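/- Let $n\ge 4$ and $k\in\{1,\dots,n\}$. Let $\mathcal M_{0,n}$ be the moduli space of rational tropical curves with $n$ marked leaves: isometry classes of finite trees without 2-valent vertices, whose 1-valent vertices are in bijection with $\{1,\dots,n\}$ and whose bounded (i.e. non-leaf) edges have positive real lengths. For disjoint pairs $(a,b)$, $(c,d)$ of markings, the double ratio of a curve is the length of the intersection of the path from $a$ to $b$ with the path from $c$ to $d$, taken with positive sign if the orientations of the two paths agree on it and with negative sign otherwise. Taking one double ratio for each of the $N$ unordered pairs of disjoint unordered pairs of markings (the choice of orders only changes signs of coordinates) gives an embedding $\iota:\mathcal M_{0,n}\to\mathbb R^N$, and $\mathcal M_{0,n}$ carries the topology induced from $\mathbb R^N$. Each combinatorial type of marked trees (trees up to isomorphism respecting the markings, ignoring lengths) defines a face of $\mathcal M_{0,n}$, the closure of the set of curves of this type; its dimension is the number of bounded edges. The tropical $\psi_k$-divisor $\Psi_k\subset\mathcal M_{0,n}$ is the union of those $(n-4)$-dimensional faces whose combinatorial type has a 4-valent vertex adjacent to the leaf marked by $k$, each taken with multiplicity $1$. **Proposition.** $\Psi_k$ is a divisor. That is, with $d=n-4$,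 the images under $\iota$ of these faces are the facets of a $d$-dimensional polyhedral complex in $\mathbb R^N$ (they are finitely many nonempty $d$-dimensional convex polyhedra, defined by inequalities with integer slopes, and the intersection of any number of them is a common face, the empty set being allowed as a face), and with all weights $w_F=1$ this complex satisfies the balancing condition: let $E$ be a $(d-1)$-dimensional face of a facet, and let $L\subset\mathbb R^N$ be an affine subspace of dimension $N-d$ with integer slope that meets the relative interior of $E$; then for all sufficiently small generic $v\in\mathbb R^N$ (outside finitely many proper linear subspaces) every facet $F\supseteq E$ meets $L+v$ in at most one point, and the number $$\iota_L=\sum_{F\supseteq E,\ F\cap(L+v)\ne\emptyset} w_F\,[\mathbb Z^N:\Lambda_F+\Lambda_L]$$ does not depend on $v$, where $\Lambda_F,\Lambda_L\subset\mathbb Z^N$ are the groups of integer vectors parallel to $F$ and to $L$. (An infinite index is read as $0$.) -/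

import Mathlib

/-! ### Tropical rational curves with marked leaves -/

/-- A combinatorial type of rational tropical curve with `n` marked leaves: a finite tree whose
1-valent vertices are labelled bijectively by `Fin n` and which has no 2-valent vertex. -/
structure MarkedTree (n : ℕ) where
  V : Type
  finite : Finite V
  graph : SimpleGraph V
  isTree : graph.IsTree
  leaf : Fin n → V
  leaf_injective : Function.Injective leaf
  leaf_iff : ∀ v, (graph.neighborSet v).ncard = 1 ↔ v ∈ Set.range leaf
  no_bivalent : ∀ v, (graph.neighborSet v).ncard ≠ 2

namespace MarkedTree

variable {n : ℕ}

/-- The valence of a vertex. -/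
noncomputable def valence (T : MarkedTree n) (v : T.V) : ℕ := (T.graph.neighborSet v).ncard

/-- A bounded edge: an edge that is not adjacent to any leaf. (The leaf edges have infinite
length.) -/
def BoundedEdge (T : MarkedTree n) : Type :=
  {e : Sym2 T.V // e ∈ T.graph.edgeSet ∧ ∀ i, T.leaf i ∉ e}

/-- The oriented edge `δ` is traversed, in its own direction, by the embedded path from the leaf
marked `a` to the leaf marked `b`. -/
def OnPath (T : MarkedTree n) (a b : Fin n) (δ : T.graph.Dart) : Prop :=
  ∃ p : T.graph.Walk (T.leaf a) (T.leaf b), p.IsPath ∧ δ ∈ p.darts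

open Classical in
/-- The sign with which the edge `e` enters the double ratio of `(a, b)` and `(c, d)`: it is `1` if
the paths from `a` to `b` and from `c` to `d` both run through `e` in the same direction, `-1` if
they run through `e` in opposite directions, `0` if one of them does not run through `e`. -/
noncomputable def sign (T : MarkedTree n) (a b c d : Fin n) (e : T.BoundedEdge) : ℤ :=
  if ∃ δ : T.graph.Dart, δ.edge = e.1 ∧ T.OnPath a b δ ∧ T.OnPath c d δ then 1
  else if ∃ δ : T.graph.Dart, δ.edge = e.1 ∧ T.OnPath a b δ ∧ T.OnPath c d δ.symm then -1
  else 0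

/-- Two marked trees have the same combinatorial type. -/
def Iso (S T : MarkedTree n) : Prop :=
  ∃ φ : S.graph ≃g T.graph, ∀ i, φ (S.leaf i) = T.leaf i

end MarkedTree

/-- A rational tropical curve with `n` marked leaves: a marked tree whose bounded edges have
positive real lengths. -/
structure TropicalCurve (n : ℕ) extends MarkedTree n where
  length : toMarkedTree.BoundedEdge → ℝ
  length_pos : ∀ e, 0 < length e

namespace TropicalCurve

variable {n : ℕ}

/-- Isometry of tropical curves respecting the markings. -/
def Iso (X Y : TropicalCurve n) : Prop :=
  ∃ φ : X.graph ≃g Y.graph, (∀ i, φ (X.leaf i) = Y.leaf i) ∧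
    ∀ (e : X.BoundedEdge) (e' : Y.BoundedEdge), e'.1 = e.1.map φ → X.length e = Y.length e'

/-- The double ratio of two ordered pairs of marked points: the signed length of the intersection
of the path from `a` to `b` with the path from `c` to `d`. -/
noncomputable def doubleRatio (X : TropicalCurve n) (a b c d : Fin n) : ℝ :=
  ∑ᶠ e : X.BoundedEdge, (X.sign a b c d e : ℝ) * X.length e

theorem Iso.refl (X : TropicalCurve n) : X.Iso X := by
  refine ⟨RelIso.refl _, fun _ => rfl, fun e e' h => ?_⟩
  have : e' = e := Subtype.ext (h.trans (by
    change Sym2.map id e.1 = e.1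
    simp))
  rw [this]

theorem Iso.symm {X Y : TropicalCurve n} (h : X.Iso Y) : Y.Iso X := by
  obtain ⟨φ, hl, hlen⟩ := h
  refine ⟨φ.symm, fun i => by rw [← hl i]; simp, fun e e' h => (hlen e' e ?_).symm⟩
  rw [h, Sym2.map_map]
  have : (φ : X.V → Y.V) ∘ (φ.symm : Y.V → X.V) = id := by ext; simp
  rw [this, Sym2.map_id, id]

theorem edge_map {X Y : TropicalCurve n} (φ : X.graph ≃g Y.graph)
    (hl : ∀ i, φ (X.leaf i) = Y.leaf i) (e : X.BoundedEdge) :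
    e.1.map φ ∈ Y.graph.edgeSet ∧ ∀ i, Y.leaf i ∉ e.1.map φ := by
  refine ⟨?_, fun i hi => ?_⟩
  · obtain ⟨e, he, -⟩ := e
    induction e with
    | _ u v => exact φ.map_rel_iff.2 he
  · obtain ⟨x, hx, hxi⟩ := Sym2.mem_map.1 hi
    rw [← hl i] at hxi
    exact e.2.2 i (φ.injective hxi ▸ hx)

theorem Iso.trans {X Y Z : TropicalCurve n} (h : X.Iso Y) (h' : Y.Iso Z) : X.Iso Z := by
  obtain ⟨φ, hl, hlen⟩ := h
  obtain ⟨ψ, hl', hlen'⟩ := h'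
  refine ⟨φ.trans ψ, fun i => by simp [hl, hl'], fun e e' h => ?_⟩
  refine (hlen e ⟨_, edge_map φ hl e⟩ rfl).trans (hlen' _ e' ?_)
  rw [h]
  simp only [Sym2.map_map]
  rfl

theorem onPath_map {X Y : TropicalCurve n} (φ : X.graph ≃g Y.graph)
    (hl : ∀ i, φ (X.leaf i) = Y.leaf i) {a b : Fin n} {δ : X.graph.Dart} (h : X.OnPath a b δ) :
    Y.OnPath a b (φ.toHom.mapDart δ) := by
  obtain ⟨p, hp, hδ⟩ := h
  refine ⟨(p.map φ.toHom).copy (hl a) (hl b), ?_, ?_⟩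
  · rw [SimpleGraph.Walk.isPath_copy]
    exact hp.map φ.injective
  · rw [SimpleGraph.Walk.darts_copy, SimpleGraph.Walk.darts_map]
    exact List.mem_map_of_mem hδ

open Classical in
theorem sign_map {X Y : TropicalCurve n} (φ : X.graph ≃g Y.graph)
    (hl : ∀ i, φ (X.leaf i) = Y.leaf i) (a b c d : Fin n) (e : X.BoundedEdge) :
    Y.sign a b c d ⟨_, edge_map φ hl e⟩ = X.sign a b c d e := by
  have hl' : ∀ i, φ.symm (Y.leaf i) = X.leaf i := fun i => by rw [← hl i]; simp
  have back : ∀ δ : Y.graph.Dart, δ.edge = e.1.map φ →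
      (φ.symm.toHom.mapDart δ).edge = e.1 := by
    intro δ hδ
    have h1 : (φ.symm.toHom.mapDart δ).edge = δ.edge.map φ.symm := rfl
    rw [h1, hδ, Sym2.map_map]
    have : (φ.symm : Y.V → X.V) ∘ (φ : X.V → Y.V) = id := by ext; simp
    rw [this, Sym2.map_id, id]
  have fwd : ∀ δ : X.graph.Dart, δ.edge = e.1 → (φ.toHom.mapDart δ).edge = e.1.map φ := by
    intro δ hδ
    rw [← hδ]
    rfl
  unfold MarkedTree.sign
  refine if_congr ⟨?_, ?_⟩ rfl (if_congr ⟨?_, ?_⟩ rfl rfl)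
  · rintro ⟨δ, hδ, h1, h2⟩
    exact ⟨_, back δ hδ, onPath_map φ.symm hl' h1, onPath_map φ.symm hl' h2⟩
  · rintro ⟨δ, hδ, h1, h2⟩
    exact ⟨_, fwd δ hδ, onPath_map φ hl h1, onPath_map φ hl h2⟩
  · rintro ⟨δ, hδ, h1, h2⟩
    exact ⟨_, back δ hδ, onPath_map φ.symm hl' h1, onPath_map φ.symm hl' h2⟩
  · rintro ⟨δ, hδ, h1, h2⟩
    exact ⟨_, fwd δ hδ, onPath_map φ hl h1, onPath_map φ hl h2⟩

theorem Iso.doubleRatio_eq {X Y : TropicalCurve n} (h : X.Iso Y) (a b c d : Fin n) :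
    X.doubleRatio a b c d = Y.doubleRatio a b c d := by
  obtain ⟨φ, hl, hlen⟩ := h
  have hl' : ∀ i, φ.symm (Y.leaf i) = X.leaf i := fun i => by rw [← hl i]; simp
  refine finsum_eq_of_bijective (fun e : X.BoundedEdge => ⟨_, edge_map φ hl e⟩) ⟨?_, ?_⟩ ?_
  · intro e e' h
    exact Subtype.ext (Sym2.map.injective φ.injective (congrArg Subtype.val h))
  · intro e
    refine ⟨⟨_, edge_map φ.symm hl' e⟩, Subtype.ext ?_⟩
    change Sym2.map φ (Sym2.map φ.symm e.1) = e.1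
    rw [Sym2.map_map]
    have : (φ : X.V → Y.V) ∘ (φ.symm : Y.V → X.V) = id := by ext; simp
    rw [this, Sym2.map_id, id]
  · intro e
    rw [sign_map φ hl, hlen e ⟨_, edge_map φ hl e⟩ rfl]

/-- Isometry as an equivalence relation. -/
instance setoid (n : ℕ) : Setoid (TropicalCurve n) where
  r := Iso
  iseqv := ⟨Iso.refl, Iso.symm, Iso.trans⟩

end TropicalCurve

/-! ### The moduli space and its embedding by double ratios -/

/-- The moduli space of rational tropical curves with `n` marked leaves. -/
def TropicalModuli (n : ℕ) : Type 1 := Quotient (TropicalCurve.setoid n)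

/-- The decompositions `{{a, b}, {c, d}}` into two disjoint pairs of markings, each represented
once, by `a < b`, `c < d`, `a < c`. -/
def PairOfPairs (n : ℕ) : Type :=
  {q : Fin n × Fin n × Fin n × Fin n //
    q.1 < q.2.1 ∧ q.2.2.1 < q.2.2.2 ∧ q.1 < q.2.2.1 ∧ q.2.1 ≠ q.2.2.1 ∧ q.2.1 ≠ q.2.2.2}

instance (n : ℕ) : Fintype (PairOfPairs n) :=
  inferInstanceAs (Fintype {q : Fin n × Fin n × Fin n × Fin n //
    q.1 < q.2.1 ∧ q.2.2.1 < q.2.2.2 ∧ q.1 < q.2.2.1 ∧ q.2.1 ≠ q.2.2.1 ∧ q.2.1 ≠ q.2.2.2})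

namespace TropicalModuli

/-- The embedding of the moduli space in `ℝ^N` by all double ratios. -/
noncomputable def embedding (n : ℕ) : TropicalModuli n → (PairOfPairs n → ℝ) :=
  Quotient.lift
    (fun X q => X.doubleRatio q.1.1 q.1.2.1 q.1.2.2.1 q.1.2.2.2)
    (fun _ _ h => funext fun _ => TropicalCurve.Iso.doubleRatio_eq h _ _ _ _)

/-- The topology of the moduli space, for which the map `embedding n` is inducing. -/
noncomputable instance (n : ℕ) : TopologicalSpace (TropicalModuli n) :=
  TopologicalSpace.induced (embedding n) inferInstance

/-- The tropical curves of combinatorial type `T`. -/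
def stratum {n : ℕ} (T : MarkedTree n) : Set (TropicalModuli n) :=
  {x | ∃ X : TropicalCurve n, Quotient.mk _ X = x ∧ X.toMarkedTree.Iso T}

/-- The (closed) face of the moduli space that corresponds to the combinatorial type `T`. -/
def face {n : ℕ} (T : MarkedTree n) : Set (TropicalModuli n) := closure (stratum T)

end TropicalModuli

/-! ### Weighted polyhedral complexes in `ℝ^N` and the balancing condition -/

section Balancing

variable {ι : Type*} [Fintype ι]

/-- The group of integer vectors lying in a linear subspace `D` of `ℝ^N`. -/
def latticeOf (D : Submodule ℝ (ι → ℝ)) : AddSubgroup (ι → ℤ) where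
  carrier := {z | (fun i => (z i : ℝ)) ∈ D}
  zero_mem' := by
    have : (fun i => (((0 : ι → ℤ) i : ℤ) : ℝ)) = 0 := by ext; simp
    simp only [Set.mem_ofPred_eq, this, D.zero_mem]
  add_mem' := by
    intro x y hx hy
    have : (fun i => (((x + y) i : ℤ) : ℝ)) = (fun i => (x i : ℝ)) + fun i => (y i : ℝ) := by
      ext; simp
    simp only [Set.mem_ofPred_eq, this]
    exact D.add_mem hx hy
  neg_mem' := by
    intro x hx
    have : (fun i => (((-x) i : ℤ) : ℝ)) = -fun i => (x i : ℝ) := by ext; simp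
    simp only [Set.mem_ofPred_eq, this]
    exact D.neg_mem hx

/-- A linear subspace of `ℝ^N` has integer slope if it is spanned by integer vectors. -/
def HasIntegerSlope (D : Submodule ℝ (ι → ℝ)) : Prop :=
  Submodule.span ℝ ((fun (z : ι → ℤ) (i : ι) => (z i : ℝ)) '' (latticeOf D : Set (ι → ℤ))) = D

/-- A convex polyhedron (possibly unbounded) with integer slopes. -/
def IsIntegerPolyhedron (P : Set (ι → ℝ)) : Prop :=
  ∃ (m : ℕ) (a : Fin m → ι → ℤ) (b : Fin m → ℝ),
    P = {x | ∀ j, ∑ i, (a j i : ℝ) * x i ≤ b j}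

/-- The dimension of a convex set. -/
noncomputable def polyDim (P : Set (ι → ℝ)) : ℕ := Module.finrank ℝ (vectorSpan ℝ P)

/-- `facets` are the facets of a `d`-dimensional polyhedral complex: finitely many `d`-dimensional
polyhedra such that the intersection of any number of them is a common face. (The empty set counts
as a face.) -/
def IsPolyhedralComplex (d : ℕ) (facets : Set (Set (ι → ℝ))) : Prop :=
  facets.Finite ∧
  (∀ F ∈ facets, F.Nonempty ∧ IsIntegerPolyhedron F ∧ polyDim F = d) ∧
  ∀ S ⊆ facets, ∀ F ∈ S, IsExposed ℝ F (⋂₀ S)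

/-- The number `ι_L` for the displacement `v`: the sum, over the facets `F` adjacent to `E` that
meet `L + v`, of the weight of `F` times the index in `ℤ^N` of the sum of the lattices of integer
vectors parallel to `F` and to `L`. -/
noncomputable def intersectionSum (facets : Set (Set (ι → ℝ))) (weight : Set (ι → ℝ) → ℕ)
    (E : Set (ι → ℝ)) (L : AffineSubspace ℝ (ι → ℝ)) (v : ι → ℝ) : ℕ :=
  ∑ᶠ F ∈ {F ∈ facets | E ⊆ F ∧ ∃ x ∈ F, x - v ∈ L},
    weight F * (latticeOf (vectorSpan ℝ F) ⊔ latticeOf L.direction).index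

/-- The balancing condition for a `d`-dimensional weighted polyhedral complex: for every
`(d-1)`-dimensional face `E` and every affine subspace `L` of codimension `d` with integer slope
that meets `E` (in a relative interior point), and for small generic `v`, the facets adjacent to `E`
meet `L + v` in at most one point each and the number `ι_L` does not depend on `v`.
Here "generic" means: outside finitely many proper linear subspaces. -/
def IsBalanced (d : ℕ) (facets : Set (Set (ι → ℝ))) (weight : Set (ι → ℝ) → ℕ) : Prop :=
  ∀ F₀ ∈ facets, ∀ E, IsExposed ℝ F₀ E → polyDim E + 1 = d →
  ∀ L : AffineSubspace ℝ (ι → ℝ), HasIntegerSlope L.direction →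
    Module.finrank ℝ L.direction + d = Fintype.card ι →
    (∃ p ∈ intrinsicInterior ℝ E, p ∈ L) →
  ∃ (c : ℕ) (B : Set (Submodule ℝ (ι → ℝ))) (ε : ℝ),
    B.Finite ∧ (∀ H ∈ B, H ≠ ⊤) ∧ 0 < ε ∧
    ∀ v : ι → ℝ, ‖v‖ < ε → (∀ H ∈ B, v ∉ H) →
      (∀ F ∈ facets, E ⊆ F → {x ∈ F | x - v ∈ L}.Subsingleton) ∧
      intersectionSum facets weight E L v = c

/-- A weighted polyhedral complex is a `d`-dimensional tropical cycle (a divisor, if it is a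
subcomplex of a `(d+1)`-dimensional tropical variety): its facets form a `d`-dimensional polyhedral
complex, they have positive weights, and the balancing condition holds. -/
def IsTropicalCycle (d : ℕ) (facets : Set (Set (ι → ℝ))) (weight : Set (ι → ℝ) → ℕ) : Prop :=
  IsPolyhedralComplex d facets ∧ (∀ F ∈ facets, 0 < weight F) ∧ IsBalanced d facets weight

end Balancing

/-! ### The tropical psi-divisors -/

/-- The faces of the moduli space that make up the tropical `ψ_k`-divisor: those `(n-4)`-dimensional
faces that correspond to curves with a 4-valent vertex adjacent to the leaf marked by `k`. (The
dimension of a face is the number of bounded edges.) -/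
def psiFaces (n : ℕ) (k : Fin n) : Set (Set (TropicalModuli n)) :=
  {F | ∃ T : MarkedTree n, Nat.card T.BoundedEdge + 4 = n ∧
    (∃ v, T.graph.Adj (T.leaf k) v ∧ T.valence v = 4) ∧ F = TropicalModuli.face T}

/-- The facets of the tropical `ψ_k`-divisor, embedded in `ℝ^N`. -/
def psiFacets (n : ℕ) (k : Fin n) : Set (Set (PairOfPairs n → ℝ)) :=
  {P | ∃ F ∈ psiFaces n k, P = TropicalModuli.embedding n '' F}

/-- Each facet of the tropical `ψ_k`-divisor has multiplicity 1. -/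
def psiWeight (n : ℕ) : Set (PairOfPairs n → ℝ) → ℕ := fun _ => 1

/-!
The moduli space is rooted at the leaf `k`. Cutting a bounded edge of a tree separates from `k` a set
`A` of markings, its cluster, and a combinatorial type amounts to the laminar family `M` of its
clusters (`IsClusterSystem`). The tree is recovered as the Hasse diagram of `M` together with the
singletons, the set of all markings but `k`, and the set of all markings (`IsHierarchy.markedTree`);
every marked tree arises in this way (`MarkedTree.iso_markedTree`). Contracting edges means passing to
a subfamily.

In the double ratio of `(a, b)` and `(c, d)`, an edge with cluster `A` has the sign
`(1_A(a) - 1_A(b)) (1_A(c) - 1_A(d))`. So the embedding maps a curve to the combination of the vectors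
`splitVector A`, `A ∈ M`, with the edge lengths as coefficients, and the face of `M` to the cone
spanned by these vectors (`IsClusterSystem.embedding_image_face`). The facets of the `ψ_k`-divisor are
the cones of those `M` with `n - 4` members for which the root vertex has three children
(`psiFacets_eq`). That these cones form a balanced fan (`isBalancedFan_psiFamily`) rests on three
facts.

* For each `A ∈ M` there is a double ratio that `A` contributes to with the sign `1` and the other
  members of `M` do not contribute to (`IsClusterSystem.exists_isDualOn`). So the cones are simplicial,
  and their rays form lattice bases.
* The length of an edge is a minimum of double ratios, as in Buneman's reconstruction of a tree from
  its quartets. So a point has the same coefficients in all cones that contain it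
  (`IsClusterSystem.combine_injective`), and cones meet in common faces.
* A cone of codimension one has one special vertex: the root vertex with four children, or another
  vertex with three. The facets around the cone arise by joining two children of this vertex. As
  `splitVector` is quadratic in the indicator function, the sum of the six or three new rays is a
  combination of the vectors of the special vertex and of its children, hence lies in the span of the
  cone (`IsClusterSystem.sum_splitVector_mem`).

For any such fan, the balancing condition for intersections with affine subspaces follows
(`IsBalancedFan.isBalanced`): if `φ` is an integer functional whose kernel is spanned by the direction
of `L` and the cone `E`, then the index belonging to a facet with the additional ray `u` is
proportional to `|φ u|` (`index_sup_zmultiples`), a translate of `L` meets the facets with `φ u > 0` on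
one side and those with `φ u < 0` on the other side, and the values `φ u` add up to zero.
-/

/-! ### Simplicial cones spanned by integer vectors -/

section Fan

variable {ι α : Type*}

/-- An integer vector, viewed in real coordinates. -/
def castVec (z : ι → ℤ) : ι → ℝ := fun i => (z i : ℝ)

/-- The linear span of the vectors `Q a` with `a ∈ S`. -/
def coneSpan (Q : α → ι → ℤ) (S : Finset α) : Submodule ℝ (ι → ℝ) :=
  Submodule.span ℝ ((fun a => castVec (Q a)) '' (S : Set α))

theorem castVec_mem_coneSpan (Q : α → ι → ℤ) {S : Finset α} {a : α} (ha : a ∈ S) :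
    castVec (Q a) ∈ coneSpan Q S :=
  Submodule.subset_span ⟨a, ha, rfl⟩

theorem coneSpan_insert [DecidableEq α] (Q : α → ι → ℤ) (R : Finset α) (b : α) :
    coneSpan Q (insert b R) = coneSpan Q R ⊔ Submodule.span ℝ {castVec (Q b)} := by
  rw [coneSpan, Finset.coe_insert, Set.image_insert_eq, Submodule.span_insert, sup_comm]
  rfl

section Functionals

variable [Fintype ι]

/-- The linear functional on `ℝ^ι` with integer coefficients `z`. -/
noncomputable def pairing (z : ι → ℤ) : (ι → ℝ) →ₗ[ℝ] ℝ := ∑ i, (z i : ℝ) • LinearMap.proj i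

theorem pairing_apply (z : ι → ℤ) (x : ι → ℝ) : pairing z x = ∑ i, (z i : ℝ) * x i := by
  simp [pairing]

theorem pairing_castVec (z w : ι → ℤ) : pairing z (castVec w) = ((z ⬝ᵥ w : ℤ) : ℝ) := by
  simp [pairing_apply, castVec, dotProduct]

/-- The integer functionals `f a` are dual to the vectors `Q a` as long as `a ∈ S`. Their existence
says that these vectors form a basis of the integer points of their linear span. -/
def IsDualOn [DecidableEq α] (Q : α → ι → ℤ) (S : Finset α) (f : α → ι → ℤ) : Prop :=
  ∀ a ∈ S, ∀ b ∈ S, f a ⬝ᵥ Q b = if a = b then 1 else 0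

namespace IsDualOn

variable [DecidableEq α] {Q : α → ι → ℤ} {S : Finset α} {f : α → ι → ℤ}

theorem mono (hf : IsDualOn Q S f) {R : Finset α} (h : R ⊆ S) : IsDualOn Q R f :=
  fun a ha b hb => hf a (h ha) b (h hb)

theorem finrank_coneSpan (hf : IsDualOn Q S f) : Module.finrank ℝ (coneSpan Q S) = S.card := by
  have hli : LinearIndependent ℝ fun a : S => castVec (Q a) := by
    rw [Fintype.linearIndependent_iff]
    intro g hg a
    have := congrArg (pairing (f a)) hg
    rw [map_sum, Finset.sum_eq_single a] at this
    · simpa [pairing_castVec, hf a a.2 a a.2] using this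
    · intro b _ hb
      have : (a : α) ≠ b := fun h => hb (Subtype.ext h.symm)
      simp [pairing_castVec, hf a a.2 b b.2, this]
    · simp
  have hr : (Set.range fun a : S => castVec (Q a)) = (fun a => castVec (Q a)) '' (S : Set α) :=
    (Set.range_comp (fun a => castVec (Q a)) ((↑) : S → α)).trans (by rw [Subtype.range_coe])
  have := finrank_span_eq_card hli
  rw [Fintype.card_coe, hr] at this
  exact this

end IsDualOn

end Functionals

variable [Fintype α]

/-- The linear map that sends a family of coefficients to the linear combination of the integer
vectors `Q a` with these coefficients. -/
noncomputable def combine (Q : α → ι → ℤ) : (α → ℝ) →ₗ[ℝ] (ι → ℝ) :=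
  Fintype.linearCombination ℝ fun a => castVec (Q a)

theorem combine_apply (Q : α → ι → ℤ) (t : α → ℝ) : combine Q t = ∑ a, t a • castVec (Q a) := rfl

theorem combine_apply_coord (Q : α → ι → ℤ) (t : α → ℝ) (i : ι) :
    combine Q t i = ∑ a, t a * (Q a i : ℝ) := by
  simp [combine_apply, castVec]

theorem combine_single [DecidableEq α] (Q : α → ι → ℤ) (a : α) (r : ℝ) :
    combine Q (Pi.single a r) = r • castVec (Q a) := by
  rw [combine_apply, Finset.sum_eq_single a] <;> simp +contextual

/-- The cone spanned by the vectors `Q a` with `a ∈ S`; coefficients are extended by zero. -/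
def simplicialCone (Q : α → ι → ℤ) (S : Finset α) : Set (ι → ℝ) :=
  {x | ∃ t : α → ℝ, (∀ a, 0 ≤ t a) ∧ (∀ a ∉ S, t a = 0) ∧ combine Q t = x}

theorem combine_mem_coneSpan {Q : α → ι → ℤ} {S : Finset α} {t : α → ℝ}
    (ht : ∀ a ∉ S, t a = 0) : combine Q t ∈ coneSpan Q S := by
  rw [combine_apply]
  refine Submodule.sum_mem _ fun a _ => ?_
  by_cases ha : a ∈ S
  · exact Submodule.smul_mem _ _ (castVec_mem_coneSpan Q ha)
  · simp [ht a ha]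

theorem mem_coneSpan_iff {Q : α → ι → ℤ} {S : Finset α} {x : ι → ℝ} :
    x ∈ coneSpan Q S ↔ ∃ t : α → ℝ, (∀ a ∉ S, t a = 0) ∧ combine Q t = x := by
  classical
  refine ⟨fun hx => ?_, fun ⟨t, ht, h⟩ => h ▸ combine_mem_coneSpan ht⟩
  induction hx using Submodule.span_induction with
  | mem x h =>
    obtain ⟨a, ha, rfl⟩ := h
    refine ⟨Pi.single a 1, fun b hb => ?_, by simp [combine_single]⟩
    rw [Pi.single_eq_of_ne]
    rintro rfl
    exact hb ha
  | zero => exact ⟨0, by simp, by simp⟩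
  | add x y _ _ hx hy =>
    obtain ⟨t, ht, rfl⟩ := hx
    obtain ⟨s, hs, rfl⟩ := hy
    exact ⟨t + s, fun a ha => by simp [ht a ha, hs a ha], by simp⟩
  | smul r x _ hx =>
    obtain ⟨t, ht, rfl⟩ := hx
    exact ⟨r • t, fun a ha => by simp [ht a ha], by simp⟩

theorem simplicialCone_subset_coneSpan (Q : α → ι → ℤ) (S : Finset α) :
    simplicialCone Q S ⊆ coneSpan Q S := by
  rintro x ⟨t, -, ht, rfl⟩
  exact combine_mem_coneSpan ht

theorem simplicialCone_mono (Q : α → ι → ℤ) {S S' : Finset α} (h : S ⊆ S') :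
    simplicialCone Q S ⊆ simplicialCone Q S' := by
  rintro x ⟨t, h0, ht, rfl⟩
  exact ⟨t, h0, fun a ha => ht a fun h' => ha (h h'), rfl⟩

theorem zero_mem_simplicialCone (Q : α → ι → ℤ) (S : Finset α) : 0 ∈ simplicialCone Q S :=
  ⟨0, by simp, by simp, by simp⟩

theorem castVec_mem_simplicialCone (Q : α → ι → ℤ) {S : Finset α} {a : α} (ha : a ∈ S) :
    castVec (Q a) ∈ simplicialCone Q S := by
  classical
  refine ⟨Pi.single a 1, fun b => ?_, fun b hb => ?_, by simp [combine_single]⟩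
  · by_cases h : b = a
    · subst h; simp
    · simp [h]
  · rw [Pi.single_eq_of_ne]
    rintro rfl
    exact hb ha

theorem affineSpan_simplicialCone (Q : α → ι → ℤ) (S : Finset α) :
    (affineSpan ℝ (simplicialCone Q S)).direction = coneSpan Q S := by
  rw [direction_affineSpan, vectorSpan_eq_span_vsub_set_right ℝ (zero_mem_simplicialCone Q S)]
  simp only [vsub_eq_sub, sub_zero, Set.image_id']
  refine le_antisymm (Submodule.span_le.2 (simplicialCone_subset_coneSpan Q S))
    (Submodule.span_le.2 ?_)
  rintro _ ⟨a, ha, rfl⟩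
  exact Submodule.subset_span (castVec_mem_simplicialCone Q ha)

theorem vectorSpan_simplicialCone (Q : α → ι → ℤ) (S : Finset α) :
    vectorSpan ℝ (simplicialCone Q S) = coneSpan Q S := by
  rw [← direction_affineSpan, affineSpan_simplicialCone]

/-- The nonempty exposed faces of a cone are spanned by subsets of its rays. -/
theorem exists_simplicialCone_eq_of_isExposed (Q : α → ι → ℤ) {S : Finset α}
    {E : Set (ι → ℝ)} (hE : IsExposed ℝ (simplicialCone Q S) E) (hne : E.Nonempty) :
    ∃ R ⊆ S, E = simplicialCone Q R := by
  classical
  obtain ⟨l, rfl⟩ := hE hne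
  obtain ⟨y, ⟨s, s0, hs, rfl⟩, hmax⟩ := hne
  have hl : ∀ t : α → ℝ, l (combine Q t) = ∑ a, t a * l (castVec (Q a)) := fun t => by
    simp [combine_apply]
  -- The maximum of a linear functional on a cone is not changed by doubling, so it is zero.
  have hy0 : l (combine Q s) = 0 := by
    have h1 := hmax 0 (zero_mem_simplicialCone Q S)
    have h2 := hmax (combine Q ((2 : ℝ) • s)) ⟨(2 : ℝ) • s, fun a => by
      simpa using s0 a, fun a ha => by simp [hs a ha], rfl⟩
    rw [map_smul, map_smul, smul_eq_mul] at h2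
    rw [map_zero] at h1
    linarith
  have hneg : ∀ a ∈ S, l (castVec (Q a)) ≤ 0 := fun a ha =>
    hy0 ▸ hmax _ (castVec_mem_simplicialCone Q ha)
  refine ⟨S.filter fun a => l (castVec (Q a)) = 0, Finset.filter_subset _ _, ?_⟩
  ext x
  constructor
  · rintro ⟨⟨t, t0, ht, rfl⟩, hx⟩
    have h0 : l (combine Q t) = 0 := by
      refine le_antisymm (hy0 ▸ hmax _ ⟨t, t0, ht, rfl⟩) ?_
      simpa using hx 0 (zero_mem_simplicialCone Q S)
    rw [hl, Finset.sum_eq_zero_iff_of_nonpos] at h0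
    · refine ⟨t, t0, fun a ha => ?_, rfl⟩
      by_cases haS : a ∈ S
      · rcases mul_eq_zero.1 (h0 a (Finset.mem_univ a)) with h | h
        · exact h
        · exact absurd (Finset.mem_filter.2 ⟨haS, h⟩) ha
      · exact ht a haS
    · intro a _
      by_cases haS : a ∈ S
      · exact mul_nonpos_of_nonneg_of_nonpos (t0 a) (hneg a haS)
      · simp [ht a haS]
  · rintro ⟨t, t0, ht, rfl⟩
    refine ⟨⟨t, t0, fun a ha => ht a fun h => ha (Finset.mem_filter.1 h).1, rfl⟩, ?_⟩
    have h0 : l (combine Q t) = 0 := by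
      rw [hl]
      refine Finset.sum_eq_zero fun a _ => ?_
      by_cases ha : a ∈ S.filter fun a => l (castVec (Q a)) = 0
      · rw [(Finset.mem_filter.1 ha).2, mul_zero]
      · rw [ht a ha, zero_mul]
    intro z hz
    rw [h0, ← hy0]
    exact hmax z hz

variable [Fintype ι]

namespace IsDualOn

variable [DecidableEq α] {Q : α → ι → ℤ} {S : Finset α} {f : α → ι → ℤ}

theorem pairing_combine (hf : IsDualOn Q S f) {t : α → ℝ} (ht : ∀ a ∉ S, t a = 0) {a : α}
    (ha : a ∈ S) : pairing (f a) (combine Q t) = t a := by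
  rw [combine_apply, map_sum, Finset.sum_eq_single a]
  · simp [pairing_castVec, hf a ha a ha]
  · intro b _ hb
    by_cases hbS : b ∈ S
    · simp [pairing_castVec, hf a ha b hbS, hb.symm]
    · simp [ht b hbS]
  · simp

theorem combine_injective (hf : IsDualOn Q S f) {t s : α → ℝ} (ht : ∀ a ∉ S, t a = 0)
    (hs : ∀ a ∉ S, s a = 0) (h : combine Q t = combine Q s) : t = s := by
  funext a
  by_cases ha : a ∈ S
  · rw [← hf.pairing_combine ht ha, h, hf.pairing_combine hs ha]
  · rw [ht a ha, hs a ha]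

/-- The integer points of the span of the vectors `Q a` are their integer combinations. -/
theorem latticeOf_coneSpan (hf : IsDualOn Q S f) :
    latticeOf (coneSpan Q S) = AddSubgroup.closure (Q '' S) := by
  refine le_antisymm (fun z hz => ?_) ((AddSubgroup.closure_le _).2 ?_)
  · obtain ⟨t, ht, h⟩ := mem_coneSpan_iff.1 (show castVec z ∈ coneSpan Q S from hz)
    have hint : ∀ a ∈ S, t a = ((f a ⬝ᵥ z : ℤ) : ℝ) := fun a ha => by
      rw [← hf.pairing_combine ht ha, h, pairing_castVec]
    have : z = ∑ a ∈ S, (f a ⬝ᵥ z) • Q a := by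
      funext i
      have h1 : (z i : ℝ) = combine Q t i := (congrFun h i).symm
      rw [combine_apply_coord, ← Finset.sum_subset (Finset.subset_univ S)
        (fun a _ ha => by simp [ht a ha]), Finset.sum_congr rfl fun a ha => by rw [hint a ha]] at h1
      simp only [Finset.sum_apply, Pi.smul_apply, smul_eq_mul]
      exact_mod_cast h1
    rw [this]
    exact sum_mem fun a ha =>
      zsmul_mem (AddSubgroup.subset_closure (Set.mem_image_of_mem Q ha)) _
  · rintro _ ⟨a, ha, rfl⟩
    exact castVec_mem_coneSpan Q ha

theorem mem_simplicialCone_iff (hf : IsDualOn Q S f) {x : ι → ℝ} :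
    x ∈ simplicialCone Q S ↔ (∀ a ∈ S, 0 ≤ pairing (f a) x) ∧
      x = ∑ a ∈ S, pairing (f a) x • castVec (Q a) := by
  have key : ∀ t : α → ℝ, (∀ a ∉ S, t a = 0) →
      combine Q t = ∑ a ∈ S, t a • castVec (Q a) := fun t ht =>
    (Finset.sum_subset (Finset.subset_univ S) fun a _ ha => by simp [ht a ha]).symm
  constructor
  · rintro ⟨t, h0, ht, rfl⟩
    refine ⟨fun a ha => by rw [hf.pairing_combine ht ha]; exact h0 a, ?_⟩
    rw [Finset.sum_congr rfl fun a ha => by rw [hf.pairing_combine ht ha]]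
    exact key t ht
  · rintro ⟨h0, hx⟩
    refine ⟨fun a => if a ∈ S then pairing (f a) x else 0, fun a => ?_, fun a ha => by simp [ha],
      ?_⟩
    · dsimp only
      split_ifs with ha
      exacts [h0 a ha, le_rfl]
    · rw [key _ fun a ha => by simp [ha]]
      conv_rhs => rw [hx]
      exact Finset.sum_congr rfl fun a ha => by simp [ha]

/-- The defining inequalities of the cone: the dual functionals are nonnegative, and a point is
the combination of the `Q a` with the values of the dual functionals as coefficients. -/
theorem isIntegerPolyhedron (hf : IsDualOn Q S f) : IsIntegerPolyhedron (simplicialCone Q S) := by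
  classical
  let ρ : ι → ι → ℤ := fun i j => (if i = j then 1 else 0) - ∑ a ∈ S, f a j * Q a i
  have hρ : ∀ i x, ∑ j, (ρ i j : ℝ) * x j
      = x i - ∑ a ∈ S, pairing (f a) x * (Q a i : ℝ) := by
    intro i x
    simp only [ρ, Int.cast_sub, sub_mul, Finset.sum_sub_distrib, Int.cast_sum, Int.cast_mul,
      pairing_apply, Finset.sum_mul]
    congr 1
    · simp
    · rw [Finset.sum_comm]
      exact Finset.sum_congr rfl fun a _ => Finset.sum_congr rfl fun j _ => by ring
  let c : (S ⊕ (ι ⊕ ι)) → ι → ℤ := Sum.elim (fun a => -f a) (Sum.elim ρ fun i => -ρ i)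
  let e := Fintype.equivFin (S ⊕ (ι ⊕ ι))
  refine ⟨_, fun j => c (e.symm j), 0, ?_⟩
  ext x
  rw [hf.mem_simplicialCone_iff, Set.mem_ofPred_eq, e.symm.forall_congr_left]
  simp only [Equiv.symm_symm, Equiv.symm_apply_apply, Pi.zero_apply, Sum.forall, c, Sum.elim_inl,
    Sum.elim_inr, Pi.neg_apply, Int.cast_neg, neg_mul, Finset.sum_neg_distrib, hρ]
  simp only [← pairing_apply, Left.neg_nonpos_iff, Subtype.forall]
  refine and_congr Iff.rfl ⟨fun h => ⟨fun i => ?_, fun i => ?_⟩, fun h => ?_⟩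
  · have := congrFun h i
    simp only [Finset.sum_apply, Pi.smul_apply, smul_eq_mul, castVec] at this
    linarith
  · have := congrFun h i
    simp only [Finset.sum_apply, Pi.smul_apply, smul_eq_mul, castVec] at this
    linarith
  · funext i
    simp only [Finset.sum_apply, Pi.smul_apply, smul_eq_mul, castVec]
    have h1 := h.1 i
    have h2 := h.2 i
    linarith

/-- A functional that vanishes on the face and is negative on the remaining rays. -/
theorem isExposed (hf : IsDualOn Q S f) {R : Finset α} (hR : R ⊆ S) :
    IsExposed ℝ (simplicialCone Q S) (simplicialCone Q R) := by
  intro _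
  let l : (ι → ℝ) →ₗ[ℝ] ℝ := -∑ a ∈ S \ R, pairing (f a)
  have hl : ∀ t : α → ℝ, (∀ a ∉ S, t a = 0) → l (combine Q t) = -∑ a ∈ S \ R, t a := by
    intro t ht
    simp only [l, LinearMap.neg_apply, LinearMap.sum_apply]
    rw [Finset.sum_congr rfl fun a ha => hf.pairing_combine ht (Finset.mem_sdiff.1 ha).1]
  refine ⟨LinearMap.toContinuousLinearMap l, ?_⟩
  ext x
  simp only [Set.mem_ofPred_eq, LinearMap.coe_toContinuousLinearMap']
  constructor
  · intro hx
    refine ⟨simplicialCone_mono Q hR hx, ?_⟩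
    rintro _ ⟨s, s0, hs, rfl⟩
    obtain ⟨t, t0, ht, rfl⟩ := hx
    rw [hl s hs, hl t fun a ha => ht a fun h => ha (hR h),
      Finset.sum_eq_zero fun a ha => ht a (Finset.mem_sdiff.1 ha).2, neg_zero]
    exact neg_nonpos.2 (Finset.sum_nonneg fun a _ => s0 a)
  · rintro ⟨⟨t, t0, ht, rfl⟩, hmax⟩
    have h0 := hmax 0 (zero_mem_simplicialCone Q S)
    rw [map_zero, hl t ht] at h0
    have h1 : ∑ a ∈ S \ R, t a = 0 :=
      le_antisymm (by linarith) (Finset.sum_nonneg fun a _ => t0 a)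
    rw [Finset.sum_eq_zero_iff_of_nonneg fun a _ => t0 a] at h1
    refine ⟨t, t0, fun a ha => ?_, rfl⟩
    by_cases haS : a ∈ S
    · exact h1 a (Finset.mem_sdiff.2 ⟨haS, ha⟩)
    · exact ht a haS

end IsDualOn

/-- A point of the relative interior of a cone has positive coefficients. -/
theorem exists_pos_of_mem_intrinsicInterior [DecidableEq α] {Q : α → ι → ℤ} {R : Finset α}
    {f : α → ι → ℤ} (hf : IsDualOn Q R f) {p : ι → ℝ}
    (hp : p ∈ intrinsicInterior ℝ (simplicialCone Q R)) :
    ∃ t : α → ℝ, (∀ a ∈ R, 0 < t a) ∧ (∀ a ∉ R, t a = 0) ∧ combine Q t = p := by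
  obtain ⟨t, t0, ht, htp⟩ := intrinsicInterior_subset hp
  refine ⟨t, fun b hb => ?_, ht, htp⟩
  obtain ⟨y, hy, rfl⟩ := mem_intrinsicInterior.1 hp
  -- The point may be moved a little in the direction of `-Q b` without leaving the cone.
  have hmem : ∀ r : ℝ, (y : ι → ℝ) + r • castVec (Q b) ∈ affineSpan ℝ (simplicialCone Q R) := by
    intro r
    rw [add_comm]
    refine AffineSubspace.vadd_mem_of_mem_direction ?_ y.2
    rw [affineSpan_simplicialCone]
    exact Submodule.smul_mem _ _ (castVec_mem_coneSpan Q hb)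
  let g : ℝ → affineSpan ℝ (simplicialCone Q R) := fun r => ⟨_, hmem r⟩
  have hg : Continuous g := by
    refine Continuous.subtype_mk ?_ _
    fun_prop
  have hg0 : g 0 = y := Subtype.ext (by simp [g])
  have hnhds : g ⁻¹' ((↑) ⁻¹' simplicialCone Q R) ∈ nhds (0 : ℝ) :=
    hg.continuousAt.preimage_mem_nhds (by rw [hg0]; exact mem_interior_iff_mem_nhds.1 hy)
  obtain ⟨ε, hε, hball⟩ := Metric.mem_nhds_iff.1 hnhds
  have hin : (y : ι → ℝ) + (-(ε / 2)) • castVec (Q b) ∈ simplicialCone Q R :=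
    hball (show -(ε / 2) ∈ Metric.ball (0 : ℝ) ε by
      rw [Metric.mem_ball, Real.dist_eq, sub_zero, abs_neg, abs_of_pos] <;> linarith)
  have h1 := (hf.mem_simplicialCone_iff.1 hin).1 b hb
  rw [map_add, map_smul, ← htp, hf.pairing_combine ht hb, pairing_castVec, hf b hb b hb] at h1
  simp only [if_true, Int.cast_one, smul_eq_mul, mul_one] at h1
  linarith

end Fan

/-! ### The balancing condition for simplicial fans -/

section Balance

/-- Adding one generator `g` to a subgroup `H` of the kernel of `φ : G → ℤ` yields a subgroup whose
index is proportional to `|φ g|`. Infinite indices, which are zero, are covered. -/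
theorem index_sup_zmultiples {G : Type*} [AddCommGroup G] (φ : G →+ ℤ) {H : AddSubgroup G}
    (hH : H ≤ φ.ker) {g : G} (hg : φ g ≠ 0) :
    (H ⊔ AddSubgroup.zmultiples g).index * φ.range.index
      = H.relIndex φ.ker * (φ g).natAbs := by
  set K := H ⊔ AddSubgroup.zmultiples g with hK
  have hmap : K.map φ = AddSubgroup.zmultiples (φ g) := by
    have : H.map φ = ⊥ := by
      rw [eq_bot_iff]
      rintro _ ⟨h, hh, rfl⟩
      exact hH hh
    rw [hK, AddSubgroup.map_sup, this, bot_sup_eq, AddMonoidHom.map_zmultiples]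
  have h1 : (K ⊔ φ.ker).index * φ.range.index = (φ g).natAbs := by
    rw [← AddSubgroup.index_map, hmap, Int.index_zmultiples]
  have h2 : K.relIndex φ.ker = H.relIndex φ.ker := by
    have : K ⊓ φ.ker = H := by
      refine le_antisymm ?_ (le_inf le_sup_left hH)
      rintro x ⟨hx, hx0⟩
      obtain ⟨h, hh, y, hy, rfl⟩ := AddSubgroup.mem_sup.1 hx
      obtain ⟨m, rfl⟩ := AddSubgroup.mem_zmultiples_iff.1 hy
      have h3 : φ (h + m • g) = 0 := hx0
      rw [map_add, show φ h = 0 from hH hh, zero_add, map_zsmul, smul_eq_mul] at h3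
      rcases mul_eq_zero.1 h3 with h4 | h4
      · simpa [h4] using hh
      · exact absurd h4 hg
    rw [← AddSubgroup.inf_relIndex_right, this]
  have h3 : K.relIndex (K ⊔ φ.ker) = K.relIndex φ.ker := by
    rw [sup_comm, AddSubgroup.relIndex_sup_right]
  rw [← AddSubgroup.relIndex_mul_index (le_sup_left : K ≤ K ⊔ φ.ker), h3, h2, mul_assoc, h1]

variable {ι α : Type*} [Fintype ι] [Fintype α] [DecidableEq α]

/-- A proper subspace spanned by integer vectors lies in the kernel of an integer functional. -/
theorem exists_pairing_eq_zero {W : Submodule ℝ (ι → ℝ)} (Z : Set (ι → ℤ))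
    (hW : W = Submodule.span ℝ (castVec '' Z)) (hlt : Module.finrank ℝ W < Fintype.card ι) :
    ∃ z : ι → ℤ, z ≠ 0 ∧ W ≤ LinearMap.ker (pairing z) := by
  classical
  obtain ⟨b, hb, hspan, hli⟩ := exists_linearIndependent ℝ (castVec '' Z)
  have : Fintype b := hli.setFinite.fintype
  have hcard : Fintype.card b < Fintype.card ι := by
    have h1 := finrank_span_eq_card hli
    rw [Subtype.range_coe, hspan, ← hW] at h1
    rwa [← h1]
  obtain ⟨e⟩ : Nonempty (b ↪ ι) := Function.Embedding.nonempty_of_card_le hcard.le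
  have hb' : ∀ x, x ∈ b → ∃ z ∈ Z, castVec z = x := fun x hx => hb hx
  choose! y hyZ hy using hb'
  let M : Matrix ι ι ℤ := fun i => if h : ∃ x, e x = i then y (h.choose : b) else 0
  have hdet : M.det = 0 := by
    have hns : ¬ Function.Surjective e := fun h =>
      absurd (Fintype.card_le_of_surjective e h) (not_le.2 hcard)
    obtain ⟨i, hi⟩ := not_forall.1 hns
    exact Matrix.det_eq_zero_of_row_eq_zero i fun j => by simp only [M, dif_neg hi, Pi.zero_apply]
  obtain ⟨z, hz0, hz⟩ := Matrix.exists_mulVec_eq_zero_iff.2 hdet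
  refine ⟨z, hz0, ?_⟩
  rw [hW, ← hspan, Submodule.span_le]
  intro x hx
  have h1 := congrFun hz (e ⟨x, hx⟩)
  have hex : ∃ x', e x' = e ⟨x, hx⟩ := ⟨_, rfl⟩
  have hch : hex.choose = ⟨x, hx⟩ := e.injective hex.choose_spec
  have h2 : M (e ⟨x, hx⟩) = y x := by
    simp only [M]
    rw [dif_pos hex, hch]
  rw [Matrix.mulVec, h2, Pi.zero_apply] at h1
  rw [SetLike.mem_coe, LinearMap.mem_ker, ← hy x hx, pairing_castVec, dotProduct_comm, h1,
    Int.cast_zero]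

theorem dotProduct_self_ne_zero {z : ι → ℤ} (hz : z ≠ 0) : z ⬝ᵥ z ≠ 0 := fun h =>
  hz (dotProduct_self_eq_zero.1 h)

/-- Small vectors of `D + span` decompose into a vector of `D` and a combination with small
coefficients. -/
theorem eventually_exists_combine (Q : α → ι → ℤ) (R : Finset α) (D : Submodule ℝ (ι → ℝ))
    {p : α → ℝ} (hp : ∀ a ∈ R, 0 < p a) :
    ∀ᶠ w in nhds (0 : ι → ℝ), w ∈ D ⊔ coneSpan Q R →
      ∃ t : α → ℝ, (∀ a ∉ R, t a = 0) ∧ (∀ a ∈ R, -p a < t a) ∧ w - combine Q t ∈ D := by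
  let res : (α → ℝ) →ₗ[ℝ] (α → ℝ) :=
    LinearMap.pi fun a => if a ∈ R then LinearMap.proj a else 0
  have res_apply : ∀ t a, res t a = if a ∈ R then t a else 0 := fun t a => by
    simp only [res, LinearMap.pi_apply]
    split_ifs <;> rfl
  let Φ : (D × (α → ℝ)) →ₗ[ℝ] (ι → ℝ) := D.subtype.coprod ((combine Q).comp res)
  obtain ⟨s, hs⟩ := Φ.rangeRestrict.exists_rightInverse_of_surjective (by simp)
  let T : LinearMap.range Φ →ₗ[ℝ] (α → ℝ) := (LinearMap.snd ℝ D (α → ℝ)).comp s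
  have hT : Continuous T := T.continuous_of_finiteDimensional
  have hev : ∀ᶠ w in nhds (0 : LinearMap.range Φ), ∀ a ∈ R, -p a < T w a := by
    rw [Filter.eventually_all_finset]
    intro a ha
    have hc : Continuous fun w => T w a := (continuous_apply a).comp hT
    refine hc.continuousAt.eventually (lt_mem_nhds ?_)
    simpa using hp a ha
  rw [nhds_subtype_eq_comap, Filter.eventually_comap] at hev
  refine hev.mono fun w hw hmem => ?_
  have hran : w ∈ LinearMap.range Φ := by
    obtain ⟨δ, hδ, e, he, rfl⟩ := Submodule.mem_sup.1 hmem
    obtain ⟨t, ht, rfl⟩ := mem_coneSpan_iff.1 he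
    refine ⟨(⟨δ, hδ⟩, t), ?_⟩
    have : res t = t := by
      funext a
      rw [res_apply]
      split_ifs with ha
      exacts [rfl, (ht a ha).symm]
    simp [Φ, this]
  refine ⟨res (T ⟨w, hran⟩), fun a ha => by simp [res_apply, ha], fun a ha => ?_, ?_⟩
  · rw [res_apply, if_pos ha]
    exact hw ⟨w, hran⟩ rfl a ha
  · have h1 : Φ (s ⟨w, hran⟩) = w := congrArg Subtype.val (LinearMap.congr_fun hs ⟨w, hran⟩)
    have h2 : Φ (s ⟨w, hran⟩) = (s ⟨w, hran⟩).1 + combine Q (res (T ⟨w, hran⟩)) := rfl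
    rw [← sub_eq_iff_eq_add, h1] at h2
    exact h2 ▸ (s ⟨w, hran⟩).1.2

/-- A family `𝓕` of index sets for which the cones spanned by the integer vectors `Q a`, `a ∈ S`,
`S ∈ 𝓕`, form a balanced `d`-dimensional simplicial fan: each cone is unimodular, the coefficients
of a point do not depend on the cone, and around each cone of codimension one the sum of the
remaining rays lies in the span of this cone. -/
structure IsBalancedFan (d : ℕ) (Q : α → ι → ℤ) (𝓕 : Set (Finset α)) : Prop where
  card_eq : ∀ S ∈ 𝓕, S.card = d
  dual : ∀ S ∈ 𝓕, ∃ f, IsDualOn Q S f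
  unique : ∀ S ∈ 𝓕, ∀ S' ∈ 𝓕, ∀ t s : α → ℝ, (∀ a, 0 ≤ t a) → (∀ a ∉ S, t a = 0) →
    (∀ a, 0 ≤ s a) → (∀ a ∉ S', s a = 0) → combine Q t = combine Q s → t = s
  balanced : ∀ R a, a ∉ R → insert a R ∈ 𝓕 → ∀ A : Finset α,
    (∀ b, b ∈ A ↔ b ∉ R ∧ insert b R ∈ 𝓕) → ∑ b ∈ A, castVec (Q b) ∈ coneSpan Q R

namespace IsBalancedFan

variable {d : ℕ} {Q : α → ι → ℤ} {𝓕 : Set (Finset α)}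

theorem subset_of_simplicialCone_subset (h : IsBalancedFan d Q 𝓕) {S S' R : Finset α}
    (hS : S ∈ 𝓕) (hR : R ⊆ S) (hS' : S' ∈ 𝓕) (hsub : simplicialCone Q R ⊆ simplicialCone Q S') :
    R ⊆ S' := by
  intro a ha
  obtain ⟨s, s0, hs, hsa⟩ := hsub (castVec_mem_simplicialCone Q ha)
  by_contra haS'
  have h1 : (Pi.single a 1 : α → ℝ) = s := by
    refine h.unique S hS S' hS' _ _ (fun b => ?_) (fun b hb => ?_) s0 hs ?_
    · by_cases hba : b = a
      · subst hba; simp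
      · simp [hba]
    · exact Pi.single_eq_of_ne (fun hba : b = a => hb (hba ▸ hR ha)) _
    · rw [combine_single, one_smul, hsa]
  have h2 := congrFun h1 a
  rw [Pi.single_eq_same, hs a haS'] at h2
  exact one_ne_zero h2

/-- By uniqueness of coefficients, an intersection of facets is spanned by their common rays. -/
theorem isPolyhedralComplex (h : IsBalancedFan d Q 𝓕) :
    IsPolyhedralComplex d (simplicialCone Q '' 𝓕) := by
  classical
  refine ⟨(Set.toFinite 𝓕).image _, ?_, ?_⟩
  · rintro _ ⟨S, hS, rfl⟩
    obtain ⟨f, hf⟩ := h.dual S hS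
    refine ⟨⟨0, zero_mem_simplicialCone Q S⟩, hf.isIntegerPolyhedron, ?_⟩
    rw [polyDim, vectorSpan_simplicialCone, hf.finrank_coneSpan, h.card_eq S hS]
  · rintro 𝒮 h𝒮 F hF
    obtain ⟨S, hS, rfl⟩ := h𝒮 hF
    obtain ⟨f, hf⟩ := h.dual S hS
    have : ⋂₀ 𝒮 = simplicialCone Q
        (S.filter fun a => ∀ S' ∈ 𝓕, simplicialCone Q S' ∈ 𝒮 → a ∈ S') := by
      ext x
      constructor
      · intro hx
        obtain ⟨t, t0, ht, rfl⟩ := hx _ hF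
        refine ⟨t, t0, fun a ha => ?_, rfl⟩
        by_contra hta
        refine ha (Finset.mem_filter.2 ⟨by_contra fun hS => hta (ht a hS), fun S' hS' hmem => ?_⟩)
        obtain ⟨s, s0, hs, hst⟩ := hx _ hmem
        have hts := h.unique S hS S' hS' t s t0 ht s0 hs hst.symm
        exact by_contra fun haS' => hta (by rw [hts, hs a haS'])
      · rintro ⟨t, t0, ht, rfl⟩ G hG
        obtain ⟨S', hS', rfl⟩ := h𝒮 hG
        exact ⟨t, t0, fun a ha => ht a fun hmem => ha ((Finset.mem_filter.1 hmem).2 S' hS' hG), rfl⟩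
    rw [this]
    exact hf.isExposed (Finset.filter_subset _ _)

end IsBalancedFan

end Balance

section Balance

variable {ι α : Type*} [Fintype ι] [Fintype α] [DecidableEq α]

namespace IsBalancedFan

variable {d : ℕ} {Q : α → ι → ℤ} {𝓕 : Set (Finset α)}

/-- Let `D` be the direction of `L`. If no facet around `E` is transversal to `D`, then generic
translates of `L` miss all facets. Otherwise `D ⊕ span E` is the kernel of an integer functional `φ`;
a small translate of `L` meets the facet with the additional ray `Q b` if and only if `φ (Q b)` and
`φ v` have the same sign, and the index of this facet is proportional to `|φ (Q b)|`. So the sums for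
the two signs of `φ v` agree, because `φ` vanishes on `∑ Q b`. -/
theorem isBalanced (h : IsBalancedFan d Q 𝓕) :
    IsBalanced d (simplicialCone Q '' 𝓕) (fun _ => 1) := by
  classical
  rintro _ ⟨S, hS, rfl⟩ E hE hdim L hLint hLdim ⟨p, hpE, hpL⟩
  obtain ⟨R, hRS, rfl⟩ := exists_simplicialCone_eq_of_isExposed Q hE
    ⟨p, intrinsicInterior_subset hpE⟩
  obtain ⟨f, hf⟩ := h.dual S hS
  have hfR := hf.mono hRS
  rw [polyDim, vectorSpan_simplicialCone, hfR.finrank_coneSpan] at hdim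
  obtain ⟨p, hp0, hpR, rfl⟩ := exists_pos_of_mem_intrinsicInterior hfR hpE
  set D := L.direction with hD
  -- The rays that together with `E` span a facet.
  obtain ⟨A, hA⟩ : ∃ A : Finset α, ∀ b, b ∈ A ↔ b ∉ R ∧ insert b R ∈ 𝓕 :=
    ⟨Finset.univ.filter fun b => b ∉ R ∧ insert b R ∈ 𝓕, fun b => by simp⟩
  have hfacet : ∀ S' ∈ 𝓕, simplicialCone Q R ⊆ simplicialCone Q S' →
      ∃ b ∈ A, S' = insert b R := by
    intro S' hS' hsub
    have hRS' := h.subset_of_simplicialCone_subset hS hRS hS' hsub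
    have hcard : S'.card = R.card + 1 := by rw [h.card_eq S' hS', hdim]
    obtain ⟨b, hb, rfl⟩ := (Finset.covBy_iff_exists_insert.1
      ((Finset.covBy_iff_card_sdiff_eq_one).2 ⟨hRS', by
        rw [Finset.card_sdiff_of_subset hRS', hcard]; omega⟩))
    exact ⟨b, (hA b).2 ⟨hb, hS'⟩, rfl⟩
  have hLmem : ∀ x v : ι → ℝ, x - v ∈ L ↔ x - v - combine Q p ∈ D := fun x v => by
    rw [hD, ← AffineSubspace.vsub_right_mem_direction_iff_mem hpL, vsub_eq_sub]
  have hpspan : combine Q p ∈ coneSpan Q R := combine_mem_coneSpan hpR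
  -- `Meets b v`: the facet spanned by `E` and `Q b` meets `L + v`.
  let Meets : α → (ι → ℝ) → Prop := fun b v =>
    ∃ x ∈ simplicialCone Q (insert b R), x - v - combine Q p ∈ D
  let idx : α → ℕ := fun b => (latticeOf (coneSpan Q (insert b R)) ⊔ latticeOf D).index
  have hsum : ∀ v, intersectionSum (simplicialCone Q '' 𝓕) (fun _ => 1) (simplicialCone Q R) L v
      = ∑ b ∈ A with Meets b v, idx b := by
    intro v
    have hset : {F ∈ simplicialCone Q '' 𝓕 | simplicialCone Q R ⊆ F ∧ ∃ x ∈ F, x - v ∈ L}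
        = (fun b => simplicialCone Q (insert b R)) '' (A.filter fun b => Meets b v : Finset α) := by
      ext F
      simp only [Set.mem_ofPred_eq, Set.mem_image, Finset.coe_filter, hLmem]
      constructor
      · rintro ⟨⟨S', hS', rfl⟩, hsub, x, hx, hxD⟩
        obtain ⟨b, hb, rfl⟩ := hfacet S' hS' hsub
        exact ⟨b, ⟨hb, x, hx, hxD⟩, rfl⟩
      · rintro ⟨b, ⟨hb, x, hx, hxD⟩, rfl⟩
        exact ⟨⟨_, ((hA b).1 hb).2, rfl⟩, simplicialCone_mono Q (Finset.subset_insert _ _),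
          x, hx, hxD⟩
    rw [intersectionSum, hset, finsum_mem_image, finsum_mem_coe_finset]
    · refine Finset.sum_congr rfl fun b _ => ?_
      rw [one_mul, vectorSpan_simplicialCone]
    · intro b hb c hc hbc
      have hb' := (hA b).1 (Finset.mem_filter.1 hb).1
      have hc' := (hA c).1 (Finset.mem_filter.1 hc).1
      have := h.subset_of_simplicialCone_subset hb'.2 subset_rfl hc'.2 hbc.subset
      rcases Finset.mem_insert.1 (this (Finset.mem_insert_self b R)) with h1 | h1
      exacts [h1, absurd h1 hb'.1]
  have hmeets : ∀ b v, Meets b v → v ∈ D ⊔ coneSpan Q (insert b R) := by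
    rintro b v ⟨x, hx, hxD⟩
    have h1 : v = -(x - v - combine Q p) + (x - combine Q p) := by abel
    rw [h1]
    refine Submodule.add_mem_sup (D.neg_mem hxD) (Submodule.sub_mem _
      (simplicialCone_subset_coneSpan _ _ hx) ?_)
    rw [coneSpan_insert]
    exact Submodule.mem_sup_left hpspan
  by_cases hcase : ∀ b ∈ A, D ⊔ coneSpan Q (insert b R) ≠ ⊤
  · -- No facet is transversal to `L`: for generic `v` nothing meets `L + v`.
    refine ⟨0, (fun b => D ⊔ coneSpan Q (insert b R)) '' A, 1, A.finite_toSet.image _, ?_,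
      one_pos, fun v _ hv => ?_⟩
    · rintro _ ⟨b, hb, rfl⟩
      exact hcase b hb
    have hno : ∀ b ∈ A, ¬ Meets b v := fun b hb hm => hv _ ⟨b, hb, rfl⟩ (hmeets b v hm)
    refine ⟨?_, ?_⟩
    · rintro _ ⟨S', hS', rfl⟩ hsub
      obtain ⟨b, hb, rfl⟩ := hfacet S' hS' hsub
      rintro x ⟨hx, hxL⟩
      exact absurd ⟨x, hx, (hLmem x v).1 hxL⟩ (hno b hb)
    · rw [hsum, Finset.filter_false_of_mem hno, Finset.sum_empty]
  push Not at hcase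
  obtain ⟨b₀, hb₀, htop⟩ := hcase
  -- Now `D ⊕ span E` is a hyperplane, the kernel of an integer functional `z`.
  have hdims : Module.finrank ℝ ↥(D ⊔ coneSpan Q R) + 1 = Fintype.card ι ∧ D ⊓ coneSpan Q R = ⊥ := by
    have h1 := Submodule.finrank_sup_add_finrank_inf_eq D (coneSpan Q R)
    rw [hfR.finrank_coneSpan] at h1
    have h2 : Fintype.card ι ≤ Module.finrank ℝ ↥(D ⊔ coneSpan Q R) + 1 := by
      have h3 := Submodule.finrank_add_le_finrank_add_finrank (D ⊔ coneSpan Q R)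
        (Submodule.span ℝ {castVec (Q b₀)})
      rw [sup_assoc, ← coneSpan_insert, htop, finrank_top, Module.finrank_fintype_fun_eq_card] at h3
      have h4 : Module.finrank ℝ ↥(Submodule.span ℝ {castVec (Q b₀)}) ≤ 1 :=
        (finrank_span_le_card (R := ℝ) {castVec (Q b₀)}).trans_eq (by simp)
      omega
    refine ⟨by omega, ?_⟩
    rw [← Submodule.finrank_eq_zero]
    omega
  obtain ⟨hdim1, hdisj⟩ := hdims
  have hspanZ : D ⊔ coneSpan Q R
      = Submodule.span ℝ (castVec '' ((latticeOf D : Set (ι → ℤ)) ∪ Q '' R)) := by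
    rw [Set.image_union, Submodule.span_union, ← Set.image_comp]
    congr 1
    exact hLint.symm
  obtain ⟨z, hz0, hzker⟩ := exists_pairing_eq_zero _ hspanZ (by omega)
  have hker : D ⊔ coneSpan Q R = LinearMap.ker (pairing z) := by
    refine Submodule.eq_of_le_of_finrank_le hzker ?_
    have h1 : LinearMap.ker (pairing z) < ⊤ := by
      refine lt_of_le_of_ne le_top fun h1 => ?_
      have h2 : castVec z ∈ LinearMap.ker (pairing z) := h1 ▸ Submodule.mem_top
      rw [LinearMap.mem_ker, pairing_castVec, Int.cast_eq_zero] at h2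
      exact dotProduct_self_ne_zero hz0 h2
    have h2 := Submodule.finrank_lt h1.ne
    rw [Module.finrank_fintype_fun_eq_card] at h2
    omega
  have hkerD : ∀ x ∈ D, pairing z x = 0 := fun x hx => hzker (Submodule.mem_sup_left hx)
  have hkerR : ∀ x ∈ coneSpan Q R, pairing z x = 0 := fun x hx => hzker (Submodule.mem_sup_right hx)
  let φ : (ι → ℤ) →+ ℤ := ⟨⟨fun w => z ⬝ᵥ w, by simp⟩, fun _ _ => by simp [dotProduct_add]⟩
  have hφ : ∀ w, pairing z (castVec w) = (φ w : ℝ) := fun w => pairing_castVec z w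
  -- The coefficient of `Q b` is read off by the functional `z`.
  have hcoef : ∀ b ∈ A, ∀ t : α → ℝ, (∀ a ∉ insert b R, t a = 0) →
      pairing z (combine Q t) = t b * φ (Q b) := by
    intro b hb t ht
    rw [combine_apply, map_sum, Finset.sum_eq_single b]
    · rw [map_smul, smul_eq_mul, hφ]
    · intro a _ hab
      by_cases haR : a ∈ R
      · rw [map_smul, hkerR _ (castVec_mem_coneSpan Q haR), smul_zero]
      · rw [ht a (by simp [hab, haR]), zero_smul, map_zero]
    · simp
  have hmeets_coef : ∀ b ∈ A, ∀ t : α → ℝ, (∀ a ∉ insert b R, t a = 0) → ∀ v,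
      combine Q t - v - combine Q p ∈ D → t b * φ (Q b) = pairing z v := by
    intro b hb t ht v hD
    have h1 := hkerD _ hD
    rw [map_sub, map_sub, hcoef b hb t ht, hkerR _ hpspan] at h1
    linarith
  -- For small generic `v`, the facet meets `L + v` iff `Q b` and `v` are on the same side.
  have hev : ∀ᶠ v in nhds (0 : ι → ℝ), ∀ b ∈ A, 0 < pairing z v * φ (Q b) → Meets b v := by
    rw [Filter.eventually_all_finset]
    intro b hb
    by_cases hb0 : φ (Q b) = 0
    · exact Filter.Eventually.of_forall fun v hv => by simp [hb0] at hv
    have hb0' : (φ (Q b) : ℝ) ≠ 0 := Int.cast_ne_zero.2 hb0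
    have hcont : Continuous fun v : ι → ℝ => v - (pairing z v / φ (Q b)) • castVec (Q b) := by
      have := (pairing z).continuous_of_finiteDimensional
      fun_prop
    have h0 := eventually_exists_combine Q R D hp0
    have htend : Filter.Tendsto (fun v : ι → ℝ => v - (pairing z v / φ (Q b)) • castVec (Q b))
        (nhds 0) (nhds 0) := by
      simpa using hcont.tendsto 0
    refine (htend.eventually h0).mono fun v hv hpos => ?_
    obtain ⟨t, ht, htp, htD⟩ := hv (by
      rw [hker, LinearMap.mem_ker, map_sub, map_smul, hφ, smul_eq_mul, div_mul_cancel₀ _ hb0',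
        sub_self])
    have hbR := ((hA b).1 hb).1
    have hr : 0 < pairing z v / φ (Q b) := by
      rcases mul_pos_iff.1 hpos with h1 | h1
      exacts [div_pos h1.1 h1.2, div_pos_of_neg_of_neg h1.1 h1.2]
    refine ⟨combine Q (p + t + Pi.single b (pairing z v / φ (Q b))), ⟨_, fun a => ?_, fun a ha => ?_,
      rfl⟩, ?_⟩
    · by_cases hab : a = b
      · subst hab
        simp [hpR a hbR, ht a hbR, hr.le]
      · by_cases haR : a ∈ R
        · have := htp a haR
          simp only [Pi.add_apply, Pi.single_eq_of_ne hab]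
          linarith
        · simp [hpR a haR, ht a haR, hab]
    · rw [Finset.mem_insert, not_or] at ha
      simp [hpR a ha.2, ht a ha.2, ha.1]
    · rw [map_add, map_add, combine_single, ← neg_mem_iff]
      convert htD using 1
      abel
  obtain ⟨ε, hε, hball⟩ := Metric.eventually_nhds_iff.1 hev
  have hmeets_iff : ∀ v : ι → ℝ, ‖v‖ < ε → pairing z v ≠ 0 → ∀ b ∈ A,
      (Meets b v ↔ 0 < pairing z v * φ (Q b)) := by
    refine fun v hv hv0 b hb => ⟨?_, hball (by simpa using hv) b hb⟩
    rintro ⟨_, ⟨t, t0, ht, rfl⟩, hD⟩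
    have h1 := hmeets_coef b hb t ht v hD
    rw [← h1] at hv0 ⊢
    have h2 : 0 < t b := lt_of_le_of_ne (t0 b) fun h => hv0 (by rw [← h, zero_mul])
    have h3 : (φ (Q b) : ℝ) ≠ 0 := fun h => hv0 (by rw [h, mul_zero])
    rw [mul_assoc]
    exact mul_pos h2 (mul_self_pos.2 h3)
  -- The indices are proportional to the values of `φ`, which sum up to zero.
  let c₀ : ℕ := (latticeOf (coneSpan Q R) ⊔ latticeOf D).relIndex φ.ker
  have hr0 : φ.range.index ≠ 0 := by
    have h1 : AddSubgroup.zmultiples (φ z) ≤ φ.range :=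
      AddSubgroup.zmultiples_le_of_mem ⟨z, rfl⟩
    have h2 := AddSubgroup.index_dvd_of_le h1
    rw [Int.index_zmultiples] at h2
    intro h3
    rw [h3, zero_dvd_iff, Int.natAbs_eq_zero] at h2
    exact dotProduct_self_ne_zero hz0 h2
  have hidx : ∀ b ∈ A, φ (Q b) ≠ 0 → idx b * φ.range.index = c₀ * (φ (Q b)).natAbs := by
    intro b hb hb0
    obtain ⟨g, hg⟩ := h.dual _ ((hA b).1 hb).2
    have h1 : latticeOf (coneSpan Q (insert b R)) ⊔ latticeOf D
        = (latticeOf (coneSpan Q R) ⊔ latticeOf D) ⊔ AddSubgroup.zmultiples (Q b) := by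
      rw [hg.latticeOf_coneSpan, (hg.mono (Finset.subset_insert b R)).latticeOf_coneSpan,
        Finset.coe_insert, Set.image_insert_eq, ← Set.singleton_union, AddSubgroup.closure_union,
        AddSubgroup.zmultiples_eq_closure]
      ac_rfl
    simp only [idx, c₀]
    rw [h1, index_sup_zmultiples φ _ hb0]
    refine sup_le (fun w hw => ?_) fun w hw => ?_
    · have := hkerR (castVec w) hw
      rw [hφ, Int.cast_eq_zero] at this
      exact this
    · have := hkerD (castVec w) hw
      rw [hφ, Int.cast_eq_zero] at this
      exact this
  have hbal : ∑ b ∈ A, φ (Q b) = 0 := by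
    obtain ⟨b, hb⟩ : ∃ b, b ∈ A := ⟨b₀, hb₀⟩
    have h1 := hkerR _ (h.balanced R b ((hA b).1 hb).1 ((hA b).1 hb).2 A hA)
    simp only [map_sum, hφ] at h1
    exact_mod_cast h1
  have hsign : ∑ b ∈ A with 0 < φ (Q b), idx b = ∑ b ∈ A with φ (Q b) < 0, idx b := by
    refine Nat.eq_of_mul_eq_mul_right (Nat.pos_of_ne_zero hr0) ?_
    rw [Finset.sum_mul, Finset.sum_mul,
      Finset.sum_congr rfl fun b hb =>
        hidx b (Finset.mem_filter.1 hb).1 (Finset.mem_filter.1 hb).2.ne',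
      Finset.sum_congr rfl fun b hb =>
        hidx b (Finset.mem_filter.1 hb).1 (Finset.mem_filter.1 hb).2.ne,
      ← Finset.mul_sum, ← Finset.mul_sum]
    congr 1
    zify
    rw [Finset.sum_congr rfl fun b hb => abs_of_pos (Finset.mem_filter.1 hb).2,
      Finset.sum_congr rfl fun b hb => abs_of_neg (Finset.mem_filter.1 hb).2,
      Finset.sum_neg_distrib, eq_neg_iff_add_eq_zero]
    refine Eq.trans ?_ hbal
    rw [Finset.sum_filter, Finset.sum_filter, ← Finset.sum_add_distrib]
    refine Finset.sum_congr rfl fun b _ => ?_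
    rcases lt_trichotomy (φ (Q b)) 0 with h1 | h1 | h1
    · simp [h1, h1.le]
    · simp [h1]
    · simp [h1, h1.le]
  refine ⟨∑ b ∈ A with 0 < φ (Q b), idx b, {LinearMap.ker (pairing z)}, ε, Set.finite_singleton _,
    ?_, hε, fun v hv hvB => ?_⟩
  · rintro _ rfl h1
    have h2 : castVec z ∈ LinearMap.ker (pairing z) := h1 ▸ Submodule.mem_top
    rw [LinearMap.mem_ker, pairing_castVec, Int.cast_eq_zero] at h2
    exact dotProduct_self_ne_zero hz0 h2
  have hv0 : pairing z v ≠ 0 := fun h => hvB _ rfl h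
  refine ⟨?_, ?_⟩
  · rintro _ ⟨S', hS', rfl⟩ hsub
    obtain ⟨b, hb, rfl⟩ := hfacet S' hS' hsub
    rintro _ ⟨⟨t, t0, ht, rfl⟩, hxL⟩ _ ⟨⟨s, s0, hs, rfl⟩, hyL⟩
    rw [hLmem] at hxL hyL
    have h1 := hmeets_coef b hb t ht v hxL
    have h2 := hmeets_coef b hb s hs v hyL
    have h3 : t b = s b := by
      rw [← h2] at h1 hv0
      exact mul_right_cancel₀ (fun h => hv0 (by rw [h, mul_zero])) h1
    have h4 : combine Q (t - s) ∈ D ⊓ coneSpan Q R := by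
      refine ⟨?_, combine_mem_coneSpan fun a ha => ?_⟩
      · have h5 := D.sub_mem hxL hyL
        rw [sub_sub_sub_cancel_right, sub_sub_sub_cancel_right, ← map_sub] at h5
        exact h5
      · by_cases hab : a = b
        · rw [hab, Pi.sub_apply, h3, sub_self]
        · rw [Pi.sub_apply, ht a (by simp [hab, ha]), hs a (by simp [hab, ha]), sub_self]
    rw [hdisj, Submodule.mem_bot, map_sub, sub_eq_zero] at h4
    exact h4
  · rw [hsum, Finset.filter_congr fun b hb => hmeets_iff v hv hv0 b hb]
    rcases lt_or_gt_of_ne hv0 with h1 | h1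
    · rw [hsign]
      refine congrArg (fun s => ∑ b ∈ s, idx b) (Finset.filter_congr fun b _ => ?_)
      simp [mul_pos_iff, h1, h1.not_gt]
    · refine congrArg (fun s => ∑ b ∈ s, idx b) (Finset.filter_congr fun b _ => ?_)
      rw [mul_pos_iff_of_pos_left h1, Int.cast_pos]

theorem isTropicalCycle (h : IsBalancedFan d Q 𝓕) :
    IsTropicalCycle d (simplicialCone Q '' 𝓕) (fun _ => 1) :=
  ⟨h.isPolyhedralComplex, fun _ _ => one_pos, h.isBalanced⟩

end IsBalancedFan

end Balance

/-! ### Laminar families of sets of markings -/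

/-- The set of all markings except the root `k`. -/
def rootCluster {n : ℕ} (k : Fin n) : Finset (Fin n) := Finset.univ.erase k

theorem mem_rootCluster {n : ℕ} {k i : Fin n} : i ∈ rootCluster k ↔ i ≠ k := by
  simp [rootCluster]

/-- A laminar family of nonempty sets of markings, not containing the root `k`, that comprises all
singletons and the largest possible set. These sets stand for the vertices, other than the root leaf
itself, of a tree rooted at the leaf `k`; each of them is the set of the leaves below the vertex. -/
structure IsHierarchy {n : ℕ} (k : Fin n) (N : Finset (Finset (Fin n))) : Prop where
  root_mem : rootCluster k ∈ N
  singleton_mem : ∀ i, i ≠ k → {i} ∈ N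
  nonempty : ∀ A ∈ N, A.Nonempty
  notMem : ∀ A ∈ N, k ∉ A
  laminar : ∀ A ∈ N, ∀ B ∈ N, A ⊆ B ∨ B ⊆ A ∨ Disjoint A B

/-- The maximal elements of `N` among those strictly contained in `P`. -/
def children {n : ℕ} (N : Finset (Finset (Fin n))) (P : Finset (Fin n)) :
    Finset (Finset (Fin n)) :=
  N.filter fun B => B ⊂ P ∧ ∀ C ∈ N, B ⊂ C → ¬ C ⊂ P

theorem mem_children {n : ℕ} {N : Finset (Finset (Fin n))} {P B : Finset (Fin n)} :
    B ∈ children N P ↔ B ∈ N ∧ B ⊂ P ∧ ∀ C ∈ N, B ⊂ C → ¬ C ⊂ P := by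
  simp [children]

namespace IsHierarchy

variable {n : ℕ} {k : Fin n} {N : Finset (Finset (Fin n))}

theorem comparable (hN : IsHierarchy k N) {A B : Finset (Fin n)} (hA : A ∈ N) (hB : B ∈ N)
    {i : Fin n} (hiA : i ∈ A) (hiB : i ∈ B) : A ⊆ B ∨ B ⊆ A := by
  rcases hN.laminar A hA B hB with h | h | h
  exacts [Or.inl h, Or.inr h, absurd hiB (Finset.disjoint_left.1 h hiA)]

theorem subset_root (hN : IsHierarchy k N) {A : Finset (Fin n)} (hA : A ∈ N) :
    A ⊆ rootCluster k := fun _ hi =>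
  mem_rootCluster.2 fun h => hN.notMem A hA (h ▸ hi)

theorem exists_child_superset {P C : Finset (Fin n)} (hC : C ∈ N)
    (hCP : C ⊂ P) : ∃ B ∈ children N P, C ⊆ B := by
  obtain ⟨B, hB, hmax⟩ := (N.filter fun B => C ⊆ B ∧ B ⊂ P).exists_max_image Finset.card
    ⟨C, Finset.mem_filter.2 ⟨hC, subset_rfl, hCP⟩⟩
  simp only [Finset.mem_filter] at hB hmax
  refine ⟨B, mem_children.2 ⟨hB.1, hB.2.2, fun D hD hBD hDP => ?_⟩, hB.2.1⟩
  exact absurd (Finset.card_lt_card hBD) (not_lt.2 (hmax D ⟨hD, hB.2.1.trans hBD.subset, hDP⟩))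

theorem exists_child_mem (hN : IsHierarchy k N) {P : Finset (Fin n)} (hk : k ∉ P)
    (hP : 2 ≤ P.card) {i : Fin n} (hi : i ∈ P) : ∃ B ∈ children N P, i ∈ B := by
  have hss : {i} ⊂ P := by
    refine Finset.ssubset_iff_subset_ne.2 ⟨Finset.singleton_subset_iff.2 hi, fun h => ?_⟩
    rw [← h, Finset.card_singleton] at hP
    omega
  obtain ⟨B, hB, hiB⟩ := exists_child_superset (hN.singleton_mem i fun h => hk (h ▸ hi)) hss
  exact ⟨B, hB, hiB (Finset.mem_singleton_self i)⟩

theorem eq_of_mem_children (hN : IsHierarchy k N) {P B C : Finset (Fin n)}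
    (hB : B ∈ children N P) (hC : C ∈ children N P) {i : Fin n} (hiB : i ∈ B) (hiC : i ∈ C) :
    B = C := by
  rw [mem_children] at hB hC
  by_contra hne
  rcases hN.comparable hB.1 hC.1 hiB hiC with h | h
  · exact hB.2.2 C hC.1 (h.ssubset_of_ne hne) hC.2.1
  · exact hC.2.2 B hB.1 (h.ssubset_of_ne (Ne.symm hne)) hB.2.1

theorem pairwiseDisjoint_children (hN : IsHierarchy k N) (P : Finset (Fin n)) :
    (children N P : Set (Finset (Fin n))).PairwiseDisjoint id := fun _ hB _ hC hne =>
  Finset.disjoint_left.2 fun _ hiB hiC => hne (hN.eq_of_mem_children hB hC hiB hiC)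

theorem exists_parent (hN : IsHierarchy k N) {B : Finset (Fin n)} (hB : B ∈ N)
    (hne : B ≠ rootCluster k) : ∃ P ∈ N, B ∈ children N P := by
  obtain ⟨P, hP, hmin⟩ := (N.filter fun P => B ⊂ P).exists_min_image Finset.card
    ⟨_, Finset.mem_filter.2 ⟨hN.root_mem, (hN.subset_root hB).ssubset_of_ne hne⟩⟩
  simp only [Finset.mem_filter] at hP hmin
  refine ⟨P, hP.1, mem_children.2 ⟨hB, hP.2, fun D hD hBD hDP => ?_⟩⟩
  exact absurd (Finset.card_lt_card hDP) (not_lt.2 (hmin D ⟨hD, hBD⟩))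

/-- The parent of `B` is the smallest node above `B`. -/
theorem parent_subset (hN : IsHierarchy k N) {B P C : Finset (Fin n)} (hP : P ∈ N)
    (hB : B ∈ children N P) (hC : C ∈ N) (hBC : B ⊂ C) : P ⊆ C := by
  rw [mem_children] at hB
  obtain ⟨i, hi⟩ := hN.nonempty B hB.1
  rcases hN.comparable hP hC (hB.2.1.subset hi) (hBC.subset hi) with h | h
  · exact h
  · by_contra hne
    exact hB.2.2 C hC hBC (Finset.ssubset_iff_subset_ne.2 ⟨h, fun h' => hne h'.symm.subset⟩)

theorem parent_unique (hN : IsHierarchy k N) {B P P' : Finset (Fin n)} (hP : P ∈ N)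
    (hP' : P' ∈ N) (hB : B ∈ children N P) (hB' : B ∈ children N P') : P = P' :=
  (hN.parent_subset hP hB hP' (mem_children.1 hB').2.1).antisymm
    (hN.parent_subset hP' hB' hP (mem_children.1 hB).2.1)

theorem biUnion_children (hN : IsHierarchy k N) {P : Finset (Fin n)} (hk : k ∉ P)
    (hP : 2 ≤ P.card) : (children N P).biUnion id = P := by
  ext i
  simp only [Finset.mem_biUnion, id]
  constructor
  · rintro ⟨B, hB, hi⟩
    exact (mem_children.1 hB).2.1.subset hi
  · exact hN.exists_child_mem hk hP

/-- A node with at least two leaves has no single child, since this would be the node itself. -/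
theorem two_le_card_children (hN : IsHierarchy k N) {P : Finset (Fin n)} (hk : k ∉ P)
    (hP : 2 ≤ P.card) : 2 ≤ (children N P).card := by
  obtain ⟨i, hi⟩ : P.Nonempty := Finset.card_pos.1 (by omega)
  obtain ⟨B, hB, -⟩ := hN.exists_child_mem hk hP hi
  obtain ⟨j, hj, hjB⟩ := Finset.exists_of_ssubset (mem_children.1 hB).2.1
  obtain ⟨C, hC, hjC⟩ := hN.exists_child_mem hk hP hj
  exact Finset.one_lt_card.2 ⟨B, hB, C, hC, fun h => hjB (h ▸ hjC)⟩

theorem children_singleton (hN : IsHierarchy k N) (i : Fin n) : children N {i} = ∅ := by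
  refine Finset.eq_empty_of_forall_notMem fun B hB => ?_
  rw [mem_children, Finset.ssubset_singleton_iff] at hB
  exact (hN.nonempty B hB.1).ne_empty hB.2.1

/-- Every node except the root cluster is the child of exactly one node. -/
theorem sum_card_children (hN : IsHierarchy k N) :
    ∑ P ∈ N, (children N P).card + 1 = N.card := by
  rw [← Finset.card_biUnion]
  · have : N.biUnion (children N) = N.erase (rootCluster k) := by
      ext B
      simp only [Finset.mem_biUnion, Finset.mem_erase]
      constructor
      · rintro ⟨P, hP, hB⟩
        rw [mem_children] at hB
        exact ⟨fun h => (h ▸ hB.2.1).not_subset (hN.subset_root hP), hB.1⟩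
      · rintro ⟨hne, hB⟩
        exact hN.exists_parent hB hne
    rw [this, Finset.card_erase_add_one hN.root_mem]
  · intro P hP P' hP' hne
    exact Finset.disjoint_left.2 fun B hB hB' => hne (hN.parent_unique hP hP' hB hB')

section Insert

variable {b P : Finset (Fin n)}

/-- Removing the node `b` turns its children into children of its parent `P`. -/
theorem children_of_insert (hN : IsHierarchy k (insert b N)) (hb : b ∉ N)
    (hbP : b ∈ children (insert b N) P) :
    children N P = (children (insert b N) P).erase b ∪ children (insert b N) b := by
  have hbP' := mem_children.1 hbP
  ext C
  simp only [Finset.mem_union, Finset.mem_erase]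
  constructor
  · intro hC
    rw [mem_children] at hC
    by_cases hCb : C ⊂ b
    · refine Or.inr (mem_children.2 ⟨Finset.mem_insert_of_mem hC.1, hCb, fun D hD hCD hDb => ?_⟩)
      rcases Finset.mem_insert.1 hD with rfl | hD
      · exact hDb.ne rfl
      · exact hC.2.2 D hD hCD (hDb.trans hbP'.2.1)
    · refine Or.inl ⟨fun h => hb (h ▸ hC.1), mem_children.2 ⟨Finset.mem_insert_of_mem hC.1, hC.2.1,
        fun D hD hCD => ?_⟩⟩
      rcases Finset.mem_insert.1 hD with rfl | hD
      · exact absurd hCD hCb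
      · exact hC.2.2 D hD hCD
  · rintro (⟨hne, hC⟩ | hC)
    · rw [mem_children] at hC
      exact mem_children.2 ⟨Finset.mem_of_mem_insert_of_ne hC.1 hne, hC.2.1,
        fun D hD => hC.2.2 D (Finset.mem_insert_of_mem hD)⟩
    · rw [mem_children] at hC
      refine mem_children.2 ⟨Finset.mem_of_mem_insert_of_ne hC.1 hC.2.1.ne,
        hC.2.1.trans hbP'.2.1, fun D hD hCD hDP => ?_⟩
      obtain ⟨i, hi⟩ := hN.nonempty C hC.1
      have hDN : D ∈ insert b N := Finset.mem_insert_of_mem hD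
      have hDb : D ≠ b := fun h => hb (h ▸ hD)
      rcases hN.comparable hDN hbP'.1 (hCD.subset hi) (hC.2.1.subset hi) with h | h
      · exact hC.2.2 D hDN hCD (h.ssubset_of_ne hDb)
      · exact hbP'.2.2 D hDN (h.ssubset_of_ne hDb.symm) hDP

theorem card_children_of_insert (hN : IsHierarchy k (insert b N)) (hb : b ∉ N)
    (hbP : b ∈ children (insert b N) P) :
    (children N P).card + 1
      = (children (insert b N) P).card + (children (insert b N) b).card := by
  rw [hN.children_of_insert hb hbP, Finset.card_union_of_disjoint,
    ← Finset.card_erase_add_one hbP]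
  · ring
  · refine Finset.disjoint_left.2 fun C hC hC' => ?_
    have h1 := mem_children.1 hC'
    exact (mem_children.1 (Finset.mem_of_mem_erase hC)).2.2 b (Finset.mem_insert_self b N) h1.2.1
      (mem_children.1 hbP).2.1

/-- Removing the node `b` changes the children of no node except its parent. -/
theorem children_of_insert_of_ne (hN : IsHierarchy k (insert b N)) (hb : b ∉ N) (hP : P ∈ N)
    (hbP : b ∈ children (insert b N) P) {P' : Finset (Fin n)} (hP' : P' ∈ N) (hne : P' ≠ P) :
    children N P' = children (insert b N) P' := by
  have hPN : P ∈ insert b N := Finset.mem_insert_of_mem hP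
  have hPN' : P' ∈ insert b N := Finset.mem_insert_of_mem hP'
  ext C
  constructor
  · intro hC
    rw [mem_children] at hC
    refine mem_children.2 ⟨Finset.mem_insert_of_mem hC.1, hC.2.1, fun D hD hCD hDP => ?_⟩
    rcases Finset.mem_insert.1 hD with rfl | hD
    · exact hC.2.2 P hP (hCD.trans (mem_children.1 hbP).2.1)
        ((hN.parent_subset hPN hbP hPN' hDP).ssubset_of_ne hne.symm)
    · exact hC.2.2 D hD hCD hDP
  · intro hC
    have hCb : C ≠ b := by
      rintro rfl
      exact hne (hN.parent_unique hPN' hPN hC hbP)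
    rw [mem_children] at hC
    exact mem_children.2 ⟨Finset.mem_of_mem_insert_of_ne hC.1 hCb, hC.2.1,
      fun D hD => hC.2.2 D (Finset.mem_insert_of_mem hD)⟩

end Insert

end IsHierarchy

/-- A laminar family of sets of markings, each of which separates at least two markings from the
root `k` and at least one further marking. Such families encode the combinatorial types of marked
trees: the members are the sets of leaves that lie beyond the bounded edges, as seen from the leaf
`k`. -/
structure IsClusterSystem {n : ℕ} (k : Fin n) (M : Finset (Finset (Fin n))) : Prop where
  notMem : ∀ A ∈ M, k ∉ A
  two_le : ∀ A ∈ M, 2 ≤ A.card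
  ne_root : ∀ A ∈ M, A ≠ rootCluster k
  laminar : ∀ A ∈ M, ∀ B ∈ M, A ⊆ B ∨ B ⊆ A ∨ Disjoint A B

/-- The hierarchy generated by a cluster system. -/
def nodes {n : ℕ} (k : Fin n) (M : Finset (Finset (Fin n))) : Finset (Finset (Fin n)) :=
  insert (rootCluster k) M ∪ (rootCluster k).image singleton

theorem mem_nodes {n : ℕ} {k : Fin n} {M : Finset (Finset (Fin n))} {A : Finset (Fin n)} :
    A ∈ nodes k M ↔ A = rootCluster k ∨ A ∈ M ∨ ∃ i, i ≠ k ∧ A = {i} := by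
  simp only [nodes, Finset.mem_union, Finset.mem_insert, Finset.mem_image, mem_rootCluster,
    or_assoc]
  simp only [eq_comm]

theorem nodes_insert {n : ℕ} (k : Fin n) (M : Finset (Finset (Fin n))) (b : Finset (Fin n)) :
    nodes k (insert b M) = insert b (nodes k M) := by
  rw [nodes, nodes, Finset.insert_comm, Finset.insert_union]

namespace IsClusterSystem

variable {n : ℕ} {k : Fin n} {M : Finset (Finset (Fin n))}

theorem mono (hM : IsClusterSystem k M) {R : Finset (Finset (Fin n))} (h : R ⊆ M) :
    IsClusterSystem k R :=
  ⟨fun A hA => hM.notMem A (h hA), fun A hA => hM.two_le A (h hA), fun A hA => hM.ne_root A (h hA),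
    fun A hA B hB => hM.laminar A (h hA) B (h hB)⟩

theorem mem_nodes_of_mem {A : Finset (Fin n)} (hA : A ∈ M) : A ∈ nodes k M :=
  mem_nodes.2 (Or.inr (Or.inl hA))

theorem isHierarchy (hM : IsClusterSystem k M) (hn : 2 ≤ n) : IsHierarchy k (nodes k M) where
  root_mem := mem_nodes.2 (Or.inl rfl)
  singleton_mem i hi := mem_nodes.2 (Or.inr (Or.inr ⟨i, hi, rfl⟩))
  nonempty A hA := by
    rcases mem_nodes.1 hA with rfl | hA | ⟨i, -, rfl⟩
    · rw [← Finset.card_pos, rootCluster, Finset.card_erase_of_mem (Finset.mem_univ k),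
        Finset.card_univ, Fintype.card_fin]
      omega
    · exact Finset.card_pos.1 (by have := hM.two_le A hA; omega)
    · exact Finset.singleton_nonempty i
  notMem A hA := by
    rcases mem_nodes.1 hA with rfl | hA | ⟨i, hi, rfl⟩
    · simp [rootCluster]
    · exact hM.notMem A hA
    · simpa using hi.symm
  laminar := by
    have hsingle : ∀ (i : Fin n) (B : Finset (Fin n)), {i} ⊆ B ∨ Disjoint {i} B := fun i B => by
      by_cases h : i ∈ B
      · exact Or.inl (Finset.singleton_subset_iff.2 h)
      · exact Or.inr (Finset.disjoint_singleton_left.2 h)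
    have hroot : ∀ A ∈ nodes k M, A ⊆ rootCluster k := fun A hA i hi => by
      rw [mem_rootCluster]
      rintro rfl
      rcases mem_nodes.1 hA with rfl | hA | ⟨j, hj, rfl⟩
      · simp [rootCluster] at hi
      · exact hM.notMem A hA hi
      · exact hj (Finset.mem_singleton.1 hi).symm
    intro A hA B hB
    rcases mem_nodes.1 hA with rfl | hA' | ⟨i, hi, rfl⟩
    · exact Or.inr (Or.inl (hroot B hB))
    · rcases mem_nodes.1 hB with rfl | hB' | ⟨j, hj, rfl⟩
      · exact Or.inl (hroot A hA)
      · exact hM.laminar A hA' B hB'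
      · exact Or.inr ((hsingle j A).imp id fun h => h.symm)
    · exact (hsingle i B).imp id Or.inr

end IsClusterSystem

theorem card_rootCluster {n : ℕ} (k : Fin n) : (rootCluster k).card + 1 = n := by
  rw [rootCluster, Finset.card_erase_add_one (Finset.mem_univ k), Finset.card_univ,
    Fintype.card_fin]

namespace IsClusterSystem

variable {n : ℕ} {k : Fin n} {M : Finset (Finset (Fin n))}

theorem disjoint_singletons (hM : IsClusterSystem k M) (hn : 3 ≤ n) :
    Disjoint (insert (rootCluster k) M) ((rootCluster k).image singleton) := by
  refine Finset.disjoint_left.2 fun A hA hA' => ?_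
  obtain ⟨i, -, rfl⟩ := Finset.mem_image.1 hA'
  have hroot := card_rootCluster k
  rcases Finset.mem_insert.1 hA with h | h
  · rw [← h, Finset.card_singleton] at hroot
    omega
  · have := hM.two_le _ h
    rw [Finset.card_singleton] at this
    omega

theorem root_notMem (hM : IsClusterSystem k M) : rootCluster k ∉ M := fun h =>
  hM.ne_root _ h rfl

theorem card_nodes (hM : IsClusterSystem k M) (hn : 3 ≤ n) : (nodes k M).card = M.card + n := by
  rw [nodes, Finset.card_union_of_disjoint (hM.disjoint_singletons hn),
    Finset.card_insert_of_notMem hM.root_notMem,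
    Finset.card_image_of_injective _ (Finset.singleton_injective)]
  have := card_rootCluster k
  omega

/-- The number of children, summed over the inner nodes. -/
theorem sum_card_children (hM : IsClusterSystem k M) (hn : 3 ≤ n) :
    (children (nodes k M) (rootCluster k)).card + ∑ P ∈ M, (children (nodes k M) P).card + 1
      = M.card + n := by
  have hN := hM.isHierarchy (by omega)
  have h := hN.sum_card_children
  rw [hM.card_nodes hn] at h
  rw [← h]
  conv_rhs => rw [nodes, Finset.sum_union (hM.disjoint_singletons hn),
    Finset.sum_insert hM.root_notMem]
  rw [Finset.sum_image (fun _ _ _ _ h => Finset.singleton_injective h)]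
  rw [Finset.sum_eq_zero (s := rootCluster k), add_zero]
  · rfl
  · intro i _
    exact Finset.card_eq_zero.2 (hN.children_singleton i)

end IsClusterSystem

/-! ### Split vectors -/

/-- The indicator function of a set of markings. -/
def indicator {n : ℕ} (A : Finset (Fin n)) (i : Fin n) : ℤ := if i ∈ A then 1 else 0

theorem indicator_of_mem {n : ℕ} {A : Finset (Fin n)} {i : Fin n} (h : i ∈ A) :
    indicator A i = 1 := if_pos h

theorem indicator_of_notMem {n : ℕ} {A : Finset (Fin n)} {i : Fin n} (h : i ∉ A) :
    indicator A i = 0 := if_neg h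

/-- The double ratio of `(a, b)` and `(c, d)` on a curve with a single bounded edge, of length one,
that separates the markings in `A` from the others: it is `1` if `a`, `c` are separated from `b`,
`d`, and `-1` if `a`, `d` are separated from `b`, `c`. As a quadratic function of the indicator of
`A` it is responsible for all linear relations between the rays of the moduli space. -/
def splitSign {n : ℕ} (A : Finset (Fin n)) (a b c d : Fin n) : ℤ :=
  (indicator A a - indicator A b) * (indicator A c - indicator A d)

/-- The vector of all double ratios of a curve with a single bounded edge of length one. -/
def splitVector {n : ℕ} (A : Finset (Fin n)) : PairOfPairs n → ℤ := fun q =>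
  splitSign A q.1.1 q.1.2.1 q.1.2.2.1 q.1.2.2.2

/-- Every double ratio is, up to sign, one of the chosen coordinates. -/
theorem exists_coordinate {n : ℕ} {a b c d : Fin n} (hab : a ≠ b) (hcd : c ≠ d) (hac : a ≠ c)
    (had : a ≠ d) (hbc : b ≠ c) (hbd : b ≠ d) :
    ∃ (q : PairOfPairs n) (s : ℤ), ∀ A, splitSign A a b c d = s * splitVector A q := by
  have main : ∀ a b c d : Fin n, a < b → c < d → a < c → b ≠ c → b ≠ d →
      ∃ (q : PairOfPairs n) (s : ℤ), ∀ A, splitSign A a b c d = s * splitVector A q :=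
    fun a b c d h1 h2 h3 h4 h5 => ⟨⟨(a, b, c, d), h1, h2, h3, h4, h5⟩, 1, fun A => by
      simp [splitVector]⟩
  have swap1 : ∀ a b c d : Fin n,
      (∃ (q : PairOfPairs n) (s : ℤ), ∀ A, splitSign A a b c d = s * splitVector A q) →
      ∃ (q : PairOfPairs n) (s : ℤ), ∀ A, splitSign A b a c d = s * splitVector A q := by
    rintro a b c d ⟨q, s, h⟩
    refine ⟨q, -s, fun A => ?_⟩
    rw [neg_mul, ← h A, splitSign, splitSign]
    ring
  have swap2 : ∀ a b c d : Fin n,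
      (∃ (q : PairOfPairs n) (s : ℤ), ∀ A, splitSign A a b c d = s * splitVector A q) →
      ∃ (q : PairOfPairs n) (s : ℤ), ∀ A, splitSign A c d a b = s * splitVector A q := by
    rintro a b c d ⟨q, s, h⟩
    refine ⟨q, s, fun A => ?_⟩
    rw [← h A, splitSign, splitSign]
    ring
  have main2 : ∀ a b c d : Fin n, a < b → c < d → a ≠ c → a ≠ d → b ≠ c → b ≠ d →
      ∃ (q : PairOfPairs n) (s : ℤ), ∀ A, splitSign A a b c d = s * splitVector A q := by
    intro a b c d h1 h2 h3 h4 h5 h6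
    rcases lt_or_gt_of_ne h3 with h | h
    · exact main a b c d h1 h2 h h5 h6
    · exact swap2 _ _ _ _ (main c d a b h2 h1 h h4.symm h6.symm)
  have main3 : ∀ a b c d : Fin n, a < b → c ≠ d → a ≠ c → a ≠ d → b ≠ c → b ≠ d →
      ∃ (q : PairOfPairs n) (s : ℤ), ∀ A, splitSign A a b c d = s * splitVector A q := by
    intro a b c d h1 h2 h3 h4 h5 h6
    rcases lt_or_gt_of_ne h2 with h | h
    · exact main2 a b c d h1 h h3 h4 h5 h6
    · exact swap2 _ _ _ _ (swap1 _ _ _ _ (swap2 _ _ _ _ (main2 a b d c h1 h h4 h3 h6 h5)))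
  rcases lt_or_gt_of_ne hab with h | h
  · exact main3 a b c d h hcd hac had hbc hbd
  · exact swap1 _ _ _ _ (main3 b a c d h hcd hbc hbd hac had)

theorem splitSign_root {n : ℕ} {k : Fin n} {A : Finset (Fin n)} (hk : k ∉ A) (a b c : Fin n) :
    splitSign A a b c k = (indicator A a - indicator A b) * indicator A c := by
  rw [splitSign, indicator_of_notMem hk, sub_zero]

theorem splitVector_singleton {n : ℕ} (i : Fin n) : splitVector ({i} : Finset (Fin n)) = 0 := by
  funext q
  obtain ⟨⟨a, b, c, d⟩, h1, h2, h3, h4, h5⟩ := q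
  change splitSign {i} a b c d = 0
  simp only [splitSign, indicator, Finset.mem_singleton]
  dsimp only at h1 h2 h3 h4 h5
  have h6 : a ≠ d := (h3.trans h2).ne
  grind

theorem splitVector_rootCluster {n : ℕ} (k : Fin n) : splitVector (rootCluster k) = 0 := by
  funext q
  obtain ⟨⟨a, b, c, d⟩, h1, h2, h3, h4, h5⟩ := q
  change splitSign (rootCluster k) a b c d = 0
  simp only [splitSign, indicator, mem_rootCluster]
  dsimp only at h1 h2 h3 h4 h5
  have h6 : a ≠ d := (h3.trans h2).ne
  grind

/-- Summing over the pairs in `s`, the product of two additive functions is polarized. -/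
theorem sum_powersetCard_two {β : Type*} [DecidableEq β] (s : Finset β) (u w : β → ℤ) :
    ∑ S ∈ s.powersetCard 2, (∑ x ∈ S, u x) * (∑ x ∈ S, w x)
      = (s.card - 2) * ∑ x ∈ s, u x * w x + (∑ x ∈ s, u x) * ∑ x ∈ s, w x := by
  induction s using Finset.induction_on with
  | empty =>
    rw [Finset.powersetCard_eq_empty.2 (by simp)]
    simp
  | insert x s hx ih =>
    rw [Finset.powersetCard_succ_insert hx, Finset.sum_union, ih, Finset.sum_image,
      Finset.powersetCard_one, Finset.sum_map, Finset.sum_insert hx, Finset.sum_insert hx,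
      Finset.sum_insert hx, Finset.card_insert_of_notMem hx]
    · have : ∀ y ∈ s, (∑ z ∈ insert x {y}, u z) * (∑ z ∈ insert x {y}, w z)
          = u x * w x + u x * w y + u y * w x + u y * w y := by
        intro y hy
        have hxy : x ≠ y := fun h => hx (h ▸ hy)
        rw [Finset.sum_pair hxy, Finset.sum_pair hxy]
        ring
      simp only [Function.Embedding.coeFn_mk]
      rw [Finset.sum_congr rfl this]
      simp only [Finset.sum_add_distrib, Finset.sum_const, nsmul_eq_mul, ← Finset.mul_sum,
        ← Finset.sum_mul]
      push_cast
      ring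
    · intro S hS S' hS' h
      have hxS : ∀ T ∈ s.powersetCard 1, x ∉ T := fun T hT hxT =>
        hx ((Finset.mem_powersetCard.1 hT).1 hxT)
      exact (Finset.insert_erase_invOn.2.injOn (hxS S hS) (hxS S' hS') h)
    · refine Finset.disjoint_left.2 fun S hS hS' => ?_
      obtain ⟨T, -, rfl⟩ := Finset.mem_image.1 hS'
      exact hx ((Finset.mem_powersetCard.1 hS).1 (Finset.mem_insert_self x T))

theorem indicator_biUnion {n : ℕ} {s : Finset (Finset (Fin n))}
    (hs : (s : Set (Finset (Fin n))).PairwiseDisjoint id) (i : Fin n) :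
    indicator (s.biUnion id) i = ∑ B ∈ s, indicator B i := by
  by_cases h : i ∈ s.biUnion id
  · obtain ⟨B, hB, hi⟩ := Finset.mem_biUnion.1 h
    rw [indicator_of_mem h, Finset.sum_eq_single_of_mem B hB]
    · exact (indicator_of_mem hi).symm
    intro C hC hne
    exact indicator_of_notMem fun hiC => Finset.disjoint_left.1 (hs hC hB hne) hiC hi
  · rw [indicator_of_notMem h, Finset.sum_eq_zero]
    exact fun B hB => indicator_of_notMem fun hi => h (Finset.mem_biUnion.2 ⟨B, hB, hi⟩)

/-- The sum of the split vectors of all unions of two members of a family of disjoint sets. -/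
theorem sum_splitVector_pairs {n : ℕ} {s : Finset (Finset (Fin n))}
    (hs : (s : Set (Finset (Fin n))).PairwiseDisjoint id) :
    ∑ S ∈ s.powersetCard 2, splitVector (S.biUnion id)
      = ((s.card : ℤ) - 2) • ∑ B ∈ s, splitVector B + splitVector (s.biUnion id) := by
  funext q
  have key : ∀ S : Finset (Finset (Fin n)), (S : Set (Finset (Fin n))).PairwiseDisjoint id →
      splitVector (S.biUnion id) q
        = (∑ B ∈ S, (indicator B q.1.1 - indicator B q.1.2.1))
          * ∑ B ∈ S, (indicator B q.1.2.2.1 - indicator B q.1.2.2.2) := by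
    intro S hS
    simp only [splitVector, splitSign, indicator_biUnion hS, Finset.sum_sub_distrib]
  rw [Finset.sum_apply, Pi.add_apply, Pi.smul_apply, Finset.sum_apply, key s hs, smul_eq_mul,
    Finset.sum_congr rfl fun S hS => key S (hs.subset (by
      exact_mod_cast (Finset.mem_powersetCard.1 hS).1)), sum_powersetCard_two]
  rfl

/-! ### Recovering a cluster system from double ratios -/

namespace IsClusterSystem

variable {n : ℕ} {k : Fin n} {M : Finset (Finset (Fin n))}

/-- Every member `A` is detected by some `a, c ∈ A` and `b ∉ A`: no other member separates `a`, `c`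
from `b` and the root. Here `a`, `c` lie in different children of `A`, and `b` lies in the
parent of `A`. -/
theorem exists_detecting (hM : IsClusterSystem k M) (hn : 2 ≤ n) {A : Finset (Fin n)}
    (hA : A ∈ M) : ∃ a ∈ A, ∃ c ∈ A, ∃ b ∉ A, a ≠ c ∧ b ≠ k ∧
      ∀ B ∈ M, a ∈ B → c ∈ B → b ∉ B → B = A := by
  have hN := hM.isHierarchy hn
  have hAN := mem_nodes_of_mem (k := k) hA
  obtain ⟨a, ha⟩ := hN.nonempty A hAN
  obtain ⟨B₁, hB₁, haB₁⟩ := hN.exists_child_mem (hM.notMem A hA) (hM.two_le A hA) ha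
  obtain ⟨P, hP, hAP⟩ := hN.exists_parent hAN (hM.ne_root A hA)
  obtain ⟨b, hbP, hbA⟩ := Finset.exists_of_ssubset (mem_children.1 hAP).2.1
  have hB₁' := mem_children.1 hB₁
  obtain ⟨c, hc, hcB₁⟩ := Finset.exists_of_ssubset hB₁'.2.1
  refine ⟨a, ha, c, hc, b, hbA, fun h => hcB₁ (h ▸ haB₁), fun h => hN.notMem P hP (h ▸ hbP),
    fun B hB haB hcB hbB => ?_⟩
  by_contra hne
  have hBN := mem_nodes_of_mem (k := k) hB
  rcases hN.comparable hBN hAN haB ha with h | h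
  · rcases hN.comparable hBN hB₁'.1 haB haB₁ with h' | h'
    · exact hcB₁ (h' hcB)
    · exact hB₁'.2.2 B hBN (h'.ssubset_of_ne fun h'' => hcB₁ (h'' ▸ hcB)) (h.ssubset_of_ne hne)
  · exact hbB (hN.parent_subset hP hAP hBN (h.ssubset_of_ne (Ne.symm hne)) hbP)

/-- No member separates `b`, `c` from `a` and the root, if another one separates `a`, `c` from `b` and
the root. -/
theorem splitSign_nonneg (hM : IsClusterSystem k M) {A B : Finset (Fin n)} (hA : A ∈ M)
    (hB : B ∈ M) {a b c : Fin n} (ha : a ∈ A) (hc : c ∈ A) (hb : b ∉ A) :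
    0 ≤ splitSign B a b c k := by
  rw [splitSign_root (hM.notMem B hB)]
  by_cases hcB : c ∈ B
  · by_cases haB : a ∈ B
    · by_cases hbB : b ∈ B <;> simp [indicator, hcB, haB, hbB]
    · have hbB : b ∉ B := by
        intro hbB
        rcases hM.laminar A hA B hB with h | h | h
        exacts [haB (h ha), hb (h hbB), Finset.disjoint_left.1 h hc hcB]
      simp [indicator, haB, hbB]
  · simp [indicator, hcB]

theorem splitSign_eq_one (hM : IsClusterSystem k M) {A : Finset (Fin n)} (hA : A ∈ M)
    {a b c : Fin n} (ha : a ∈ A) (hc : c ∈ A) (hb : b ∉ A) : splitSign A a b c k = 1 := by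
  rw [splitSign_root (hM.notMem A hA)]
  simp [indicator, ha, hb, hc]

theorem splitSign_eq_zero (hM : IsClusterSystem k M) {A B : Finset (Fin n)} (hA : A ∈ M)
    (hB : B ∈ M) {a b c : Fin n} (ha : a ∈ A) (hc : c ∈ A) (hb : b ∉ A)
    (h : ¬ (a ∈ B ∧ c ∈ B ∧ b ∉ B)) : splitSign B a b c k = 0 := by
  refine le_antisymm ?_ (hM.splitSign_nonneg hA hB ha hc hb)
  rw [splitSign_root (hM.notMem B hB)]
  by_cases hcB : c ∈ B
  · by_cases haB : a ∈ B
    · have hbB : b ∈ B := by_contra fun hbB => h ⟨haB, hcB, hbB⟩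
      simp [indicator, haB, hbB]
    · by_cases hbB : b ∈ B <;> simp [indicator, hcB, haB, hbB]
  · simp [indicator, hcB]

/-- The rays of a cone are part of a lattice basis: each is detected by a coordinate. -/
theorem exists_isDualOn (hM : IsClusterSystem k M) (hn : 2 ≤ n) :
    ∃ f, IsDualOn splitVector M f := by
  have : ∀ A, ∃ f : PairOfPairs n → ℤ, A ∈ M →
      ∀ B ∈ M, f ⬝ᵥ splitVector B = if A = B then 1 else 0 := by
    classical
    intro A
    by_cases hA : A ∈ M
    · obtain ⟨a, ha, c, hc, b, hb, hac, hbk, huniq⟩ := hM.exists_detecting hn hA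
      have hak : a ≠ k := fun h => hM.notMem A hA (h ▸ ha)
      have hck : c ≠ k := fun h => hM.notMem A hA (h ▸ hc)
      obtain ⟨q, s, hqs⟩ := exists_coordinate (fun h : a = b => hb (h ▸ ha)) hck hac hak
        (fun h : b = c => hb (h ▸ hc)) hbk
      refine ⟨Pi.single q s, fun _ B hB => ?_⟩
      rw [single_dotProduct, ← hqs B]
      split_ifs with hAB
      · exact hAB ▸ hM.splitSign_eq_one hA ha hc hb
      · exact hM.splitSign_eq_zero hA hB ha hc hb fun h =>
          hAB (huniq B hB h.1 h.2.1 h.2.2).symm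
    · exact ⟨0, fun h => absurd h hA⟩
  choose f hf using this
  exact ⟨f, fun A hA B hB => hf A hA B hB⟩

theorem le_sum_splitSign (hM : IsClusterSystem k M) {t : Finset (Fin n) → ℝ} (t0 : ∀ A, 0 ≤ t A)
    (ht : ∀ A ∉ M, t A = 0) {A : Finset (Fin n)} (hA : A ∈ M) {a b c : Fin n} (ha : a ∈ A)
    (hc : c ∈ A) (hb : b ∉ A) : t A ≤ ∑ B, t B * (splitSign B a b c k : ℝ) := by
  have h1 : t A = t A * (splitSign A a b c k : ℝ) := by
    rw [hM.splitSign_eq_one hA ha hc hb, Int.cast_one, mul_one]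
  rw [h1]
  refine Finset.single_le_sum (f := fun B => t B * (splitSign B a b c k : ℝ)) (fun B _ => ?_)
    (Finset.mem_univ A)
  by_cases hB : B ∈ M
  · exact mul_nonneg (t0 B) (Int.cast_nonneg (hM.splitSign_nonneg hA hB ha hc hb))
  · simp [ht B hB]

/-- Buneman's criterion: the length belonging to the set `A` is the minimum of the double ratios of
`(a, b)` and `(c, k)` with `a, c ∈ A` and `b ∉ A`, or zero if this is not positive. -/
theorem exists_sum_splitSign_le (hM : IsClusterSystem k M) (hn : 2 ≤ n)
    {t : Finset (Fin n) → ℝ} (t0 : ∀ A, 0 ≤ t A) (ht : ∀ A ∉ M, t A = 0) {A : Finset (Fin n)}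
    (hk : k ∉ A) (hA2 : 2 ≤ A.card) (hroot : A ≠ rootCluster k) :
    ∃ a ∈ A, ∃ c ∈ A, ∃ b ∉ A, a ≠ c ∧ b ≠ k ∧ ∑ B, t B * (splitSign B a b c k : ℝ) ≤ t A := by
  by_cases hcomp : ∀ B ∈ M, A ⊆ B ∨ B ⊆ A ∨ Disjoint A B
  · -- `A` can be added to the system, and a quadruple detecting it there does the job.
    have hM' : IsClusterSystem k (insert A M) := by
      refine ⟨?_, ?_, ?_, ?_⟩
      · simpa using ⟨hk, hM.notMem⟩
      · simpa using ⟨hA2, hM.two_le⟩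
      · exact Finset.forall_mem_insert _ _ _ |>.2 ⟨hroot, hM.ne_root⟩
      · intro B hB C hC
        rcases Finset.mem_insert.1 hB with rfl | hB'
        · rcases Finset.mem_insert.1 hC with rfl | hC'
          · exact Or.inl subset_rfl
          · exact hcomp C hC'
        · rcases Finset.mem_insert.1 hC with rfl | hC'
          · rcases hcomp B hB' with h | h | h
            exacts [Or.inr (Or.inl h), Or.inl h, Or.inr (Or.inr h.symm)]
          · exact hM.laminar B hB' C hC'
    have hA := Finset.mem_insert_self A M
    obtain ⟨a, ha, c, hc, b, hb, hac, hbk, huniq⟩ := hM'.exists_detecting hn hA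
    refine ⟨a, ha, c, hc, b, hb, hac, hbk, le_of_eq ?_⟩
    rw [Finset.sum_eq_single A]
    · rw [hM'.splitSign_eq_one hA ha hc hb, Int.cast_one, mul_one]
    · intro B _ hBA
      by_cases hB : B ∈ M
      · have hB' := Finset.mem_insert_of_mem (s := M) (b := A) hB
        rw [hM'.splitSign_eq_zero hA hB' ha hc hb fun h =>
          hBA (huniq B hB' h.1 h.2.1 h.2.2), Int.cast_zero, mul_zero]
      · rw [ht B hB, zero_mul]
    · simp
  · -- Some member `B` crosses `A`, so nothing separates `A ∩ B` and `A \ B` from `B \ A`.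
    push Not at hcomp
    obtain ⟨B, hB, hAB, hBA, hdisj⟩ := hcomp
    obtain ⟨a, ha, haB⟩ := Finset.not_subset.1 hAB
    obtain ⟨b, hb, hbA⟩ := Finset.not_subset.1 hBA
    obtain ⟨c, hc, hcB⟩ := Finset.not_disjoint_iff.1 hdisj
    refine ⟨a, ha, c, hc, b, hbA, fun h => haB (h ▸ hcB), fun h => hM.notMem B hB (h ▸ hb),
      (Finset.sum_nonpos fun C _ => ?_).trans (t0 A)⟩
    by_cases hC : C ∈ M
    · have h1 := hM.splitSign_nonneg hB hC hb hcB haB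
      have h2 : splitSign C a b c k = -splitSign C b a c k := by
        rw [splitSign, splitSign]
        ring
      refine mul_nonpos_of_nonneg_of_nonpos (t0 C) ?_
      rw [h2, Int.cast_neg]
      exact neg_nonpos.2 (Int.cast_nonneg h1)
    · simp [ht C hC]

/-- The double ratios of a tropical curve determine its edges and their lengths: each length in one
system is a lower bound of certain double ratios, and by Buneman's criterion one of these is at most
the corresponding length in the other system. -/
theorem combine_injective {M' : Finset (Finset (Fin n))} (hM : IsClusterSystem k M)
    (hM' : IsClusterSystem k M') (hn : 2 ≤ n) {t s : Finset (Fin n) → ℝ} (t0 : ∀ A, 0 ≤ t A)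
    (ht : ∀ A ∉ M, t A = 0) (s0 : ∀ A, 0 ≤ s A) (hs : ∀ A ∉ M', s A = 0)
    (h : combine splitVector t = combine splitVector s) : t = s := by
  have key : ∀ {M M' : Finset (Finset (Fin n))} {t s : Finset (Fin n) → ℝ},
      IsClusterSystem k M → IsClusterSystem k M' → (∀ A, 0 ≤ t A) → (∀ A ∉ M, t A = 0) →
      (∀ A, 0 ≤ s A) → (∀ A ∉ M', s A = 0) → combine splitVector t = combine splitVector s →
      ∀ A, t A ≤ s A := by
    intro M M' t s hM hM' t0 ht s0 hs h A
    by_cases hA : A ∈ M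
    · obtain ⟨a, ha, c, hc, b, hb, hac, hbk, hle⟩ := hM'.exists_sum_splitSign_le hn s0 hs
        (hM.notMem A hA) (hM.two_le A hA) (hM.ne_root A hA)
      have hak : a ≠ k := fun h => hM.notMem A hA (h ▸ ha)
      have hck : c ≠ k := fun h => hM.notMem A hA (h ▸ hc)
      obtain ⟨q, r, hqr⟩ := exists_coordinate (fun h : a = b => hb (h ▸ ha)) hck hac hak
        (fun h : b = c => hb (h ▸ hc)) hbk
      have hsum : ∀ x : Finset (Fin n) → ℝ, ∑ B, x B * (splitSign B a b c k : ℝ)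
          = r * combine splitVector x q := by
        intro x
        rw [combine_apply_coord, Finset.mul_sum]
        refine Finset.sum_congr rfl fun B _ => ?_
        rw [hqr B, Int.cast_mul]
        ring
      calc t A ≤ _ := hM.le_sum_splitSign t0 ht hA ha hc hb
        _ = _ := by rw [hsum, h, ← hsum]
        _ ≤ s A := hle
    · rw [ht A hA]
      exact s0 A
  funext A
  exact le_antisymm (key hM hM' t0 ht s0 hs h A) (key hM' hM s0 hs t0 ht h.symm A)

end IsClusterSystem

/-! ### The fan of the `ψ`-divisor -/

section CastVec

variable {ι : Type*}

theorem castVec_add (x y : ι → ℤ) : castVec (x + y) = castVec x + castVec y := by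
  funext i
  simp [castVec]

theorem castVec_zsmul (m : ℤ) (x : ι → ℤ) : castVec (m • x) = (m : ℝ) • castVec x := by
  funext i
  simp [castVec]

theorem castVec_sum {β : Type*} (s : Finset β) (x : β → ι → ℤ) :
    castVec (∑ b ∈ s, x b) = ∑ b ∈ s, castVec (x b) := by
  funext i
  simp [castVec]

end CastVec

/-- The cluster systems of the facets of the `ψ_k`-divisor: they have `n - 4` members, and the
vertex adjacent to the leaf `k` has three neighbours besides this leaf. -/
def psiFamily (n : ℕ) (k : Fin n) : Set (Finset (Finset (Fin n))) :=
  {M | IsClusterSystem k M ∧ M.card + 4 = n ∧ (children (nodes k M) (rootCluster k)).card = 3}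

namespace IsClusterSystem

variable {n : ℕ} {k : Fin n} {R : Finset (Finset (Fin n))}

theorem castVec_splitVector_mem (k : Fin n) {R : Finset (Finset (Fin n))} {B : Finset (Fin n)}
    (hB : B ∈ nodes k R) : castVec (splitVector B) ∈ coneSpan splitVector R := by
  have h0 : castVec (0 : PairOfPairs n → ℤ) = 0 := by
    funext i
    simp [castVec]
  rcases mem_nodes.1 hB with rfl | hB | ⟨i, -, rfl⟩
  · rw [splitVector_rootCluster, h0]
    exact Submodule.zero_mem _
  · exact castVec_mem_coneSpan _ hB
  · rw [splitVector_singleton, h0]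
    exact Submodule.zero_mem _

theorem notMem_nodes {b : Finset (Fin n)} (hbR : b ∉ R) (hb2 : 2 ≤ b.card)
    (hroot : b ≠ rootCluster k) : b ∉ nodes k R := fun h => by
  rcases mem_nodes.1 h with h | h | ⟨i, -, rfl⟩
  · exact hroot h
  · exact hbR h
  · simp at hb2

theorem mem_insert_of_ssubset {b P : Finset (Fin n)} (hb2 : 2 ≤ b.card) (hP : P ∈ nodes k R)
    (h : b ⊂ P) : P ∈ insert (rootCluster k) R := by
  rcases mem_nodes.1 hP with rfl | hP | ⟨i, -, rfl⟩
  · exact Finset.mem_insert_self _ _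
  · exact Finset.mem_insert_of_mem hP
  · have := Finset.card_lt_card h
    rw [Finset.card_singleton] at this
    omega

/-- In a facet of the `ψ_k`-divisor, the root cluster has three children and each other inner node
has two. The special node `P` of a cone of codimension one has one child more than that, and the root
cluster has three children if it is not special itself. -/
def IsSpecialNode (k : Fin n) (R : Finset (Finset (Fin n))) (P : Finset (Fin n)) : Prop :=
  P = rootCluster k ∧ (children (nodes k R) (rootCluster k)).card = 4 ∨
  P ∈ R ∧ (children (nodes k R) (rootCluster k)).card = 3 ∧ (children (nodes k R) P).card = 3

theorem two_le_card_children (hR : IsClusterSystem k R) (hn : 2 ≤ n) {P : Finset (Fin n)}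
    (hP : P ∈ R) : 2 ≤ (children (nodes k R) P).card :=
  (hR.isHierarchy hn).two_le_card_children (hR.notMem P hP) (hR.two_le P hP)

theorem IsSpecialNode.unique (hR : IsClusterSystem k R) (hn : 3 ≤ n) (hcard : R.card + 5 = n)
    {P P' : Finset (Fin n)} (hP : IsSpecialNode k R P) (hP' : IsSpecialNode k R P') : P = P' := by
  have hsum := hR.sum_card_children hn
  rcases hP with ⟨rfl, h4⟩ | ⟨hPR, h3, hP3⟩ <;> rcases hP' with ⟨rfl, h4'⟩ | ⟨hPR', h3', hP3'⟩
  · rfl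
  · omega
  · omega
  · by_contra hne
    have hPR'' := Finset.mem_erase.2 ⟨Ne.symm hne, hPR'⟩
    rw [← Finset.add_sum_erase _ _ hPR, ← Finset.add_sum_erase _ _ hPR''] at hsum
    have h1 : ((R.erase P).erase P').card * 2
        ≤ ∑ C ∈ (R.erase P).erase P', (children (nodes k R) C).card := by
      rw [← smul_eq_mul]
      exact Finset.card_nsmul_le_sum _ _ _ fun C hC => hR.two_le_card_children (by omega)
        (Finset.mem_of_mem_erase (Finset.mem_of_mem_erase hC))
    have h2 := Finset.card_erase_add_one hPR
    have h3 := Finset.card_erase_add_one hPR''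
    omega

/-- A facet around the cone of `R` is obtained by joining two children of the special node. -/
theorem exists_pair_of_insert_mem {b : Finset (Fin n)} (hb : b ∉ R)
    (h : insert b R ∈ psiFamily n k) : ∃ P, IsSpecialNode k R P ∧
      ∃ S ∈ (children (nodes k R) P).powersetCard 2, S.biUnion id = b := by
  obtain ⟨hM, hcard, hroot⟩ := h
  have hR := hM.mono (Finset.subset_insert b R)
  have hbM := Finset.mem_insert_self b R
  rw [Finset.card_insert_of_notMem hb] at hcard
  have hN := hM.isHierarchy (by omega)
  rw [nodes_insert] at hN hroot
  have hbN := notMem_nodes (k := k) hb (hM.two_le b hbM) (hM.ne_root b hbM)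
  obtain ⟨P, hP, hbP⟩ := hN.exists_parent (Finset.mem_insert_self b _) (hM.ne_root b hbM)
  have hPN : P ∈ nodes k R := Finset.mem_of_mem_insert_of_ne hP
    fun h => (mem_children.1 hbP).2.1.ne h.symm
  have hPR := mem_insert_of_ssubset (hM.two_le b hbM) hPN (mem_children.1 hbP).2.1
  have hP2 : 2 ≤ P.card :=
    (hM.two_le b hbM).trans (Finset.card_le_card (mem_children.1 hbP).2.1.subset)
  have hc := hN.card_children_of_insert hbN hbP
  have hb2 := hN.two_le_card_children (hM.notMem b hbM) (hM.two_le b hbM)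
  have hPc2 := hN.two_le_card_children (hN.notMem P hP) hP2
  have hsum := hR.sum_card_children (by omega)
  have hspecial : IsSpecialNode k R P ∧ (children (insert b (nodes k R)) b).card = 2 := by
    have hle : ∀ C ∈ R, 2 ≤ (children (nodes k R) C).card := fun C hC =>
      hR.two_le_card_children (by omega) hC
    rcases Finset.mem_insert.1 hPR with rfl | hPR
    · have h1 := Finset.card_nsmul_le_sum _ _ _ hle
      rw [smul_eq_mul] at h1
      exact ⟨Or.inl ⟨rfl, by omega⟩, by omega⟩
    · have hne : rootCluster k ≠ P := fun h => hR.ne_root P hPR h.symm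
      have hr := hN.children_of_insert_of_ne hbN hPN hbP (mem_nodes.2 (Or.inl rfl)) hne
      rw [← hr] at hroot
      rw [← Finset.add_sum_erase _ _ hPR] at hsum
      have h1 := Finset.card_nsmul_le_sum (R.erase P) _ _ fun C hC =>
        hle C (Finset.mem_of_mem_erase hC)
      rw [smul_eq_mul] at h1
      have h2 := Finset.card_erase_add_one hPR
      exact ⟨Or.inr ⟨hPR, hroot, by omega⟩, by omega⟩
  refine ⟨P, hspecial.1, children (insert b (nodes k R)) b, Finset.mem_powersetCard.2
    ⟨?_, hspecial.2⟩, hN.biUnion_children (hM.notMem b hbM) (hM.two_le b hbM)⟩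
  rw [hN.children_of_insert hbN hbP]
  exact Finset.subset_union_right

/-- Conversely, joining two children of the special node yields a facet. -/
theorem insert_mem_of_pair (hR : IsClusterSystem k R) (hcard : R.card + 5 = n)
    {P : Finset (Fin n)} (hP : IsSpecialNode k R P) {S : Finset (Finset (Fin n))}
    (hS : S ∈ (children (nodes k R) P).powersetCard 2) :
    S.biUnion id ∉ R ∧ insert (S.biUnion id) R ∈ psiFamily n k := by
  have hN := hR.isHierarchy (by omega)
  set b := S.biUnion id with hb
  obtain ⟨hSP, hS2⟩ := Finset.mem_powersetCard.1 hS
  have hmemb : ∀ {i}, i ∈ b ↔ ∃ B ∈ S, i ∈ B := fun {i} => by simp [hb]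
  have hPN : P ∈ nodes k R := by
    rcases hP with ⟨rfl, -⟩ | ⟨hP, -⟩
    exacts [mem_nodes.2 (Or.inl rfl), mem_nodes_of_mem hP]
  have hPc : 3 ≤ (children (nodes k R) P).card := by
    rcases hP with ⟨rfl, h⟩ | ⟨-, -, h⟩ <;> omega
  -- There is a further child of `P`, so `b` is a proper subset of `P`.
  have hbP : b ⊂ P := by
    rw [Finset.ssubset_iff_subset_ne]
    constructor
    · intro i hi
      obtain ⟨B, hB, hiB⟩ := hmemb.1 hi
      exact (mem_children.1 (hSP hB)).2.1.subset hiB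
    · intro h
      obtain ⟨C, hC, hCS⟩ := Finset.exists_mem_notMem_of_card_lt_card
        (show S.card < (children (nodes k R) P).card by omega)
      obtain ⟨i, hi⟩ := hN.nonempty C (mem_children.1 hC).1
      have hib : i ∈ b := h ▸ (mem_children.1 hC).2.1.subset hi
      obtain ⟨B, hB, hiB⟩ := hmemb.1 hib
      exact hCS (hN.eq_of_mem_children (hSP hB) hC hiB hi ▸ hB)
  obtain ⟨B₁, B₂, hne, hS12⟩ := Finset.card_eq_two.1 hS2
  have hB₁ : B₁ ∈ S := by rw [hS12]; simp
  have hB₂ : B₂ ∈ S := by rw [hS12]; simp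
  have hsub : ∀ B ∈ S, B ⊂ b := by
    intro B hB
    refine Finset.ssubset_iff_subset_ne.2 ⟨fun i hi => hmemb.2 ⟨B, hB, hi⟩, fun h => ?_⟩
    have hall : ∀ C ∈ S, C = B := fun C hC => by
      obtain ⟨i, hi⟩ := hN.nonempty C (mem_children.1 (hSP hC)).1
      exact hN.eq_of_mem_children (hSP hC) (hSP hB) hi (h.symm ▸ hmemb.2 ⟨C, hC, hi⟩)
    exact hne ((hall B₁ hB₁).trans (hall B₂ hB₂).symm)
  have hb2 : 2 ≤ b.card := by
    have h1 := Finset.card_lt_card (hsub B₁ hB₁)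
    have h2 := Finset.card_pos.2 (hN.nonempty B₁ (mem_children.1 (hSP hB₁)).1)
    omega
  have hbN : b ∉ nodes k R := fun h =>
    (mem_children.1 (hSP hB₁)).2.2 b h (hsub B₁ hB₁) hbP
  have hbR : b ∉ R := fun h => hbN (mem_nodes_of_mem h)
  have hbroot : b ≠ rootCluster k := fun h => hbN (mem_nodes.2 (Or.inl h))
  have hcompat : ∀ C ∈ R, b ⊆ C ∨ C ⊆ b ∨ Disjoint b C := by
    intro C hC
    have hCN := mem_nodes_of_mem (k := k) hC
    rcases hN.laminar P hPN C hCN with h | h | h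
    · exact Or.inl (hbP.subset.trans h)
    · rcases eq_or_ne C P with rfl | hCP
      · exact Or.inl hbP.subset
      obtain ⟨D, hD, hCD⟩ := IsHierarchy.exists_child_superset hCN (h.ssubset_of_ne hCP)
      by_cases hDS : D ∈ S
      · exact Or.inr (Or.inl (hCD.trans (hsub D hDS).subset))
      · refine Or.inr (Or.inr (Finset.disjoint_left.2 fun i hi hiC => hDS ?_))
        obtain ⟨B, hB, hiB⟩ := hmemb.1 hi
        exact hN.eq_of_mem_children (hSP hB) hD hiB (hCD hiC) ▸ hB
    · exact Or.inr (Or.inr (h.mono_left hbP.subset))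
  have hM : IsClusterSystem k (insert b R) := by
    refine ⟨?_, ?_, ?_, ?_⟩
    · exact (Finset.forall_mem_insert _ _ _).2 ⟨fun h => hN.notMem P hPN (hbP.subset h), hR.notMem⟩
    · exact (Finset.forall_mem_insert _ _ _).2 ⟨hb2, hR.two_le⟩
    · exact (Finset.forall_mem_insert _ _ _).2 ⟨hbroot, hR.ne_root⟩
    · intro C hC D hD
      rcases Finset.mem_insert.1 hC with hC | hC
      · rcases Finset.mem_insert.1 hD with hD | hD
        · exact Or.inl (hC.trans hD.symm).subset
        · exact hC ▸ hcompat D hD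
      · rcases Finset.mem_insert.1 hD with hD | hD
        · rcases hcompat C hC with h | h | h
          exacts [Or.inr (Or.inl (hD ▸ h)), Or.inl (hD ▸ h), Or.inr (Or.inr (hD ▸ h.symm))]
        · exact hR.laminar C hC D hD
  have hN' := hM.isHierarchy (by omega)
  rw [nodes_insert] at hN'
  have hbchild : b ∈ children (insert b (nodes k R)) P := by
    refine mem_children.2 ⟨Finset.mem_insert_self _ _, hbP, fun D hD hbD => ?_⟩
    rcases Finset.mem_insert.1 hD with rfl | hD
    · exact absurd rfl hbD.ne
    · exact (mem_children.1 (hSP hB₁)).2.2 D hD ((hsub B₁ hB₁).trans hbD)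
  have hchb : children (insert b (nodes k R)) b = S := by
    have hSsub : S ⊆ children (insert b (nodes k R)) b := fun B hB => by
      have hB' := mem_children.1 (hSP hB)
      refine mem_children.2 ⟨Finset.mem_insert_of_mem hB'.1, hsub B hB, fun D hD hBD hDb => ?_⟩
      rcases Finset.mem_insert.1 hD with rfl | hD
      · exact hDb.ne rfl
      · exact hB'.2.2 D hD hBD (hDb.trans hbP)
    refine Finset.Subset.antisymm (fun C hC => ?_) hSsub
    obtain ⟨i, hi⟩ := hN'.nonempty C (mem_children.1 hC).1
    obtain ⟨B, hB, hiB⟩ := hmemb.1 ((mem_children.1 hC).2.1.subset hi)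
    exact hN'.eq_of_mem_children (hSsub hB) hC hiB hi ▸ hB
  refine ⟨hbR, hM, by rw [Finset.card_insert_of_notMem hbR]; omega, ?_⟩
  rw [nodes_insert]
  rcases hP with ⟨rfl, h4⟩ | ⟨hPR, h3, -⟩
  · have := hN'.card_children_of_insert hbN hbchild
    rw [hchb] at this
    omega
  · rw [← hN'.children_of_insert_of_ne hbN hPN hbchild (mem_nodes.2 (Or.inl rfl))
      fun h => hR.ne_root P hPR h.symm, h3]

/-- The rays completing the cone of `R` to a facet come from the unions of two children of the
special node `P`; their sum is a combination of the vectors of `P` and of the children of `P`. -/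
theorem sum_splitVector_mem {a : Finset (Fin n)} (ha : a ∉ R)
    (haF : insert a R ∈ psiFamily n k) {A : Finset (Finset (Fin n))}
    (hA : ∀ b, b ∈ A ↔ b ∉ R ∧ insert b R ∈ psiFamily n k) :
    ∑ b ∈ A, castVec (splitVector b) ∈ coneSpan splitVector R := by
  have hR := haF.1.mono (Finset.subset_insert a R)
  have hcard : R.card + 5 = n := by
    have := haF.2.1
    rw [Finset.card_insert_of_notMem ha] at this
    omega
  have hN := hR.isHierarchy (by omega)
  obtain ⟨P, hP, -⟩ := exists_pair_of_insert_mem ha haF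
  have hPN : P ∈ nodes k R := by
    rcases hP with ⟨rfl, -⟩ | ⟨hP, -⟩
    exacts [mem_nodes.2 (Or.inl rfl), mem_nodes_of_mem hP]
  have hP2 : 2 ≤ P.card := by
    rcases hP with ⟨rfl, -⟩ | ⟨hP, -⟩
    · have := card_rootCluster k
      omega
    · exact hR.two_le P hP
  have himage : A = ((children (nodes k R) P).powersetCard 2).image fun S => S.biUnion id := by
    ext b
    rw [hA, Finset.mem_image]
    constructor
    · rintro ⟨hb, hbF⟩
      obtain ⟨P', hP', S, hS, hSb⟩ := exists_pair_of_insert_mem hb hbF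
      rw [IsSpecialNode.unique hR (by omega) hcard hP' hP] at hS
      exact ⟨S, hS, hSb⟩
    · rintro ⟨S, hS, rfl⟩
      exact insert_mem_of_pair hR hcard hP hS
  have hinj : Set.InjOn (fun S : Finset (Finset (Fin n)) => S.biUnion id)
      ((children (nodes k R) P).powersetCard 2 : Finset _) := by
    have hsub : ∀ S ∈ (children (nodes k R) P).powersetCard 2,
        ∀ S' ∈ (children (nodes k R) P).powersetCard 2, S.biUnion id = S'.biUnion id → S ⊆ S' := by
      intro S hS S' hS' h B hB
      have hBc := (Finset.mem_powersetCard.1 hS).1 hB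
      obtain ⟨i, hi⟩ := hN.nonempty B (mem_children.1 hBc).1
      have hi' : i ∈ S'.biUnion id := h ▸ Finset.mem_biUnion.2 ⟨B, hB, hi⟩
      obtain ⟨B', hB', hiB'⟩ := Finset.mem_biUnion.1 hi'
      exact hN.eq_of_mem_children ((Finset.mem_powersetCard.1 hS').1 hB') hBc hiB' hi ▸ hB'
    exact fun S hS S' hS' h => (hsub S hS S' hS' h).antisymm (hsub S' hS' S hS h.symm)
  rw [himage, Finset.sum_image hinj, ← castVec_sum,
    sum_splitVector_pairs (hN.pairwiseDisjoint_children P),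
    hN.biUnion_children (hN.notMem P hPN) hP2, castVec_add, castVec_zsmul, castVec_sum]
  exact Submodule.add_mem _ (Submodule.smul_mem _ _ (Submodule.sum_mem _ fun B hB =>
    castVec_splitVector_mem k (mem_children.1 hB).1)) (castVec_splitVector_mem k hPN)

end IsClusterSystem

theorem isBalancedFan_psiFamily {n : ℕ} (hn : 4 ≤ n) (k : Fin n) :
    IsBalancedFan (n - 4) splitVector (psiFamily n k) where
  card_eq M hM := by
    have := hM.2.1
    omega
  dual M hM := hM.1.exists_isDualOn (by omega)
  unique M hM M' hM' _ _ t0 ht s0 hs h :=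
    hM.1.combine_injective hM'.1 (by omega) t0 ht s0 hs h
  balanced _ _ ha haF _ hA := IsClusterSystem.sum_splitVector_mem ha haF hA

/-! ### The tree of a hierarchy -/

/-- A path uses an oriented edge `δ`, the only one that leaves the vertex set `S`, if and only if it
starts in `S` and ends outside of `S`. -/
theorem mem_darts_iff_of_isPath {V : Type*} {G : SimpleGraph V} {S : Set V} {δ : G.Dart}
    (h1 : δ.fst ∈ S) (h2 : δ.snd ∉ S)
    (huniq : ∀ δ' : G.Dart, δ'.fst ∈ S → δ'.snd ∉ S → δ' = δ) {u v : V} (p : G.Walk u v)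
    (hp : p.IsPath) : δ ∈ p.darts ↔ u ∈ S ∧ v ∉ S := by
  refine ⟨fun hδ => ?_, fun ⟨hu, hv⟩ => ?_⟩
  · induction p with
    | nil => simp at hδ
    | @cons u x v h p ih =>
      have hedge : s(u, x) ∉ p.edges := fun he =>
        ((SimpleGraph.Walk.cons_isPath_iff h p).1 hp).2 (p.fst_mem_support_of_mem_edges he)
      rw [SimpleGraph.Walk.darts_cons, List.mem_cons] at hδ
      rcases hδ with rfl | hδ
      · refine ⟨h1, fun hv => ?_⟩
        obtain ⟨d, hd, hd1, hd2⟩ := p.reverse.exists_boundary_dart S hv h2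
        have := huniq d hd1 hd2
        subst this
        rw [SimpleGraph.Walk.mem_darts_reverse] at hd
        refine hedge (List.mem_map.2 ⟨_, hd, ?_⟩)
        rw [SimpleGraph.Dart.edge_symm]
        rfl
      · obtain ⟨hx, hv⟩ := ih ((SimpleGraph.Walk.cons_isPath_iff h p).1 hp).1 hδ
        refine ⟨by_contra fun hu => hedge ?_, hv⟩
        have := huniq (⟨(u, x), h⟩ : G.Dart).symm hx hu
        rw [← this] at hδ
        refine List.mem_map.2 ⟨_, hδ, ?_⟩
        rw [SimpleGraph.Dart.edge_symm]
        rfl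
  · obtain ⟨d, hd, hd1, hd2⟩ := p.exists_boundary_dart S hu hv
    exact huniq d hd1 hd2 ▸ hd

/-- The vertices of the tree of a hierarchy: its members, and the set of all markings, which stands
for the leaf `k`. -/
abbrev Node {n : ℕ} (N : Finset (Finset (Fin n))) : Type :=
  {A : Finset (Fin n) // A ∈ insert Finset.univ N}

namespace IsHierarchy

variable {n : ℕ} {k : Fin n} {N : Finset (Finset (Fin n))}

theorem univ_notMem (hN : IsHierarchy k N) : Finset.univ ∉ N := fun h =>
  hN.notMem _ h (Finset.mem_univ k)

/-- The set of all markings, as a vertex. -/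
def topNode (N : Finset (Finset (Fin n))) : Node N := ⟨Finset.univ, Finset.mem_insert_self _ _⟩

theorem mem_of_ne_top {A : Node N} (h : A ≠ topNode N) : A.1 ∈ N :=
  Finset.mem_of_mem_insert_of_ne A.2 fun h' => h (Subtype.ext h')

theorem le_topNode (A : Node N) : A ≤ topNode N := Finset.subset_univ A.1

theorem covBy_iff {A B : Node N} : A ⋖ B ↔ A.1 ∈ children N B.1 := by
  rw [mem_children]
  constructor
  · intro h
    have hA : A.1 ≠ Finset.univ := fun h' => h.1.not_ge
      (show B.1 ⊆ A.1 from h'.symm ▸ Finset.subset_univ B.1)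
    exact ⟨Finset.mem_of_mem_insert_of_ne A.2 hA, h.1, fun C hC hAC hCB =>
      h.2 (c := ⟨C, Finset.mem_insert_of_mem hC⟩) hAC hCB⟩
  · rintro ⟨-, hAB, h⟩
    refine ⟨hAB, fun C hAC hCB => h C.1 (Finset.mem_of_mem_insert_of_ne C.2 fun h' => ?_) hAC hCB⟩
    exact hCB.not_ge (show B.1 ⊆ C.1 from h'.symm ▸ Finset.subset_univ B.1)

theorem rootCluster_ssubset_univ (k : Fin n) : rootCluster k ⊂ Finset.univ :=
  Finset.erase_ssubset (Finset.mem_univ k)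

theorem covBy_topNode_iff (hN : IsHierarchy k N) {A : Node N} :
    A ⋖ topNode N ↔ A.1 = rootCluster k := by
  rw [covBy_iff, mem_children]
  constructor
  · rintro ⟨-, hA, h⟩
    by_contra hne
    have hAN : A.1 ∈ N := mem_of_ne_top fun h' => hA.ne (congrArg Subtype.val h')
    exact h _ hN.root_mem ((hN.subset_root hAN).ssubset_of_ne hne)
      (rootCluster_ssubset_univ k)
  · intro h
    refine ⟨h ▸ hN.root_mem, h ▸ rootCluster_ssubset_univ k, fun C hC hAC _ => ?_⟩
    exact hAC.not_subset (h ▸ hN.subset_root hC)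

theorem exists_covBy (hN : IsHierarchy k N) {A : Node N} (hA : A ≠ topNode N) :
    ∃ P : Node N, A ⋖ P := by
  have hAN := mem_of_ne_top hA
  by_cases hroot : A.1 = rootCluster k
  · exact ⟨topNode N, hN.covBy_topNode_iff.2 hroot⟩
  · obtain ⟨P, hP, hAP⟩ := hN.exists_parent hAN hroot
    exact ⟨⟨P, Finset.mem_insert_of_mem hP⟩, covBy_iff.2 hAP⟩

/-- The parent of `A` is the smallest vertex above `A`. -/
theorem le_of_covBy_of_lt (hN : IsHierarchy k N) {A P C : Node N} (hP : A ⋖ P) (hC : A < C) :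
    P ≤ C := by
  by_cases hCtop : C = topNode N
  · exact hCtop ▸ le_topNode P
  have hCN := mem_of_ne_top hCtop
  by_cases hPtop : P = topNode N
  · have h1 := hN.covBy_topNode_iff.1 (hPtop ▸ hP)
    have h2 : A.1 ⊂ C.1 := hC
    exact absurd (h1 ▸ hN.subset_root hCN) h2.not_subset
  · have hPN := mem_of_ne_top hPtop
    exact hN.parent_subset hPN (covBy_iff.1 hP) hCN hC

/-- The edge from `A` to its parent is the only edge leaving the set of the vertices below `A`. -/
theorem eq_of_adj_of_le (hN : IsHierarchy k N) {A P : Node N} (hP : A ⋖ P) {C D : Node N}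
    (hadj : (SimpleGraph.hasse (Node N)).Adj C D) (hC : C ≤ A) (hD : ¬ D ≤ A) : C = A ∧ D = P := by
  rcases hadj with h | h
  · have hCA : C = A := by
      by_contra hne
      exact hD (hN.le_of_covBy_of_lt h (lt_of_le_of_ne hC hne))
    subst hCA
    exact ⟨rfl, (hN.le_of_covBy_of_lt h hP.1).antisymm (hN.le_of_covBy_of_lt hP h.1)⟩
  · exact absurd (h.1.le.trans hC) hD

/-- All vertices are connected to the root, and the set of the vertices below `A` shows that the edge
above `A` is a bridge. -/
theorem isTree_hasse (hN : IsHierarchy k N) : (SimpleGraph.hasse (Node N)).IsTree := by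
  have hreach : ∀ A : Node N, (SimpleGraph.hasse (Node N)).Reachable A (topNode N) := by
    intro A
    induction A using WellFoundedGT.induction with
    | _ A ih =>
      by_cases hA : A = topNode N
      · rw [hA]
      · obtain ⟨P, hP⟩ := hN.exists_covBy hA
        exact (SimpleGraph.Adj.reachable (Or.inl hP)).trans (ih P hP.1)
  have : Nonempty (Node N) := ⟨topNode N⟩
  refine ⟨⟨fun A B => (hreach A).trans (hreach B).symm⟩, ?_⟩
  rw [SimpleGraph.isAcyclic_iff_forall_adj_isBridge]
  have hbridge : ∀ A P : Node N, A ⋖ P → (SimpleGraph.hasse (Node N)).IsBridge s(A, P) := by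
    intro A P hP
    rw [SimpleGraph.isBridge_iff_forall_walk_mem_edges]
    intro p
    obtain ⟨d, hd, hd1, hd2⟩ := p.exists_boundary_dart {C | C ≤ A} (le_refl A) hP.1.not_ge
    obtain ⟨h1, h2⟩ := hN.eq_of_adj_of_le hP d.adj hd1 hd2
    refine List.mem_map.2 ⟨d, hd, ?_⟩
    rw [← h1, ← h2]
    rfl
  intro A B hadj
  rcases hadj with h | h
  · exact hbridge A B h
  · rw [Sym2.eq_swap]
    exact hbridge B A h

theorem ncard_neighborSet_topNode (hN : IsHierarchy k N) :
    ((SimpleGraph.hasse (Node N)).neighborSet (topNode N)).ncard = 1 := by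
  rw [Set.ncard_eq_one]
  refine ⟨⟨rootCluster k, Finset.mem_insert_of_mem hN.root_mem⟩, ?_⟩
  ext A
  rw [SimpleGraph.mem_neighborSet, Set.mem_singleton_iff, Subtype.ext_iff]
  constructor
  · rintro (h | h)
    · exact absurd h.1 (not_lt_of_ge (le_topNode A))
    · exact hN.covBy_topNode_iff.1 h
  · exact fun h => Or.inr (hN.covBy_topNode_iff.2 h)

/-- A vertex other than the leaf `k` is adjacent to its parent and to its children. -/
theorem ncard_neighborSet (hN : IsHierarchy k N) {A : Node N} (hA : A.1 ∈ N) :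
    ((SimpleGraph.hasse (Node N)).neighborSet A).ncard = (children N A.1).card + 1 := by
  obtain ⟨P, hP⟩ := hN.exists_covBy (A := A) fun h => hN.univ_notMem (by rw [h] at hA; exact hA)
  have himage : Subtype.val '' (SimpleGraph.hasse (Node N)).neighborSet A
      = (insert P.1 (children N A.1) : Finset (Finset (Fin n))) := by
    ext B
    simp only [Set.mem_image, SimpleGraph.mem_neighborSet, Finset.coe_insert, Set.mem_insert_iff,
      Finset.mem_coe, SimpleGraph.hasse_adj]
    constructor
    · rintro ⟨C, h | h, rfl⟩
      · exact Or.inl (congrArg Subtype.val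
          ((hN.le_of_covBy_of_lt h hP.1).antisymm (hN.le_of_covBy_of_lt hP h.1)))
      · exact Or.inr (covBy_iff.1 h)
    · rintro (rfl | h)
      · exact ⟨P, Or.inl hP, rfl⟩
      · exact ⟨⟨B, Finset.mem_insert_of_mem (mem_children.1 h).1⟩,
          Or.inr (covBy_iff.2 h), rfl⟩
  rw [← Set.ncard_image_of_injective _ Subtype.val_injective, himage, Set.ncard_coe_finset,
    Finset.card_insert_of_notMem]
  intro h
  have h1 : P.1 ⊂ A.1 := (mem_children.1 h).2.1
  exact lt_asymm h1 hP.1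

/-- The vertex of the leaf with marking `i`. -/
def leafNode (hN : IsHierarchy k N) (i : Fin n) : Node N :=
  if h : i = k then topNode N else ⟨{i}, Finset.mem_insert_of_mem (hN.singleton_mem i h)⟩

theorem leafNode_root (hN : IsHierarchy k N) : hN.leafNode k = topNode N := dif_pos rfl

theorem leafNode_of_ne (hN : IsHierarchy k N) {i : Fin n} (h : i ≠ k) :
    (hN.leafNode i).1 = {i} := by
  rw [leafNode, dif_neg h]

theorem leafNode_le_iff (hN : IsHierarchy k N) {A : Node N} (hA : A.1 ∈ N) (i : Fin n) :
    hN.leafNode i ≤ A ↔ i ∈ A.1 := by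
  by_cases h : i = k
  · subst h
    rw [leafNode_root]
    exact ⟨fun h => h (Finset.mem_univ i), fun h => absurd h (hN.notMem _ hA)⟩
  · change (hN.leafNode i).1 ⊆ A.1 ↔ _
    rw [hN.leafNode_of_ne h, Finset.singleton_subset_iff]

/-- The combinatorial type of marked tree with the given hierarchy of sets of leaves. -/
def markedTree (hN : IsHierarchy k N) (hn : 3 ≤ n) : MarkedTree n where
  V := Node N
  finite := inferInstance
  graph := SimpleGraph.hasse (Node N)
  isTree := hN.isTree_hasse
  leaf := hN.leafNode
  leaf_injective := by
    have huniv : ∀ i : Fin n, Finset.univ ≠ ({i} : Finset (Fin n)) := fun i h => by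
      have := congrArg Finset.card h
      rw [Finset.card_univ, Fintype.card_fin, Finset.card_singleton] at this
      omega
    intro i j h
    have h' := congrArg Subtype.val h
    by_cases hi : i = k <;> by_cases hj : j = k
    · rw [hi, hj]
    · rw [hi, leafNode_root, hN.leafNode_of_ne hj] at h'
      exact absurd h' (huniv j)
    · rw [hj, leafNode_root, hN.leafNode_of_ne hi] at h'
      exact absurd h'.symm (huniv i)
    · rw [hN.leafNode_of_ne hi, hN.leafNode_of_ne hj] at h'
      exact Finset.singleton_injective h'
  leaf_iff A := by
    by_cases hA : A = topNode N
    · rw [hA]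
      exact iff_of_true hN.ncard_neighborSet_topNode ⟨k, hN.leafNode_root⟩
    have hAN := mem_of_ne_top hA
    rw [hN.ncard_neighborSet hAN]
    constructor
    · intro h
      have hcard : ¬ 2 ≤ A.1.card := fun h2 => by
        have := hN.two_le_card_children (hN.notMem _ hAN) h2
        omega
      have hpos := Finset.card_pos.2 (hN.nonempty _ hAN)
      obtain ⟨i, hi⟩ := Finset.card_eq_one.1 (show A.1.card = 1 by omega)
      refine ⟨i, Subtype.ext ?_⟩
      rw [hN.leafNode_of_ne, hi]
      rintro rfl
      exact hN.notMem _ hAN (hi ▸ Finset.mem_singleton_self i)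
    · rintro ⟨i, rfl⟩
      have hi : i ≠ k := by
        rintro rfl
        exact hA hN.leafNode_root
      rw [hN.leafNode_of_ne hi, hN.children_singleton, Finset.card_empty]
  no_bivalent A := by
    by_cases hA : A = topNode N
    · rw [hA, hN.ncard_neighborSet_topNode]
      omega
    have hAN := mem_of_ne_top hA
    rw [hN.ncard_neighborSet hAN]
    rcases Nat.lt_or_ge A.1.card 2 with h | h
    · have hpos := Finset.card_pos.2 (hN.nonempty _ hAN)
      obtain ⟨i, hi⟩ := Finset.card_eq_one.1 (show A.1.card = 1 by omega)
      rw [hi, hN.children_singleton, Finset.card_empty]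
      omega
    · have := hN.two_le_card_children (hN.notMem _ hAN) h
      omega

variable (hN : IsHierarchy k N) (hn : 3 ≤ n)

/-- The vertex adjacent to the leaf `k` is the root cluster. -/
theorem exists_adj_leaf_valence_iff :
    (∃ v, (hN.markedTree hn).graph.Adj ((hN.markedTree hn).leaf k) v ∧
      (hN.markedTree hn).valence v = 4) ↔ (children N (rootCluster k)).card = 3 := by
  have hval : ∀ v : Node N, v.1 = rootCluster k →
      ((SimpleGraph.hasse (Node N)).neighborSet v).ncard
        = (children N (rootCluster k)).card + 1 := fun v hv => by
    rw [hN.ncard_neighborSet (hv ▸ hN.root_mem), hv]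
  constructor
  · rintro ⟨v, hadj, h4⟩
    change (SimpleGraph.hasse (Node N)).Adj (hN.leafNode k) v at hadj
    rw [leafNode_root] at hadj
    have hv : v.1 = rootCluster k := by
      rcases hadj with h | h
      · exact absurd h.1 (not_lt_of_ge (le_topNode v))
      · exact hN.covBy_topNode_iff.1 h
    have h4' : ((SimpleGraph.hasse (Node N)).neighborSet v).ncard = 4 := h4
    have := hval v hv
    omega
  · intro h3
    refine ⟨⟨rootCluster k, Finset.mem_insert_of_mem hN.root_mem⟩, ?_, ?_⟩
    · change (SimpleGraph.hasse (Node N)).Adj (hN.leafNode k) _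
      rw [leafNode_root]
      exact Or.inr (hN.covBy_topNode_iff.2 rfl)
    · exact (hval _ rfl).trans (by rw [h3])

/-- The oriented edge from `A` to its parent lies on the path from `a` to `b` iff `A` contains `a`
but not `b`. -/
theorem onPath_iff {A P : Node N} (hA : A.1 ∈ N) (hP : A ⋖ P) (a b : Fin n) :
    (hN.markedTree hn).OnPath a b ⟨(A, P), Or.inl hP⟩ ↔ a ∈ A.1 ∧ b ∉ A.1 := by
  have key := fun (p : (SimpleGraph.hasse (Node N)).Walk (hN.leafNode a) (hN.leafNode b)) hp =>
    mem_darts_iff_of_isPath (S := {C : Node N | C ≤ A}) (δ := ⟨(A, P), Or.inl hP⟩)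
    (le_refl A) hP.1.not_ge (fun δ' h1 h2 => by
      obtain ⟨h3, h4⟩ := hN.eq_of_adj_of_le hP δ'.adj h1 h2
      exact SimpleGraph.Dart.ext _ _ (Prod.ext h3 h4)) p hp
  rw [← hN.leafNode_le_iff hA, ← hN.leafNode_le_iff hA]
  constructor
  · rintro ⟨p, hp, hδ⟩
    exact (key p hp).1 hδ
  · intro h
    obtain ⟨p, hp, -⟩ := hN.isTree_hasse.existsUnique_path (hN.leafNode a) (hN.leafNode b)
    exact ⟨p, hp, (key p hp).2 h⟩

theorem onPath_symm (T : MarkedTree n) (a b : Fin n) (δ : T.graph.Dart) :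
    T.OnPath a b δ.symm ↔ T.OnPath b a δ := by
  have : ∀ (a b : Fin n) (δ : T.graph.Dart), T.OnPath a b δ → T.OnPath b a δ.symm := by
    rintro a b δ ⟨p, hp, hδ⟩
    exact ⟨p.reverse, hp.reverse, SimpleGraph.Walk.mem_darts_reverse.2 (by simpa using hδ)⟩
  exact ⟨fun h => by simpa using this _ _ _ h, this _ _ _⟩

/-- The sign of the edge from `A` to its parent in a double ratio only depends on which of the four
markings lie in `A`. -/
theorem sign_eq_splitSign {A P : Node N} (hA : A.1 ∈ N) (hP : A ⋖ P) (a b c d : Fin n)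
    (e : (hN.markedTree hn).BoundedEdge) (he : e.1 = s(A, P)) :
    (hN.markedTree hn).sign a b c d e = splitSign A.1 a b c d := by
  classical
  let δ₀ : (hN.markedTree hn).graph.Dart := ⟨(A, P), Or.inl hP⟩
  have hδ : ∀ δ : (hN.markedTree hn).graph.Dart, δ.edge = e.1 ↔ δ = δ₀ ∨ δ = δ₀.symm := by
    intro δ
    rw [he, ← SimpleGraph.dart_edge_eq_iff]
    rfl
  have h0 := fun a b => hN.onPath_iff hn hA hP a b
  have h0' : ∀ a b, (hN.markedTree hn).OnPath a b δ₀.symm ↔ b ∈ A.1 ∧ a ∉ A.1 := fun a b =>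
    (onPath_symm _ _ _ _).trans (h0 b a)
  have e1 : (∃ δ : (hN.markedTree hn).graph.Dart, δ.edge = e.1 ∧
      (hN.markedTree hn).OnPath a b δ ∧ (hN.markedTree hn).OnPath c d δ) ↔
      (a ∈ A.1 ∧ b ∉ A.1) ∧ (c ∈ A.1 ∧ d ∉ A.1) ∨ (b ∈ A.1 ∧ a ∉ A.1) ∧ (d ∈ A.1 ∧ c ∉ A.1) := by
    rw [← h0 a b, ← h0 c d, ← h0' a b, ← h0' c d]
    constructor
    · rintro ⟨δ, hδe, h⟩
      rcases (hδ δ).1 hδe with rfl | rfl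
      exacts [Or.inl h, Or.inr h]
    · rintro (h | h)
      exacts [⟨δ₀, (hδ _).2 (Or.inl rfl), h⟩, ⟨δ₀.symm, (hδ _).2 (Or.inr rfl), h⟩]
  have e2 : (∃ δ : (hN.markedTree hn).graph.Dart, δ.edge = e.1 ∧
      (hN.markedTree hn).OnPath a b δ ∧ (hN.markedTree hn).OnPath c d δ.symm) ↔
      (a ∈ A.1 ∧ b ∉ A.1) ∧ (d ∈ A.1 ∧ c ∉ A.1) ∨ (b ∈ A.1 ∧ a ∉ A.1) ∧ (c ∈ A.1 ∧ d ∉ A.1) := by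
    rw [← h0 a b, ← h0 c d, ← h0' a b, ← h0' c d]
    constructor
    · rintro ⟨δ, hδe, h⟩
      rcases (hδ δ).1 hδe with rfl | rfl
      · exact Or.inl h
      · rw [SimpleGraph.Dart.symm_symm] at h
        exact Or.inr h
    · rintro (h | h)
      · exact ⟨δ₀, (hδ _).2 (Or.inl rfl), h⟩
      · refine ⟨δ₀.symm, (hδ _).2 (Or.inr rfl), ?_⟩
        rw [SimpleGraph.Dart.symm_symm]
        exact h
  rw [MarkedTree.sign, if_congr e1 rfl (if_congr e2 rfl rfl), splitSign, indicator, indicator,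
    indicator, indicator]
  by_cases ha : a ∈ A.1 <;> by_cases hb : b ∈ A.1 <;> by_cases hc : c ∈ A.1 <;>
    by_cases hd : d ∈ A.1 <;> simp [ha, hb, hc, hd]

end IsHierarchy

/-! ### The order on the vertices of a rooted tree -/

section Below

variable {V : Type*} {G : SimpleGraph V} {r : V}

/-- The vertex `w` lies on the path from `v` to the root `r`. -/
def Below (G : SimpleGraph V) (r v w : V) : Prop :=
  ∃ p : G.Walk v r, p.IsPath ∧ w ∈ p.support

theorem Below.mem_support (hG : G.IsTree) {v w : V} (h : Below G r v w) {p : G.Walk v r}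
    (hp : p.IsPath) : w ∈ p.support := by
  obtain ⟨q, hq, hw⟩ := h
  rwa [(hG.existsUnique_path v r).unique hp hq]

theorem below_refl (hG : G.IsTree) (v : V) : Below G r v v := by
  obtain ⟨p, hp, -⟩ := hG.existsUnique_path v r
  exact ⟨p, hp, p.start_mem_support⟩

theorem below_root (hG : G.IsTree) (v : V) : Below G r v r := by
  obtain ⟨p, hp, -⟩ := hG.existsUnique_path v r
  exact ⟨p, hp, p.end_mem_support⟩

theorem Below.trans (hG : G.IsTree) {u v w : V} (h : Below G r u v) (h' : Below G r v w) :
    Below G r u w := by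
  classical
  obtain ⟨p, hp, hv⟩ := h
  exact ⟨p, hp, p.support_dropUntil_subset_support hv (h'.mem_support hG (hp.dropUntil hv))⟩

theorem Below.antisymm (hG : G.IsTree) {u v : V} (h : Below G r u v) (h' : Below G r v u) :
    u = v := by
  classical
  obtain ⟨p, hp, hv⟩ := h
  have hu := h'.mem_support hG (hp.dropUntil hv)
  by_contra hne
  rw [← p.take_spec hv] at hp
  exact hp.ne_of_mem_support_of_append hne (SimpleGraph.Walk.start_mem_support _) hu rfl

/-- The vertices above a given one form a chain. -/
theorem Below.comparable (hG : G.IsTree) {u v w : V} (h : Below G r u v) (h' : Below G r u w) :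
    Below G r v w ∨ Below G r w v := by
  classical
  obtain ⟨p, hp, hv⟩ := h
  have hw := h'.mem_support hG hp
  have hw' := hw
  rw [← p.take_spec hv, SimpleGraph.Walk.mem_support_append_iff] at hw'
  rcases hw' with hw' | hw'
  · refine Or.inr ⟨((p.takeUntil v hv).dropUntil w hw').append (p.dropUntil v hv), ?_, ?_⟩
    · rw [← p.take_spec hv, ← (p.takeUntil v hv).take_spec hw',
        ← SimpleGraph.Walk.append_assoc] at hp
      exact hp.of_append_right
    · rw [SimpleGraph.Walk.mem_support_append_iff]
      exact Or.inl (SimpleGraph.Walk.end_mem_support _)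
  · exact Or.inl ⟨_, hp.dropUntil hv, hw'⟩

theorem below_or_below_of_adj (hG : G.IsTree) {v w : V} (h : G.Adj v w) :
    Below G r v w ∨ Below G r w v := by
  obtain ⟨q, hq, -⟩ := hG.existsUnique_path w r
  by_cases hv : v ∈ q.support
  · exact Or.inr ⟨q, hq, hv⟩
  · exact Or.inl ⟨q.cons h, hq.cons hv, by simp⟩

theorem Below.eq_or_eq_of_adj (hG : G.IsTree) {u v w : V} (hadj : G.Adj v w)
    (h : Below G r v w) (hu : Below G r v u) (hu' : Below G r u w) : u = v ∨ u = w := by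
  obtain ⟨q, hq, -⟩ := hG.existsUnique_path w r
  have hv : v ∉ q.support := fun hv => hadj.ne (h.antisymm hG ⟨q, hq, hv⟩)
  have := hu.mem_support hG (hq.cons hv (h := hadj))
  rw [SimpleGraph.Walk.support_cons, List.mem_cons] at this
  exact this.imp id fun h => hu'.antisymm hG ⟨q, hq, h⟩

theorem Below.exists_adj {v w : V} (hne : v ≠ w) (h : Below G r v w) :
    ∃ x, G.Adj v x ∧ Below G r v x ∧ Below G r x w := by
  obtain ⟨p, hp, hw⟩ := h
  cases p with
  | nil => simp at hw; exact absurd hw.symm hne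
  | @cons _ x _ hadj q =>
    rw [SimpleGraph.Walk.support_cons, List.mem_cons] at hw
    exact ⟨x, hadj, ⟨_, hp, by simp⟩, q, hp.of_cons, hw.resolve_left hne.symm⟩

end Below

namespace MarkedTree

variable {n : ℕ}

/-- The vertices of a marked tree, ordered by the position with respect to the leaf `k` as root:
the root is the largest element, and the other leaves are the minimal elements. -/
def Rooted (T : MarkedTree n) (_k : Fin n) : Type := T.V

instance (T : MarkedTree n) (k : Fin n) : PartialOrder (T.Rooted k) where
  le := Below T.graph (T.leaf k)
  le_refl := below_refl T.isTree
  le_trans _ _ _ := Below.trans T.isTree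
  le_antisymm _ _ := Below.antisymm T.isTree

instance (T : MarkedTree n) (k : Fin n) : Finite (T.Rooted k) := T.finite

variable {T : MarkedTree n} {k : Fin n}

/-- A leaf as an element of the rooted tree. -/
def rleaf (T : MarkedTree n) (k i : Fin n) : T.Rooted k := T.leaf i

/-- The graph of a marked tree on the vertices of the rooted tree. -/
def rgraph (T : MarkedTree n) (k : Fin n) : SimpleGraph (T.Rooted k) := T.graph

theorem ncard_rgraph_eq_one_iff (v : T.Rooted k) :
    ((T.rgraph k).neighborSet v).ncard = 1 ↔ v ∈ Set.range (T.rleaf k) := T.leaf_iff v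

theorem ncard_rgraph_ne_two (v : T.Rooted k) : ((T.rgraph k).neighborSet v).ncard ≠ 2 :=
  T.no_bivalent v

theorem rleaf_injective : Function.Injective (T.rleaf k) := T.leaf_injective

theorem le_root (v : T.Rooted k) : v ≤ T.rleaf k k := below_root T.isTree v

theorem comparable_of_le {u v w : T.Rooted k} (h : u ≤ v) (h' : u ≤ w) : v ≤ w ∨ w ≤ v :=
  Below.comparable T.isTree h h'

theorem adj_iff_covBy {v w : T.Rooted k} : (T.rgraph k).Adj v w ↔ v ⋖ w ∨ w ⋖ v := by
  have h1 : ∀ {v w : T.Rooted k}, (T.rgraph k).Adj v w → v ≤ w → v ⋖ w := by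
    intro v w hadj hle
    refine ⟨lt_of_le_of_ne hle hadj.ne, fun u hvu huw => ?_⟩
    rcases Below.eq_or_eq_of_adj T.isTree hadj hle hvu.le huw.le with h | h
    exacts [hvu.ne h.symm, huw.ne h]
  have h2 : ∀ {v w : T.Rooted k}, v ⋖ w → (T.rgraph k).Adj v w := by
    intro v w h
    obtain ⟨x, hadj, hvx, hxw⟩ : ∃ x : T.Rooted k, (T.rgraph k).Adj v x ∧ v ≤ x ∧ x ≤ w :=
      Below.exists_adj h.1.ne h.1.le
    rcases eq_or_lt_of_le hxw with rfl | hlt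
    · exact hadj
    · exact absurd hlt (h.2 (lt_of_le_of_ne hvx hadj.ne))
  constructor
  · intro hadj
    have h : v ≤ w ∨ w ≤ v := below_or_below_of_adj T.isTree hadj
    exact h.imp (h1 hadj) (h1 hadj.symm)
  · rintro (h | h)
    exacts [h2 h, (h2 h).symm]

theorem ncard_lower_covers_root : {w : T.Rooted k | w ⋖ T.rleaf k k}.ncard = 1 := by
  rw [← (ncard_rgraph_eq_one_iff (T.rleaf k k)).2 ⟨k, rfl⟩]
  congr 1
  ext w
  rw [SimpleGraph.mem_neighborSet, adj_iff_covBy]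
  exact ⟨Or.inr, fun h => h.resolve_left fun h => h.1.not_ge (le_root w)⟩

theorem exists_upper_cover {v : T.Rooted k} (hv : v ≠ T.rleaf k k) :
    ∃ w : T.Rooted k, v ⋖ w := by
  obtain ⟨w, hw, -⟩ := exists_covBy_le_of_lt (lt_of_le_of_ne (le_root v) hv)
  exact ⟨w, hw⟩

/-- A vertex other than the root has one neighbour above it; the other ones are below. -/
theorem ncard_rgraph_eq {v : T.Rooted k} (hv : v ≠ T.rleaf k k) :
    ((T.rgraph k).neighborSet v).ncard = {w : T.Rooted k | w ⋖ v}.ncard + 1 := by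
  obtain ⟨p, hp⟩ := exists_upper_cover hv
  have : (T.rgraph k).neighborSet v = insert p {w : T.Rooted k | w ⋖ v} := by
    ext w
    rw [SimpleGraph.mem_neighborSet, adj_iff_covBy, Set.mem_insert_iff]
    refine or_congr_left ⟨fun h => ?_, fun h => h ▸ hp⟩
    rcases comparable_of_le h.1.le hp.1.le with h' | h'
    · exact h'.eq_of_not_lt fun hlt => hp.2 h.1 hlt
    · exact (h'.eq_of_not_lt fun hlt => h.2 hp.1 hlt).symm
  rw [this]
  exact Set.ncard_insert_of_notMem (fun h => lt_asymm h.1 hp.1) (Set.toFinite _)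

theorem isMin_rleaf {i : Fin n} (hi : i ≠ k) : IsMin (T.rleaf k i) := by
  have h1 := (ncard_rgraph_eq_one_iff (T.rleaf k i)).2 ⟨i, rfl⟩
  rw [ncard_rgraph_eq fun h => hi (rleaf_injective h), Nat.add_eq_right, Set.ncard_eq_zero] at h1
  rw [isMin_iff_forall_not_lt]
  intro w hw
  obtain ⟨c, -, hc⟩ := exists_le_covBy_of_lt hw
  exact Set.eq_empty_iff_forall_notMem.1 h1 c hc

theorem exists_lower_cover_root : ∃ c : T.Rooted k, c ⋖ T.rleaf k k ∧
    ∀ w : T.Rooted k, w < T.rleaf k k → w ≤ c := by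
  obtain ⟨c, hc⟩ := Set.ncard_eq_one.1 (ncard_lower_covers_root (T := T) (k := k))
  refine ⟨c, hc.ge rfl, fun w hw => ?_⟩
  obtain ⟨d, hwd, hd⟩ := exists_le_covBy_of_lt hw
  exact hwd.trans_eq (hc.le hd)

/-- Below each vertex there is a leaf other than the root. -/
theorem exists_rleaf_le (v : T.Rooted k) : ∃ i, i ≠ k ∧ T.rleaf k i ≤ v := by
  obtain ⟨m, hmv, hm⟩ := Finite.exists_le_minimal (p := fun _ : T.Rooted k => True) (a := v) trivial
  rw [minimal_true] at hm
  have hmk : m ≠ T.rleaf k k := by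
    rintro rfl
    obtain ⟨c, hc, -⟩ := exists_lower_cover_root (T := T) (k := k)
    exact hm.not_lt hc.1
  have h0 : {w : T.Rooted k | w ⋖ m} = ∅ :=
    Set.eq_empty_iff_forall_notMem.2 fun w hw => hm.not_lt hw.1
  have h1 : ((T.rgraph k).neighborSet m).ncard = 1 := by
    rw [ncard_rgraph_eq hmk, h0, Set.ncard_empty]
  obtain ⟨i, hi⟩ := (ncard_rgraph_eq_one_iff m).1 h1
  exact ⟨i, fun h => hmk (by rw [← hi, h]), le_of_eq_of_le hi hmv⟩

/-- As there are no 2-valent vertices, a vertex with another vertex below it has two lower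
neighbours. -/
theorem exists_other_lower_cover {c v : T.Rooted k} (hv : v ≠ T.rleaf k k) (hc : c ⋖ v) :
    ∃ c' : T.Rooted k, c' ⋖ v ∧ c' ≠ c := by
  by_contra! h
  have h1 : {w : T.Rooted k | w ⋖ v} = {c} := by
    ext w
    exact ⟨h w, fun hw => by rw [hw]; exact hc⟩
  apply ncard_rgraph_ne_two v
  rw [ncard_rgraph_eq hv, h1, Set.ncard_singleton]

open Classical in
/-- The set of the leaves below a vertex. -/
noncomputable def cluster (v : T.Rooted k) : Finset (Fin n) :=
  Finset.univ.filter fun i => T.rleaf k i ≤ v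

theorem mem_cluster {v : T.Rooted k} {i : Fin n} : i ∈ cluster v ↔ T.rleaf k i ≤ v := by
  simp [cluster]

theorem root_mem_cluster_iff {v : T.Rooted k} : k ∈ cluster v ↔ v = T.rleaf k k :=
  mem_cluster.trans ⟨fun h => (le_root v).antisymm h, fun h => h.ge⟩

theorem cluster_root : cluster (T.rleaf k k) = Finset.univ :=
  Finset.eq_univ_of_forall fun i => mem_cluster.2 (le_root (T.rleaf k i))

theorem cluster_rleaf {i : Fin n} (hi : i ≠ k) : cluster (T.rleaf k i) = {i} := by
  ext j
  rw [mem_cluster, Finset.mem_singleton]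
  exact ⟨fun h => rleaf_injective ((isMin_rleaf hi).eq_of_le h), fun h => h ▸ le_rfl⟩

/-- Two lower neighbours of `w` have disjoint sets of leaves, so `w` has a leaf that `v` has not. -/
theorem exists_mem_cluster_notMem {v w : T.Rooted k} (h : v < w) :
    ∃ i ∈ cluster w, i ∉ cluster v := by
  by_cases hw : w = T.rleaf k k
  · refine ⟨k, root_mem_cluster_iff.2 hw, fun hk => ?_⟩
    rw [root_mem_cluster_iff.1 hk, hw] at h
    exact lt_irrefl _ h
  · obtain ⟨c, hvc, hc⟩ := exists_le_covBy_of_lt h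
    obtain ⟨c', hc', hne⟩ := exists_other_lower_cover hw hc
    obtain ⟨i, -, hi⟩ := exists_rleaf_le c'
    refine ⟨i, mem_cluster.2 (hi.trans hc'.1.le), fun hiv => ?_⟩
    rcases comparable_of_le hi ((mem_cluster.1 hiv).trans hvc) with h' | h'
    · exact hc'.2 (lt_of_le_of_ne h' hne) hc.1
    · exact hc.2 (lt_of_le_of_ne h' hne.symm) hc'.1

/-- The tree order is inclusion of the sets of leaves below the vertices. -/
theorem cluster_subset_iff {v w : T.Rooted k} : cluster v ⊆ cluster w ↔ v ≤ w := by
  refine ⟨fun h => ?_, fun h i hi => mem_cluster.2 ((mem_cluster.1 hi).trans h)⟩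
  obtain ⟨i, -, hi⟩ := exists_rleaf_le v
  rcases comparable_of_le hi (mem_cluster.1 (h (mem_cluster.2 hi))) with h' | h'
  · exact h'
  · by_contra hne
    obtain ⟨j, hj, hj'⟩ := exists_mem_cluster_notMem (lt_of_le_not_ge h' hne)
    exact hj' (h hj)

open Classical in
/-- The hierarchy of the sets of leaves below the vertices of a marked tree. -/
noncomputable def hierarchy (T : MarkedTree n) (k : Fin n) : Finset (Finset (Fin n)) :=
  Finset.univ.filter fun A => ∃ v : T.Rooted k, v ≠ T.rleaf k k ∧ cluster v = A

theorem mem_hierarchy {A : Finset (Fin n)} :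
    A ∈ T.hierarchy k ↔ ∃ v : T.Rooted k, v ≠ T.rleaf k k ∧ cluster v = A := by
  simp [hierarchy]

theorem isHierarchy_hierarchy (T : MarkedTree n) (k : Fin n) : IsHierarchy k (T.hierarchy k) where
  root_mem := by
    obtain ⟨c, hc, hmax⟩ := exists_lower_cover_root (T := T) (k := k)
    refine mem_hierarchy.2 ⟨c, hc.1.ne, ?_⟩
    ext i
    rw [mem_cluster, mem_rootCluster]
    constructor
    · rintro h rfl
      exact hc.1.not_ge h
    · exact fun hi => hmax _ (lt_of_le_of_ne (le_root _) fun h => hi (rleaf_injective h))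
  singleton_mem i hi :=
    mem_hierarchy.2 ⟨T.rleaf k i, fun h => hi (rleaf_injective h), cluster_rleaf hi⟩
  nonempty A hA := by
    obtain ⟨v, -, rfl⟩ := mem_hierarchy.1 hA
    obtain ⟨i, -, hi⟩ := exists_rleaf_le v
    exact ⟨i, mem_cluster.2 hi⟩
  notMem A hA := by
    obtain ⟨v, hv, rfl⟩ := mem_hierarchy.1 hA
    exact fun h => hv (root_mem_cluster_iff.1 h)
  laminar A hA B hB := by
    obtain ⟨v, -, rfl⟩ := mem_hierarchy.1 hA
    obtain ⟨w, -, rfl⟩ := mem_hierarchy.1 hB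
    by_cases h : Disjoint (cluster v) (cluster w)
    · exact Or.inr (Or.inr h)
    · obtain ⟨i, hi, hi'⟩ := Finset.not_disjoint_iff.1 h
      rcases comparable_of_le (mem_cluster.1 hi) (mem_cluster.1 hi') with h | h
      exacts [Or.inl (cluster_subset_iff.2 h), Or.inr (Or.inl (cluster_subset_iff.2 h))]

/-- The vertices of a marked tree are the nodes of its hierarchy. -/
noncomputable def nodeIso (T : MarkedTree n) (k : Fin n) : T.Rooted k ≃o Node (T.hierarchy k) where
  toEquiv := Equiv.ofBijective
    (fun v => ⟨cluster v, by
      by_cases hv : v = T.rleaf k k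
      · rw [hv, cluster_root]
        exact Finset.mem_insert_self _ _
      · exact Finset.mem_insert_of_mem (mem_hierarchy.2 ⟨v, hv, rfl⟩)⟩) (by
    constructor
    · intro v w h
      have h' : cluster v = cluster w := congrArg Subtype.val h
      exact (cluster_subset_iff.1 h'.subset).antisymm (cluster_subset_iff.1 h'.symm.subset)
    · rintro ⟨A, hA⟩
      rcases Finset.mem_insert.1 hA with rfl | hA
      · exact ⟨T.rleaf k k, Subtype.ext cluster_root⟩
      · obtain ⟨v, -, rfl⟩ := mem_hierarchy.1 hA
        exact ⟨v, rfl⟩)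
  map_rel_iff' := cluster_subset_iff

/-- A marked tree is determined by its hierarchy. -/
theorem iso_markedTree (T : MarkedTree n) (k : Fin n) (hn : 3 ≤ n) :
    T.Iso ((T.isHierarchy_hierarchy k).markedTree hn) := by
  refine ⟨⟨(T.nodeIso k).toEquiv, ?_⟩, fun i => Subtype.ext ?_⟩
  · intro v w
    refine Iff.trans ?_ (adj_iff_covBy (k := k)).symm
    exact or_congr (apply_covBy_apply_iff (T.nodeIso k)) (apply_covBy_apply_iff (T.nodeIso k))
  · change cluster (T.rleaf k i) = ((T.isHierarchy_hierarchy k).leafNode i).1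
    by_cases hi : i = k
    · subst hi
      rw [cluster_root, IsHierarchy.leafNode_root]
      rfl
    · rw [cluster_rleaf hi, IsHierarchy.leafNode_of_ne _ hi]

end MarkedTree

/-! ### The faces of the moduli space -/

namespace MarkedTree

variable {n : ℕ}

theorem Iso.symm {S T : MarkedTree n} (h : S.Iso T) : T.Iso S := by
  obtain ⟨φ, hl⟩ := h
  exact ⟨φ.symm, fun i => by rw [← hl i]; simp⟩

theorem Iso.trans {S T U : MarkedTree n} (h : S.Iso T) (h' : T.Iso U) : S.Iso U := by
  obtain ⟨φ, hl⟩ := h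
  obtain ⟨ψ, hl'⟩ := h'
  exact ⟨φ.trans ψ, fun i => by simp [hl, hl']⟩

theorem Iso.stratum_eq {S T : MarkedTree n} (h : S.Iso T) :
    TropicalModuli.stratum S = TropicalModuli.stratum T := by
  ext x
  exact ⟨fun ⟨X, hX, hS⟩ => ⟨X, hX, hS.trans h⟩, fun ⟨X, hX, hT⟩ => ⟨X, hX, hT.trans h.symm⟩⟩

theorem Iso.exists_adj_leaf_valence {S T : MarkedTree n} (h : S.Iso T) {k : Fin n} {m : ℕ}
    (hS : ∃ v, S.graph.Adj (S.leaf k) v ∧ S.valence v = m) :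
    ∃ v, T.graph.Adj (T.leaf k) v ∧ T.valence v = m := by
  obtain ⟨φ, hl⟩ := h
  obtain ⟨v, hadj, hv⟩ := hS
  refine ⟨φ v, hl k ▸ φ.map_rel_iff.2 hadj, ?_⟩
  rw [← hv]
  exact (Nat.card_congr (φ.mapNeighborSet v)).symm

end MarkedTree

namespace TropicalCurve

variable {n : ℕ}

/-- The bounded edges of curves of the same combinatorial type correspond to each other. -/
def boundedEdgeEquiv {X Y : TropicalCurve n} (φ : X.graph ≃g Y.graph)
    (hl : ∀ i, φ (X.leaf i) = Y.leaf i) : X.BoundedEdge ≃ Y.BoundedEdge where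
  toFun e := ⟨_, edge_map φ hl e⟩
  invFun e := ⟨_, edge_map φ.symm (fun i => by rw [← hl i]; simp) e⟩
  left_inv e := Subtype.ext (by
    change Sym2.map φ.symm (Sym2.map φ e.1) = e.1
    rw [Sym2.map_map]
    have : (φ.symm : Y.V → X.V) ∘ (φ : X.V → Y.V) = id := by ext; simp
    rw [this, Sym2.map_id, id])
  right_inv e := Subtype.ext (by
    change Sym2.map φ (Sym2.map φ.symm e.1) = e.1
    rw [Sym2.map_map]
    have : (φ : X.V → Y.V) ∘ (φ.symm : Y.V → X.V) = id := by ext; simp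
    rw [this, Sym2.map_id, id])

end TropicalCurve

theorem MarkedTree.Iso.card_boundedEdge {n : ℕ} {S T : MarkedTree n} (h : S.Iso T) :
    Nat.card S.BoundedEdge = Nat.card T.BoundedEdge := by
  obtain ⟨φ, hl⟩ := h
  let X : TropicalCurve n := ⟨S, fun _ => 1, fun _ => one_pos⟩
  let Y : TropicalCurve n := ⟨T, fun _ => 1, fun _ => one_pos⟩
  exact Nat.card_congr (TropicalCurve.boundedEdgeEquiv (X := X) (Y := Y) φ hl)

namespace IsHierarchy

variable {n : ℕ} {k : Fin n} {N : Finset (Finset (Fin n))}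

/-- A hierarchy is generated by its members that are neither singletons nor the root cluster. -/
theorem exists_isClusterSystem (hN : IsHierarchy k N) :
    ∃ M, IsClusterSystem k M ∧ nodes k M = N := by
  refine ⟨N.filter fun A => 2 ≤ A.card ∧ A ≠ rootCluster k, ⟨?_, ?_, ?_, ?_⟩, ?_⟩
  · exact fun A hA => hN.notMem A (Finset.mem_filter.1 hA).1
  · exact fun A hA => (Finset.mem_filter.1 hA).2.1
  · exact fun A hA => (Finset.mem_filter.1 hA).2.2
  · exact fun A hA B hB => hN.laminar A (Finset.mem_filter.1 hA).1 B (Finset.mem_filter.1 hB).1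
  · ext A
    rw [mem_nodes, Finset.mem_filter]
    constructor
    · rintro (rfl | hA | ⟨i, hi, rfl⟩)
      exacts [hN.root_mem, hA.1, hN.singleton_mem i hi]
    · intro hA
      by_cases hroot : A = rootCluster k
      · exact Or.inl hroot
      rcases Nat.lt_or_ge A.card 2 with h | h
      · have hpos := Finset.card_pos.2 (hN.nonempty A hA)
        obtain ⟨i, rfl⟩ := Finset.card_eq_one.1 (show A.card = 1 by omega)
        exact Or.inr (Or.inr ⟨i, fun h => hN.notMem _ hA (by simp [h]), rfl⟩)
      · exact Or.inr (Or.inl ⟨hA, h, hroot⟩)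

end IsHierarchy

namespace IsClusterSystem

variable {n : ℕ} {k : Fin n} {M : Finset (Finset (Fin n))}

/-- The marked tree of a cluster system. -/
def tree (hM : IsClusterSystem k M) (hn : 3 ≤ n) : MarkedTree n :=
  (hM.isHierarchy (by omega)).markedTree hn

/-- The bounded edges join the members of the system to their parents: the edge above a singleton or
above the root cluster is a leaf edge. -/
theorem exists_eq_of_boundedEdge (hM : IsClusterSystem k M) (hn : 3 ≤ n)
    (e : (hM.tree hn).BoundedEdge) :
    ∃ A P : Node (nodes k M), A.1 ∈ M ∧ A ⋖ P ∧ e.1 = s(A, P) := by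
  have hN := hM.isHierarchy (by omega)
  have main : ∀ A P : Node (nodes k M), A ⋖ P →
      (∀ i, (hM.tree hn).leaf i ∉ (s(A, P) : Sym2 (Node (nodes k M)))) → A.1 ∈ M := by
    intro A P hAP hleaf
    have hAN : A.1 ∈ nodes k M := IsHierarchy.mem_of_ne_top fun h =>
      hAP.1.not_ge (h ▸ IsHierarchy.le_topNode P)
    rcases mem_nodes.1 hAN with h | h | ⟨i, hi, h⟩
    · have htop := hN.covBy_topNode_iff.2 h
      have hP : P = IsHierarchy.topNode _ :=
        (hN.le_of_covBy_of_lt hAP htop.1).antisymm (hN.le_of_covBy_of_lt htop hAP.1)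
      refine absurd (Sym2.mem_iff.2 (Or.inr ?_)) (hleaf k)
      rw [hP]
      exact hN.leafNode_root
    · exact h
    · refine absurd (Sym2.mem_iff.2 (Or.inl ?_)) (hleaf i)
      exact Subtype.ext ((hN.leafNode_of_ne hi).trans h.symm)
  obtain ⟨e, he, hleaf⟩ := e
  induction e with
  | _ u v =>
    rcases (he : (SimpleGraph.hasse (Node (nodes k M))).Adj u v) with h | h
    · exact ⟨u, v, main u v h hleaf, h, rfl⟩
    · exact ⟨v, u, main v u h (fun i hi => hleaf i (Sym2.eq_swap (a := v) (b := u) ▸ hi)), h, Sym2.eq_swap⟩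

variable (hM : IsClusterSystem k M) (hn : 3 ≤ n)

theorem boundedEdge_of_covBy {A P : Node (nodes k M)} (hA : A.1 ∈ M) (hP : A ⋖ P) :
    (s(A, P) : Sym2 (Node (nodes k M))) ∈ (hM.tree hn).graph.edgeSet ∧
      ∀ i, (hM.tree hn).leaf i ∉ (s(A, P) : Sym2 (Node (nodes k M))) := by
  have hN := hM.isHierarchy (by omega)
  refine ⟨Or.inl hP, fun i hi => ?_⟩
  have hA2 := hM.two_le _ hA
  rcases Sym2.mem_iff.1 hi with h | h
  · have h' : hN.leafNode i = A := h
    by_cases hik : i = k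
    · subst hik
      rw [hN.leafNode_root] at h'
      exact hM.notMem _ hA (h' ▸ Finset.mem_univ i)
    · rw [← h', hN.leafNode_of_ne hik, Finset.card_singleton] at hA2
      omega
  · have h' : hN.leafNode i = P := h
    by_cases hik : i = k
    · subst hik
      rw [hN.leafNode_root] at h'
      rw [← h', hN.covBy_topNode_iff] at hP
      exact hM.ne_root _ hA hP
    · have hlt : A.1 ⊂ P.1 := hP.1
      have := Finset.card_lt_card hlt
      rw [← h', hN.leafNode_of_ne hik, Finset.card_singleton] at this
      omega

/-- The lower end of a bounded edge, which is the set of the leaves beyond this edge. -/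
def lowerEnd (e : (hM.tree hn).BoundedEdge) : Finset (Fin n) :=
  (Sym2.map (Subtype.val : Node (nodes k M) → Finset (Fin n)) e.1).inf

theorem lowerEnd_eq {A P : Node (nodes k M)} (hP : A ⋖ P) (e : (hM.tree hn).BoundedEdge)
    (he : e.1 = s(A, P)) : hM.lowerEnd hn e = A.1 := by
  rw [lowerEnd, he]
  exact inf_eq_left.2 hP.1.le

theorem lowerEnd_mem (e : (hM.tree hn).BoundedEdge) : hM.lowerEnd hn e ∈ M := by
  obtain ⟨A, P, hA, hP, he⟩ := hM.exists_eq_of_boundedEdge hn e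
  rw [hM.lowerEnd_eq hn hP e he]
  exact hA

/-- The bounded edges of the tree correspond to the members of the cluster system. -/
noncomputable def edgeEquiv : (hM.tree hn).BoundedEdge ≃ M :=
  Equiv.ofBijective (fun e => ⟨hM.lowerEnd hn e, hM.lowerEnd_mem hn e⟩) (by
    have hN := hM.isHierarchy (by omega)
    constructor
    · intro e e' h
      have h' : hM.lowerEnd hn e = hM.lowerEnd hn e' := congrArg Subtype.val h
      obtain ⟨A, P, hA, hP, he⟩ := hM.exists_eq_of_boundedEdge hn e
      obtain ⟨A', P', hA', hP', he'⟩ := hM.exists_eq_of_boundedEdge hn e'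
      rw [hM.lowerEnd_eq hn hP e he, hM.lowerEnd_eq hn hP' e' he', ← Subtype.ext_iff] at h'
      subst h'
      have hPP : P = P' :=
        (hN.le_of_covBy_of_lt hP hP'.1).antisymm (hN.le_of_covBy_of_lt hP' hP.1)
      exact Subtype.ext (by rw [he, he', hPP])
    · rintro ⟨A, hA⟩
      let A' : Node (nodes k M) := ⟨A, Finset.mem_insert_of_mem (mem_nodes_of_mem hA)⟩
      obtain ⟨P, hP⟩ := hN.exists_covBy (A := A') fun h =>
        hM.notMem A hA (by
          have h' : A = Finset.univ := congrArg Subtype.val h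
          rw [h']
          exact Finset.mem_univ k)
      exact ⟨⟨_, hM.boundedEdge_of_covBy hn (A := A') hA hP⟩,
        Subtype.ext (hM.lowerEnd_eq hn hP _ rfl)⟩)

theorem card_boundedEdge : Nat.card (hM.tree hn).BoundedEdge = M.card := by
  rw [Nat.card_congr (hM.edgeEquiv hn), Nat.card_eq_fintype_card, Fintype.card_coe]

theorem sign_tree (a b c d : Fin n) (e : (hM.tree hn).BoundedEdge) :
    (hM.tree hn).sign a b c d e = splitSign (hM.lowerEnd hn e) a b c d := by
  obtain ⟨A, P, hA, hP, he⟩ := hM.exists_eq_of_boundedEdge hn e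
  rw [hM.lowerEnd_eq hn hP e he]
  exact (hM.isHierarchy (by omega)).sign_eq_splitSign hn (mem_nodes_of_mem hA) hP a b c d e he

/-- The curve with the tree of a cluster system and the given edge lengths. -/
def curve (t : Finset (Fin n) → ℝ) (ht : ∀ A ∈ M, 0 < t A) : TropicalCurve n where
  toMarkedTree := hM.tree hn
  length e := t (hM.lowerEnd hn e)
  length_pos e := ht _ (hM.lowerEnd_mem hn e)

/-- The double ratios of a curve are the combination of the split vectors of its edges with the
lengths as coefficients. -/
theorem embedding_curve {t : Finset (Fin n) → ℝ} (ht : ∀ A ∈ M, 0 < t A)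
    (ht0 : ∀ A ∉ M, t A = 0) :
    TropicalModuli.embedding n (Quotient.mk _ (hM.curve hn t ht)) = combine splitVector t := by
  funext q
  change ∑ᶠ e : (hM.tree hn).BoundedEdge, ((hM.tree hn).sign _ _ _ _ e : ℝ) * t (hM.lowerEnd hn e)
    = _
  have h1 := finsum_comp_equiv (hM.edgeEquiv hn) (f := fun A : M =>
    (splitVector A.1 q : ℝ) * t A.1)
  rw [combine_apply_coord, ← Finset.sum_subset (Finset.subset_univ M)
    (fun A _ hA => by rw [ht0 A hA, zero_mul]), ← Finset.sum_coe_sort M, ← finsum_eq_sum_of_fintype]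
  refine Eq.trans (finsum_congr fun e => ?_) (h1.trans (finsum_congr fun A => mul_comm _ _))
  rw [sign_tree]
  rfl

/-- Curves of the same combinatorial type correspond to positive edge lengths. -/
theorem embedding_image_stratum :
    TropicalModuli.embedding n '' TropicalModuli.stratum (hM.tree hn)
      = {x | ∃ t : Finset (Fin n) → ℝ, (∀ A ∈ M, 0 < t A) ∧ (∀ A ∉ M, t A = 0) ∧
          combine splitVector t = x} := by
  classical
  ext x
  constructor
  · rintro ⟨_, ⟨X, rfl, φ, hl⟩, rfl⟩
    -- The lengths of the edges of `X` are carried over to the tree of the cluster system.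
    let Y₀ : TropicalCurve n := hM.curve hn (fun _ => 1) fun _ _ => one_pos
    let E : X.BoundedEdge ≃ (hM.tree hn).BoundedEdge :=
      TropicalCurve.boundedEdgeEquiv (X := X) (Y := Y₀) φ hl
    let t : Finset (Fin n) → ℝ := fun A =>
      if hA : A ∈ M then X.length (E.symm ((hM.edgeEquiv hn).symm ⟨A, hA⟩)) else 0
    have ht : ∀ A ∈ M, 0 < t A := fun A hA => by
      simp only [t, dif_pos hA]
      exact X.length_pos _
    have ht0 : ∀ A ∉ M, t A = 0 := fun A hA => by simp only [t, dif_neg hA]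
    refine ⟨t, ht, ht0, ?_⟩
    rw [← hM.embedding_curve hn ht ht0]
    refine congrArg _ (Quotient.sound (Setoid.symm ?_))
    have key : ∀ (e : X.BoundedEdge) (e' : (hM.tree hn).BoundedEdge), e' = E e →
        X.length e = t (hM.lowerEnd hn e') := by
      rintro e _ rfl
      have h : (⟨hM.lowerEnd hn (E e), hM.lowerEnd_mem hn (E e)⟩ : M) = hM.edgeEquiv hn (E e) := rfl
      simp only [t, dif_pos (hM.lowerEnd_mem hn (E e))]
      rw [h, Equiv.symm_apply_apply, Equiv.symm_apply_apply]
    exact ⟨φ, hl, fun e e' he => key e e' (Subtype.ext he)⟩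
  · rintro ⟨t, ht, ht0, rfl⟩
    exact ⟨_, ⟨hM.curve hn t ht, rfl, RelIso.refl _, fun _ => rfl⟩, hM.embedding_curve hn ht ht0⟩

end IsClusterSystem

theorem IsIntegerPolyhedron.isClosed {ι : Type*} [Fintype ι] {P : Set (ι → ℝ)}
    (h : IsIntegerPolyhedron P) : IsClosed P := by
  obtain ⟨m, a, b, rfl⟩ := h
  rw [Set.ofPred_forall]
  exact isClosed_iInter fun j => isClosed_le (by fun_prop) continuous_const

namespace IsClusterSystem

variable {n : ℕ} {k : Fin n} {M : Finset (Finset (Fin n))}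

/-- The face of the moduli space that belongs to a cluster system is embedded as a simplicial cone.
The points of the boundary come from subsystems, that is, from contracting edges. -/
theorem embedding_image_face (hM : IsClusterSystem k M) (hn : 3 ≤ n) :
    TropicalModuli.embedding n '' TropicalModuli.face (hM.tree hn)
      = simplicialCone splitVector M := by
  classical
  have hind : Topology.IsInducing (TropicalModuli.embedding n) := ⟨rfl⟩
  rw [TropicalModuli.face, hind.closure_eq_preimage_closure_image, Set.image_preimage_eq_inter_range,
    hM.embedding_image_stratum hn]
  obtain ⟨f, hf⟩ := hM.exists_isDualOn (by omega)
  apply Set.Subset.antisymm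
  · refine Set.inter_subset_left.trans (closure_minimal ?_ hf.isIntegerPolyhedron.isClosed)
    rintro _ ⟨t, ht, ht0, rfl⟩
    refine ⟨t, fun A => ?_, ht0, rfl⟩
    by_cases hA : A ∈ M
    exacts [(ht A hA).le, (ht0 A hA).ge]
  · rintro _ ⟨t, t0, ht, rfl⟩
    constructor
    · let g : ℝ → (PairOfPairs n → ℝ) := fun ε =>
        combine splitVector (t + ε • fun A => if A ∈ M then 1 else 0)
      have hg : Continuous g := by
        have := (combine (splitVector (n := n))).continuous_of_finiteDimensional
        fun_prop
      have hlim : Filter.Tendsto g (nhdsWithin 0 (Set.Ioi 0)) (nhds (combine splitVector t)) := by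
        have h0 : g 0 = combine splitVector t := by simp [g]
        rw [← h0]
        exact hg.continuousAt.tendsto.mono_left nhdsWithin_le_nhds
      refine mem_closure_of_tendsto hlim (Filter.eventually_of_mem self_mem_nhdsWithin ?_)
      intro ε hε
      refine ⟨_, fun A hA => ?_, fun A hA => ?_, rfl⟩
      · simpa [hA] using add_pos_of_nonneg_of_pos (t0 A) hε
      · simp [hA, ht A hA]
    · have hM' := hM.mono (Finset.filter_subset (fun A => 0 < t A) M)
      refine ⟨_, hM'.embedding_curve hn (t := t) (fun A hA => (Finset.mem_filter.1 hA).2) ?_⟩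
      intro A hA
      by_contra hne
      have hAM : A ∈ M := by_contra fun h => hne (ht A h)
      exact hA (Finset.mem_filter.2 ⟨hAM, lt_of_le_of_ne (t0 A) (Ne.symm hne)⟩)

end IsClusterSystem

/-- The facets of the `ψ_k`-divisor are the simplicial cones of the family `psiFamily n k`. -/
theorem psiFacets_eq {n : ℕ} (hn : 4 ≤ n) (k : Fin n) :
    psiFacets n k = simplicialCone splitVector '' psiFamily n k := by
  have hn3 : 3 ≤ n := by omega
  ext P
  constructor
  · rintro ⟨_, ⟨T, hcard, hval, rfl⟩, rfl⟩
    obtain ⟨M, hM, hMN⟩ := (T.isHierarchy_hierarchy k).exists_isClusterSystem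
    have hiso : T.Iso (hM.tree hn3) := by
      have hmain : ∀ (N : Finset (Finset (Fin n))) (hN : IsHierarchy k N), nodes k M = N →
          T.Iso (hN.markedTree hn3) → T.Iso (hM.tree hn3) := by
        rintro _ hN rfl h
        exact h
      exact hmain _ _ hMN (T.iso_markedTree k hn3)
    refine ⟨M, ⟨hM, ?_, ?_⟩, ?_⟩
    · have h := hiso.card_boundedEdge
      rw [hM.card_boundedEdge hn3] at h
      omega
    · exact ((hM.isHierarchy (by omega)).exists_adj_leaf_valence_iff hn3).1
        (hiso.exists_adj_leaf_valence hval)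
    · rw [TropicalModuli.face, hiso.stratum_eq]
      exact (hM.embedding_image_face hn3).symm
  · rintro ⟨M, ⟨hM, hcard, hval⟩, rfl⟩
    refine ⟨_, ⟨hM.tree hn3, ?_, ?_, rfl⟩, (hM.embedding_image_face hn3).symm⟩
    · rw [hM.card_boundedEdge hn3, hcard]
    · exact ((hM.isHierarchy (by omega)).exists_adj_leaf_valence_iff hn3).2 hval

theorem mainTheorem3 (n : ℕ) (hn : 4 ≤ n) (k : Fin n) :
    IsTropicalCycle (n - 4) (psiFacets n k) (psiWeight n) := by
  rw [psiFacets_eq hn k]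
  exact (isBalancedFan_psiFamily hn k).isTropicalCycle
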